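/- **Source calculus.** Let $\mathcal N$ be a countably infinite set of names. Processes of $\Pi_{\mathtt{Stop}}$ are $P,Q ::= \nu x.P \mid \bar x(y).P \mid x(y).P \mid\, !P \mid P\,|\,Q \mid 0 \mid \mathtt{Stop}$ ($\bar x(y).P$ sends the name $y$ on $x$; $\nu x.P$ and $z(x).P$ bind $x$ in $P$). Structural congruence $\equiv$ is the least congruence that contains $\alpha$-equivalence and $P|(Q|R)\equiv(P|Q)|R$, $P|Q\equiv Q|P$, $P|0\equiv P$, $\nu x.(P|Q)\equiv P|\nu x.Q$ if $x$ is not free in $P$, $\nu x.0\equiv 0$, $\nu x.\mathtt{Stop}\equiv\mathtt{Stop}$, $\nu x.\nu y.P\equiv\nu y.\nu x.P$, $!P\equiv P\,|\,!P$. With $D ::= [\cdot]\mid D|P\mid P|D\mid \nu x.D$, standard reduction is: $P\to Q$ iff $P\equiv D[x(y).P_1\,|\,\bar x(z).P_2]$ and $Q\equiv D[P_1[z/y]\,|\,P_2]$ for some $D$. A process is successful if it is $\equiv D[\mathtt{Stop}]$ for some $D$. $P{\downarrow}$ (may-convergence) means that $P\to^* P'$ for some successful $P'$; $P{\Downarrow}$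 (should-convergence) means that $P'{\downarrow}$ whenever $P\to^*P'$. Contexts $C$ are processes with one hole, at any position; plugging may capture names. Put $P\le_c P'$ iff for all contexts $C$: $C[P]{\downarrow}\Rightarrow C[P']{\downarrow}$ and $C[P]{\Downarrow}\Rightarrow C[P']{\Downarrow}$. **Target calculus $\mathit{CH}$.** It is a monomorphically typed core of Concurrent Haskell. Its data types are $()$, $\mathtt{Bool}$, $\mathtt{List}$, $\mathtt{Pair}$, $\mathtt{Channel}$ with $\mathtt{data\ Channel = Chan\ (MVar\ (Channel, MVar\ ()))}$, and any further family of data types with finitely many constructors each. Expressions are $e ::= x \mid \lambda x.e \mid e_1\,e_2 \mid c\,e_1\dots e_{ar(c)} \mid \mathtt{letrec}\ x_1{=}e_1,\dots,x_n{=}e_n\ \mathtt{in}\ e \mid \mathtt{case}_T\ e\ \mathtt{of}\ \mathit{alts} \mid \mathtt{seq}\ e_1\,e_2 \mid \mathtt{return}\ e \mid e_1 \mathbin{>\!\!>\!\!=} e_2 \mid \mathtt{forkIO}\ e \mid \mathtt{takeMVar}\ e \mid \mathtt{newMVar}\ e \mid \mathtt{putMVar}\ e_1\,e_2$, with the usual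 typing rules; the first argument of $\mathtt{seq}$ has a function type or a data type. Processes are $P ::= P_1|P_2 \mid {\Leftarrow}\,e \mid \nu x.P \mid x\,\mathbf m\,e \mid x\,\mathbf m\,{-} \mid x=e$ (threads, filled and empty MVars, heap bindings), where a thread may be marked as the main thread ${\Leftarrow_{\mathrm{main}}}\,e$. A process is well-formed if its introduced variables (names of MVars, left hand sides of bindings) are pairwise distinct and it has at most one main thread. Structural congruence is the least congruence generated by $\alpha$-equivalence, associativity and commutativity of $|$, exchange of adjacent $\nu$, and $(\nu x.P_1)|P_2\equiv\nu x.(P_1|P_2)$ for $x$ not free in $P_2$. Let $M ::= [\cdot]\mid M\mathbin{>\!\!>\!\!=}e$, $E ::= [\cdot]\mid E\,e\mid \mathtt{seq}\,E\,e\mid\mathtt{case}\,E\,\mathtt{of}\,\mathit{alts}$, $F ::= E\mid\mathtt{takeMVar}\,E\mid\mathtt{putMVar}\,E\,e$. The rules, for main and other threads alike, are * ${\Leftarrow}M[F[x]]\,|\,x{=}e\to{\Leftarrow}M[F[e]]\,|\,x{=}e$; * ${\Leftarrow}M[F[\mathtt{letrec}\,x_1{=}e_1,\dots,x_n{=}e_n\,\mathtt{in}\,e]]\to\nu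 x_1\dots x_n.({\Leftarrow}M[F[e]]\,|\,x_1{=}e_1|\dots|x_n{=}e_n)$; * ${\Leftarrow}M[F[(\lambda x.e_1)\,e_2]]\to{\Leftarrow}M[F[e_1[e_2/x]]]$; * ${\Leftarrow}M[F[\mathtt{case}_T\,(c\,e_1\dots e_n)\,\mathtt{of}\dots(c\,y_1\dots y_n\to e)\dots]]\to{\Leftarrow}M[F[e[e_1/y_1,\dots,e_n/y_n]]]$; * ${\Leftarrow}M[F[\mathtt{seq}\,v\,e]]\to{\Leftarrow}M[F[e]]$ for $v$ an abstraction or a constructor application; * ${\Leftarrow}M[\mathtt{return}\,e_1\mathbin{>\!\!>\!\!=}e_2]\to{\Leftarrow}M[e_2\,e_1]$; * ${\Leftarrow}M[\mathtt{takeMVar}\,x]\,|\,x\,\mathbf m\,e\to{\Leftarrow}M[\mathtt{return}\,e]\,|\,x\,\mathbf m\,{-}$; * ${\Leftarrow}M[\mathtt{putMVar}\,x\,e]\,|\,x\,\mathbf m\,{-}\to{\Leftarrow}M[\mathtt{return}\,()]\,|\,x\,\mathbf m\,e$; * ${\Leftarrow}M[\mathtt{newMVar}\,e]\to\nu x.({\Leftarrow}M[\mathtt{return}\,x]\,|\,x\,\mathbf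 m\,e)$; * ${\Leftarrow}M[\mathtt{forkIO}\,e]\to{\Leftarrow}M[\mathtt{return}\,()]\,|\,{\Leftarrow}e$, where the new thread is not a main thread. A process is successful if it is well-formed and $\equiv\nu x_1\dots x_n.({\Leftarrow_{\mathrm{main}}}\,\mathtt{return}\,e\,|\,P')$, where $P'$ may be absent. Standard reduction is the closure of the rules under contexts $[\cdot]$, $D|P$, $P|D$, $\nu x.D$ and under $\equiv$, restricted to well-formed, not successful processes. ${\downarrow}$ and ${\Downarrow}$ are defined as above and in addition require well-formedness. **Translation.** In $\mathtt{do}$-notation, with $\bot=\mathtt{letrec}\ x=x\ \mathtt{in}\ x$, $\mathit{unchan}\,e=\mathtt{case}\ e\ \mathtt{of}\ (\mathtt{Chan}\,m\to m)$, and a fixed variable $\mathit{stop}$ that is not a channel name, * $\tau(\bar x(y).P)=\mathtt{do}\{k\leftarrow\mathtt{newMVar}\,();\ \mathtt{putMVar}\,(\mathit{unchan}\,x)\,(y,k);\ \mathtt{putMVar}\,k\,();\ \tau(P)\}$, * $\tau(x(y).P)=\mathtt{do}\{(y,k)\leftarrow\mathtt{takeMVar}\,(\mathit{unchan}\,x);\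 \mathtt{takeMVar}\,k;\ \tau(P)\}$, * $\tau(P|Q)=\mathtt{do}\{\mathtt{forkIO}\,\tau(Q);\ \tau(P)\}$, * $\tau(\nu x.P)=\mathtt{do}\{m\leftarrow\mathtt{newMVar}\,\bot;\ \mathtt{takeMVar}\,m;\ \mathtt{letrec}\ x=\mathtt{Chan}\,m\ \mathtt{in}\ \tau(P)\}$, * $\tau(0)=\mathtt{return}\,()$, $\tau(\mathtt{Stop})=\mathtt{takeMVar}\,\mathit{stop}$, * $\tau(!P)=\mathtt{letrec}\ f=\mathtt{do}\{\mathtt{forkIO}\,\tau(P);\ f\}\ \mathtt{in}\ f$ ($k,m,f$ fresh). For an expression $e$ let $C_{out}[e]=\nu\,\mathit{stop}.\,{\Leftarrow_{\mathrm{main}}}\,\mathtt{do}\{\mathit{stop}\leftarrow\mathtt{newMVar}\,();\ \mathtt{forkIO}\,e;\ \mathtt{putMVar}\,\mathit{stop}\,()\}$, and let $e{\downarrow_0}$, $e{\Downarrow_0}$ mean $C_{out}[e]{\downarrow}$, $C_{out}[e]{\Downarrow}$. For expressions $e_1,e_2$ of type $\mathtt{IO}\,()$ put $e_1\le_{c,\tau_0}e_2$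 iff for all well-typed expression contexts $C$ of type $\mathtt{IO}\,()$, with hole of type $\mathtt{IO}\,()$, such that at most $\mathit{stop}::\mathtt{MVar}\,()$ occurs free in $C[e_1]$ and $C[e_2]$: $C[e_1]{\downarrow_0}\Rightarrow C[e_2]{\downarrow_0}$ and $C[e_1]{\Downarrow_0}\Rightarrow C[e_2]{\Downarrow_0}$. **Theorem.** The open translation $\tau$ is adequate: for all (possibly open) processes $P,P'\in\Pi_{\mathtt{Stop}}$, if $\tau(P)\le_{c,\tau_0}\tau(P')$ then $P\le_c P'$. -/

import Mathlib

/-! ## Names, binders and renamings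

Both calculi are represented up to alpha-equivalence: variables are natural numbers, and below `n`
simultaneously bound variables the indices `0, …, n-1` denote the bound variables, while the
index `x + n` denotes the variable that is called `x` outside.  A number that is not bound is the
*name* of a free variable. -/

/-- Bind the name `x`: the map from names to the indices below a binder for `x`. -/
def bindName (x : ℕ) : ℕ → ℕ := fun y => if y = x then 0 else y + 1

open Classical in
/-- Bind the (pairwise distinct) names `xs 0, …, xs (n-1)` simultaneously. -/
noncomputable def bindNames {n : ℕ} (xs : Fin n → ℕ) : ℕ → ℕ :=
  fun y => if h : ∃ i, xs i = y then (h.choose : ℕ) else y + n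

/-- A renaming, transported below `n` binders. -/
def upRen (n : ℕ) (r : ℕ → ℕ) : ℕ → ℕ := fun y => if y < n then y else r (y - n) + n

/-- Replace the index `0` of the innermost binder by `z`, removing that binder. -/
def instName (z : ℕ) : ℕ → ℕ
  | 0 => z
  | y + 1 => y

/-- Exchange the two innermost binders. -/
def swapName : ℕ → ℕ
  | 0 => 1
  | 1 => 0
  | y + 2 => y + 2

/-- Environment extension: the bound variable `0` is sent to `a`, the other ones to `r`. -/
def consName (a : ℕ) (r : ℕ → ℕ) : ℕ → ℕ
  | 0 => a
  | y + 1 => r y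

/-! ## The synchronous pi-calculus with a success constant -/

/-- Processes. `nu P` is `νx.P`, `out x y P` is the output of `y` on `x`, continued by `P`,
`inp x P` is the input `x(y).P`; `nu` and `inp` bind one name in `P`. -/
inductive PiProc : Type
  | nu (P : PiProc)
  | out (x y : ℕ) (P : PiProc)
  | inp (x : ℕ) (P : PiProc)
  | bang (P : PiProc)
  | par (P Q : PiProc)
  | zero
  | success

namespace PiProc

def rename : (ℕ → ℕ) → PiProc → PiProc
  | r, nu P => nu (rename (upRen 1 r) P)
  | r, out x y P => out (r x) (r y) (rename r P)
  | r, inp x P => inp (r x) (rename (upRen 1 r) P)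
  | r, bang P => bang (rename r P)
  | r, par P Q => par (rename r P) (rename r Q)
  | _, zero => zero
  | _, success => success

/-- `νx.P` for a name `x`. -/
def nuName (x : ℕ) (P : PiProc) : PiProc := nu (P.rename (bindName x))

/-- `x(y).P` for names `x` and `y`. -/
def inpName (x y : ℕ) (P : PiProc) : PiProc := inp x (P.rename (bindName y))

/-- Structural congruence: the least congruence that satisfies the laws below. -/
inductive Cong : PiProc → PiProc → Prop
  | refl (P) : Cong P P
  | symm {P Q} : Cong P Q → Cong Q P
  | trans {P Q R} : Cong P Q → Cong Q R → Cong P R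
  | congrNu {P Q} : Cong P Q → Cong (nu P) (nu Q)
  | congrOut (x y) {P Q} : Cong P Q → Cong (out x y P) (out x y Q)
  | congrInp (x) {P Q} : Cong P Q → Cong (inp x P) (inp x Q)
  | congrBang {P Q} : Cong P Q → Cong (bang P) (bang Q)
  | congrPar {P P' Q Q'} : Cong P P' → Cong Q Q' → Cong (par P Q) (par P' Q')
  | parAssoc (P Q R) : Cong (par P (par Q R)) (par (par P Q) R)
  | nuPar (P Q) : Cong (nu (par (P.rename Nat.succ) Q)) (par P (nu Q))
  | parZero (P) : Cong (par P zero) P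
  | nuZero : Cong (nu zero) zero
  | nuSuccess : Cong (nu success) success
  | nuSwap (P) : Cong (nu (nu P)) (nu (nu (P.rename swapName)))
  | parComm (P Q) : Cong (par P Q) (par Q P)
  | bangUnfold (P) : Cong (bang P) (par P (bang P))

/-- Reduction contexts `D ::= [·] | D|P | P|D | νx.D`. -/
inductive RCtx : Type
  | hole
  | parL (D : RCtx) (P : PiProc)
  | parR (P : PiProc) (D : RCtx)
  | nu (D : RCtx)

def RCtx.plug : RCtx → PiProc → PiProc
  | hole, R => R
  | parL D P, R => .par (D.plug R) P
  | parR P D, R => .par P (D.plug R)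
  | nu D, R => .nu (D.plug R)

/-- Interaction: `x(y).P | x̄z.Q → P[z/y] | Q`. -/
inductive Interact : PiProc → PiProc → Prop
  | ia (x z : ℕ) (P Q : PiProc) :
      Interact (par (inp x P) (out x z Q)) (par (P.rename (instName z)) Q)

/-- Standard reduction. -/
def Step (P Q : PiProc) : Prop :=
  ∃ (D : RCtx) (P' Q' : PiProc), Cong P (D.plug P') ∧ Interact P' Q' ∧ Cong (D.plug Q') Q

def Successful (P : PiProc) : Prop := ∃ D : RCtx, Cong P (D.plug success)

def MayConv (P : PiProc) : Prop := ∃ P', Relation.ReflTransGen Step P P' ∧ Successful P'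

def ShouldConv (P : PiProc) : Prop := ∀ P', Relation.ReflTransGen Step P P' → MayConv P'

/-- Process contexts. The binders in a context carry names, because plugging captures the free
names of the plugged process. -/
inductive Ctx : Type
  | hole
  | out (x y : ℕ) (C : Ctx)
  | inp (x y : ℕ) (C : Ctx)
  | parL (C : Ctx) (P : PiProc)
  | parR (P : PiProc) (C : Ctx)
  | bang (C : Ctx)
  | nu (x : ℕ) (C : Ctx)

/-- `C[R]`, with capture. -/
def Ctx.plug : Ctx → PiProc → PiProc
  | hole, R => R
  | out x y C, R => .out x y (C.plug R)
  | inp x y C, R => inpName x y (C.plug R)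
  | parL C P, R => .par (C.plug R) P
  | parR P C, R => .par P (C.plug R)
  | bang C, R => .bang (C.plug R)
  | nu x C, R => nuName x (C.plug R)

/-- Contextual preorder for may-convergence. -/
def LeMay (P Q : PiProc) : Prop := ∀ C : Ctx, MayConv (C.plug P) → MayConv (C.plug Q)

/-- Contextual preorder for should-convergence. -/
def LeShould (P Q : PiProc) : Prop := ∀ C : Ctx, ShouldConv (C.plug P) → ShouldConv (C.plug Q)

/-- Contextual preorder `≤_c`. -/
def CtxLe (P Q : PiProc) : Prop := LeMay P Q ∧ LeShould P Q

end PiProc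

/-! ## The calculus CH: types and data constructors -/

namespace CH

/-- Names and kinds (numbers of type parameters) of the data types that the calculus has in
addition to `()`, `Bool`, `List`, `Pair` and `Channel`. -/
structure TySig where
  UserTy : Type
  kind : UserTy → ℕ

/-- Type constructors of the data types. -/
inductive TCon (U : TySig) : Type
  | unit
  | bool
  | list
  | pair
  | channel
  | user (T : U.UserTy)

@[reducible] def TCon.kind {U : TySig} : TCon U → ℕ
  | unit => 0
  | bool => 0
  | list => 1
  | pair => 2
  | channel => 0
  | user T => U.kind T

/-- Monomorphic types. -/
inductive Ty (U : TySig) : Type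
  | io (t : Ty U)
  | mvar (t : Ty U)
  | fn (t₁ t₂ : Ty U)
  | data (T : TCon U) (ts : Fin T.kind → Ty U)

def Ty.unit {U : TySig} : Ty U := .data .unit Fin.elim0

def Ty.channel {U : TySig} : Ty U := .data .channel Fin.elim0

def Ty.pair {U : TySig} (t₁ t₂ : Ty U) : Ty U := .data .pair ![t₁, t₂]

/-- The additional data types: each has finitely many constructors, each constructor has an arity
and, for every instance of the type parameters, a type for each of its arguments. -/
structure DataSig extends TySig where
  numCons : UserTy → ℕ
  conArity : (T : UserTy) → Fin (numCons T) → ℕ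
  conFields : (T : UserTy) → (c : Fin (numCons T)) →
    (Fin (kind T) → Ty toTySig) → Fin (conArity T c) → Ty toTySig

/-- `Con S T`: the data constructors of the type `T`. -/
inductive Con (S : DataSig) : TCon S.toTySig → Type
  | unit : Con S .unit
  | tt : Con S .bool
  | ff : Con S .bool
  | nil : Con S .list
  | cons : Con S .list
  | pair : Con S .pair
  | chan : Con S .channel
  | user (T : S.UserTy) (c : Fin (S.numCons T)) : Con S (.user T)

@[reducible] def Con.arity {S : DataSig} : {T : TCon S.toTySig} → Con S T → ℕ
  | _, unit => 0
  | _, tt => 0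
  | _, ff => 0
  | _, nil => 0
  | _, cons => 2
  | _, pair => 2
  | _, chan => 1
  | _, user T c => S.conArity T c

/-- The types of the arguments of a constructor of type `T ts`. In particular
`data Channel = Chan (MVar (Channel, MVar ()))`. -/
def Con.fields {S : DataSig} : {T : TCon S.toTySig} → (c : Con S T) →
    (Fin T.kind → Ty S.toTySig) → Fin c.arity → Ty S.toTySig
  | _, unit, _ => Fin.elim0
  | _, tt, _ => Fin.elim0
  | _, ff, _ => Fin.elim0
  | _, nil, _ => Fin.elim0
  | _, cons, ts => ![ts (0 : Fin 1), .data .list ts]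
  | _, pair, ts => ![ts (0 : Fin 2), ts (1 : Fin 2)]
  | _, chan, _ => ![.mvar (Ty.pair Ty.channel (.mvar Ty.unit))]
  | _, user T c, ts => S.conFields T c ts

/-! ## Expressions -/

/-- Expressions. `lam` binds one variable, `letrec n es e` binds `n` variables in `e` and in all
the right hand sides `es i`, and the alternative of the constructor `c` in a case-expression binds
`c.arity` variables. -/
inductive Expr (S : DataSig) : Type
  | var (x : ℕ)
  | lam (e : Expr S)
  | app (e₁ e₂ : Expr S)
  | con {T : TCon S.toTySig} (c : Con S T) (es : Fin c.arity → Expr S)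
  | letrec (n : ℕ) (es : Fin n → Expr S) (e : Expr S)
  | case (T : TCon S.toTySig) (e : Expr S) (alts : Con S T → Expr S)
  | seq (e₁ e₂ : Expr S)
  | ret (e : Expr S)
  | bind (e₁ e₂ : Expr S)
  | fork (e : Expr S)
  | take (e : Expr S)
  | new (e : Expr S)
  | put (e₁ e₂ : Expr S)

namespace Expr

variable {S : DataSig}

def rename : (ℕ → ℕ) → Expr S → Expr S
  | r, var x => var (r x)
  | r, lam e => lam (rename (upRen 1 r) e)
  | r, app e₁ e₂ => app (rename r e₁) (rename r e₂)
  | r, con c es => con c (fun i => rename r (es i))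
  | r, letrec n es e => letrec n (fun i => rename (upRen n r) (es i)) (rename (upRen n r) e)
  | r, case T e alts => case T (rename r e) (fun c => rename (upRen c.arity r) (alts c))
  | r, seq e₁ e₂ => seq (rename r e₁) (rename r e₂)
  | r, ret e => ret (rename r e)
  | r, bind e₁ e₂ => bind (rename r e₁) (rename r e₂)
  | r, fork e => fork (rename r e)
  | r, take e => take (rename r e)
  | r, new e => new (rename r e)
  | r, put e₁ e₂ => put (rename r e₁) (rename r e₂)

/-- A substitution, transported below `n` binders. -/
def upSubst (n : ℕ) (s : ℕ → Expr S) : ℕ → Expr S :=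
  fun y => if y < n then var y else (s (y - n)).rename (· + n)

/-- Simultaneous capture-avoiding substitution. -/
def subst : (ℕ → Expr S) → Expr S → Expr S
  | s, var x => s x
  | s, lam e => lam (subst (upSubst 1 s) e)
  | s, app e₁ e₂ => app (subst s e₁) (subst s e₂)
  | s, con c es => con c (fun i => subst s (es i))
  | s, letrec n es e => letrec n (fun i => subst (upSubst n s) (es i)) (subst (upSubst n s) e)
  | s, case T e alts => case T (subst s e) (fun c => subst (upSubst c.arity s) (alts c))
  | s, seq e₁ e₂ => seq (subst s e₁) (subst s e₂)
  | s, ret e => ret (subst s e)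
  | s, bind e₁ e₂ => bind (subst s e₁) (subst s e₂)
  | s, fork e => fork (subst s e)
  | s, take e => take (subst s e)
  | s, new e => new (subst s e)
  | s, put e₁ e₂ => put (subst s e₁) (subst s e₂)

/-- `e[es 0/x₀, …, es (n-1)/xₙ₋₁]` for the `n` innermost bound variables. -/
def inst {n : ℕ} (es : Fin n → Expr S) (e : Expr S) : Expr S :=
  e.subst (fun y => if h : y < n then es ⟨y, h⟩ else var (y - n))

/-- Functional values: abstractions and constructor applications. -/
inductive FunValue : Expr S → Prop
  | lam (e) : FunValue (lam e)
  | con {T : TCon S.toTySig} (c : Con S T) (es) : FunValue (con c es)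

/-- The value `()`. -/
def unit : Expr S := con Con.unit Fin.elim0

/-- The pair `(e₁, e₂)`. -/
def pair (e₁ e₂ : Expr S) : Expr S := con Con.pair ![e₁, e₂]

/-- `Chan e`. -/
def chan (e : Expr S) : Expr S := con Con.chan ![e]

/-- `unchan e`, that is `case e of (Chan m -> m)`. -/
def unchan (e : Expr S) : Expr S := case .channel e (fun _ => var 0)

/-- The must-divergent expression `letrec x = x in x`. -/
def bot : Expr S := letrec 1 (fun _ => var 0) (var 0)

end Expr

/-! ## Typing -/

/-- Type environments: finite or infinite partial maps from variables to types. -/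
abbrev Env (S : DataSig) : Type := ℕ → Option (Ty S.toTySig)

/-- The environment below `n` binders for variables of the types `ts`. -/
def Env.ext {S : DataSig} {n : ℕ} (ts : Fin n → Ty S.toTySig) (Γ : Env S) : Env S :=
  fun y => if h : y < n then some (ts ⟨y, h⟩) else Γ (y - n)

/-- The first argument of `seq` has a function type or a data type. -/
inductive SeqTy {U : TySig} : Ty U → Prop
  | fn (t₁ t₂) : SeqTy (.fn t₁ t₂)
  | data (T ts) : SeqTy (.data T ts)

/-- The monomorphic type system: `HasTy Γ e t` is `Γ ⊢ e :: t`. -/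
inductive HasTy {S : DataSig} : Env S → Expr S → Ty S.toTySig → Prop
  | var {Γ x t} : Γ x = some t → HasTy Γ (.var x) t
  | lam {Γ : Env S} {e t₁ t₂} : HasTy (Γ.ext ![t₁]) e t₂ → HasTy Γ (.lam e) (.fn t₁ t₂)
  | app {Γ e₁ e₂ t₁ t₂} : HasTy Γ e₁ (.fn t₁ t₂) → HasTy Γ e₂ t₁ → HasTy Γ (.app e₁ e₂) t₂
  | con {Γ} {T : TCon S.toTySig} {c : Con S T} {es ts} :
      (∀ i, HasTy Γ (es i) (c.fields ts i)) → HasTy Γ (.con c es) (.data T ts)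
  | letrec {Γ : Env S} {n es e} {ts : Fin n → Ty S.toTySig} {t} :
      (∀ i, HasTy (Γ.ext ts) (es i) (ts i)) → HasTy (Γ.ext ts) e t → HasTy Γ (.letrec n es e) t
  | case {Γ : Env S} {T : TCon S.toTySig} {e ts alts t} :
      HasTy Γ e (.data T ts) → (∀ c : Con S T, HasTy (Γ.ext (c.fields ts)) (alts c) t) →
      HasTy Γ (.case T e alts) t
  | seq {Γ e₁ e₂ t₁ t₂} : HasTy Γ e₁ t₁ → SeqTy t₁ → HasTy Γ e₂ t₂ → HasTy Γ (.seq e₁ e₂) t₂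
  | ret {Γ e t} : HasTy Γ e t → HasTy Γ (.ret e) (.io t)
  | bind {Γ e₁ e₂ t₁ t₂} : HasTy Γ e₁ (.io t₁) → HasTy Γ e₂ (.fn t₁ (.io t₂)) →
      HasTy Γ (.bind e₁ e₂) (.io t₂)
  | fork {Γ e} : HasTy Γ e (.io Ty.unit) → HasTy Γ (.fork e) (.io Ty.unit)
  | take {Γ e t} : HasTy Γ e (.mvar t) → HasTy Γ (.take e) (.io t)
  | new {Γ e t} : HasTy Γ e t → HasTy Γ (.new e) (.io (.mvar t))
  | put {Γ e₁ e₂ t} : HasTy Γ e₁ (.mvar t) → HasTy Γ e₂ t → HasTy Γ (.put e₁ e₂) (.io Ty.unit)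

/-! ## Processes and standard reduction -/

/-- Processes. `thread b e` is a thread, it is the main thread if `b = true`; `mvar x e` is a
filled MVar, `emptyMVar x` an empty one, and `share x e` is the binding `x = e`. -/
inductive Proc (S : DataSig) : Type
  | par (P Q : Proc S)
  | thread (main : Bool) (e : Expr S)
  | nu (P : Proc S)
  | mvar (x : ℕ) (e : Expr S)
  | emptyMVar (x : ℕ)
  | share (x : ℕ) (e : Expr S)

namespace Proc

variable {S : DataSig}

def rename : (ℕ → ℕ) → Proc S → Proc S
  | r, par P Q => par (rename r P) (rename r Q)
  | r, thread b e => thread b (e.rename r)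
  | r, nu P => nu (rename (upRen 1 r) P)
  | r, mvar x e => mvar (r x) (e.rename r)
  | r, emptyMVar x => emptyMVar (r x)
  | r, share x e => share (r x) (e.rename r)

/-- Introduced variables of a process that are visible from outside. -/
def introduced : Proc S → Set ℕ
  | par P Q => introduced P ∪ introduced Q
  | thread _ _ => ∅
  | nu P => {x | x + 1 ∈ introduced P}
  | mvar x _ => {x}
  | emptyMVar x => {x}
  | share x _ => {x}

/-- The introduced variables (including the restricted ones) are pairwise distinct. -/
def DistinctIntro : Proc S → Prop
  | par P Q => DistinctIntro P ∧ DistinctIntro Q ∧ Disjoint (introduced P) (introduced Q)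
  | nu P => DistinctIntro P
  | _ => True

/-- Number of main threads. -/
def mainCount : Proc S → ℕ
  | par P Q => mainCount P + mainCount Q
  | nu P => mainCount P
  | thread true _ => 1
  | _ => 0

def WellFormed (P : Proc S) : Prop := DistinctIntro P ∧ mainCount P ≤ 1

/-- Structural congruence: the least congruence that satisfies the laws below. -/
inductive Cong : Proc S → Proc S → Prop
  | refl (P) : Cong P P
  | symm {P Q} : Cong P Q → Cong Q P
  | trans {P Q R} : Cong P Q → Cong Q R → Cong P R
  | congrPar {P P' Q Q'} : Cong P P' → Cong Q Q' → Cong (par P Q) (par P' Q')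
  | congrNu {P Q} : Cong P Q → Cong (nu P) (nu Q)
  | parComm (P Q) : Cong (par P Q) (par Q P)
  | parAssoc (P Q R) : Cong (par (par P Q) R) (par P (par Q R))
  | nuSwap (P) : Cong (nu (nu P)) (nu (nu (P.rename swapName)))
  | nuPar (P Q) : Cong (par (nu P) Q) (nu (par P (Q.rename Nat.succ)))

/-- `νx₁…νxₙ.P`. -/
def nus : ℕ → Proc S → Proc S
  | 0, P => P
  | n + 1, P => nu (nus n P)

/-- `P | x₁ = e₁ | … | xₙ = eₙ`, where the `xᵢ` are the `n` innermost bound variables. -/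
def addShares {n : ℕ} (P : Proc S) (es : Fin n → Expr S) : Proc S :=
  (List.ofFn fun i : Fin n => share (i : ℕ) (es i)).foldl par P

/-- Process contexts `D ::= [·] | D|P | P|D | νx.D`. -/
inductive PCtx (S : DataSig) : Type
  | hole
  | parL (D : PCtx S) (P : Proc S)
  | parR (P : Proc S) (D : PCtx S)
  | nu (D : PCtx S)

def PCtx.plug : PCtx S → Proc S → Proc S
  | hole, R => R
  | parL D P, R => .par (D.plug R) P
  | parR P D, R => .par P (D.plug R)
  | nu D, R => .nu (D.plug R)

end Proc

/-- Monadic contexts `M ::= [·] | M >>= e`. -/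
inductive MCtx (S : DataSig) : Type
  | hole
  | bind (M : MCtx S) (e : Expr S)

/-- Expression evaluation contexts `E ::= [·] | (E e) | (seq E e) | (case E of alts)`. -/
inductive ECtx (S : DataSig) : Type
  | hole
  | app (E : ECtx S) (e : Expr S)
  | seq (E : ECtx S) (e : Expr S)
  | case (T : TCon S.toTySig) (E : ECtx S) (alts : Con S T → Expr S)

/-- Forcing contexts `F ::= E | takeMVar E | putMVar E e`. -/
inductive FCtx (S : DataSig) : Type
  | eval (E : ECtx S)
  | take (E : ECtx S)
  | put (E : ECtx S) (e : Expr S)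

section EvalContexts

variable {S : DataSig}

def MCtx.plug : MCtx S → Expr S → Expr S
  | hole, e => e
  | bind M e', e => .bind (M.plug e) e'

def MCtx.rename (r : ℕ → ℕ) : MCtx S → MCtx S
  | hole => hole
  | bind M e => bind (M.rename r) (e.rename r)

def ECtx.plug : ECtx S → Expr S → Expr S
  | hole, e => e
  | app E e', e => .app (E.plug e) e'
  | seq E e', e => .seq (E.plug e) e'
  | case T E alts, e => .case T (E.plug e) alts

def ECtx.rename (r : ℕ → ℕ) : ECtx S → ECtx S
  | hole => hole
  | app E e => app (E.rename r) (e.rename r)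
  | seq E e => seq (E.rename r) (e.rename r)
  | case T E alts => case T (E.rename r) (fun c => (alts c).rename (upRen c.arity r))

def FCtx.plug : FCtx S → Expr S → Expr S
  | eval E, e => E.plug e
  | take E, e => .take (E.plug e)
  | put E e', e => .put (E.plug e) e'

def FCtx.rename (r : ℕ → ℕ) : FCtx S → FCtx S
  | eval E => eval (E.rename r)
  | take E => take (E.rename r)
  | put E e => put (E.rename r) (e.rename r)

end EvalContexts

namespace Proc

variable {S : DataSig}

/-- The call-by-name standard reduction rules; they apply to the main thread and to the other
threads alike. -/
inductive Rule : Proc S → Proc S → Prop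
  | cpce (b) (M : MCtx S) (F : FCtx S) (x e) :
      Rule (par (thread b (M.plug (F.plug (.var x)))) (share x e))
        (par (thread b (M.plug (F.plug e))) (share x e))
  | mkbinds (b) (M : MCtx S) (F : FCtx S) (n es e) :
      Rule (thread b (M.plug (F.plug (.letrec n es e))))
        (nus n (addShares (thread b ((M.rename (· + n)).plug ((F.rename (· + n)).plug e))) es))
  | beta (b) (M : MCtx S) (F : FCtx S) (e₁ e₂) :
      Rule (thread b (M.plug (F.plug (.app (.lam e₁) e₂))))
        (thread b (M.plug (F.plug (e₁.inst ![e₂]))))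
  | case (b) (M : MCtx S) (F : FCtx S) {T : TCon S.toTySig} (c : Con S T) (es alts) :
      Rule (thread b (M.plug (F.plug (.case T (.con c es) alts))))
        (thread b (M.plug (F.plug ((alts c).inst es))))
  | seq (b) (M : MCtx S) (F : FCtx S) {v} (e) : Expr.FunValue v →
      Rule (thread b (M.plug (F.plug (.seq v e)))) (thread b (M.plug (F.plug e)))
  | lunit (b) (M : MCtx S) (e₁ e₂) :
      Rule (thread b (M.plug (.bind (.ret e₁) e₂))) (thread b (M.plug (.app e₂ e₁)))
  | tmvar (b) (M : MCtx S) (x e) :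
      Rule (par (thread b (M.plug (.take (.var x)))) (mvar x e))
        (par (thread b (M.plug (.ret e))) (emptyMVar x))
  | pmvar (b) (M : MCtx S) (x e) :
      Rule (par (thread b (M.plug (.put (.var x) e))) (emptyMVar x))
        (par (thread b (M.plug (.ret .unit))) (mvar x e))
  | nmvar (b) (M : MCtx S) (e) :
      Rule (thread b (M.plug (.new e)))
        (nu (par (thread b ((M.rename Nat.succ).plug (.ret (.var 0))))
          (mvar 0 (e.rename Nat.succ))))
  | fork (b) (M : MCtx S) (e) :
      Rule (thread b (M.plug (.fork e)))
        (par (thread b (M.plug (.ret .unit))) (thread false e))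

/-- Successful processes: well-formed, and congruent to `νx₁…xₙ.(main ⇐ return e | P')`, where the
rest `P'` may be absent. -/
def Successful (P : Proc S) : Prop :=
  WellFormed P ∧ ∃ (n : ℕ) (e : Expr S),
    Cong P (nus n (thread true (.ret e))) ∨
    ∃ P' : Proc S, Cong P (nus n (par (thread true (.ret e)) P'))

/-- Standard reduction: the closure of the rules under process contexts and structural congruence,
permitted for well-formed processes that are not successful. -/
def Step (P Q : Proc S) : Prop :=
  WellFormed P ∧ ¬ Successful P ∧
    ∃ (D : PCtx S) (P' Q' : Proc S), Cong P (D.plug P') ∧ Rule P' Q' ∧ Cong Q (D.plug Q')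

def MayConv (P : Proc S) : Prop :=
  WellFormed P ∧ ∃ P', Relation.ReflTransGen Step P P' ∧ Successful P'

def ShouldConv (P : Proc S) : Prop :=
  WellFormed P ∧ ∀ P', Relation.ReflTransGen Step P P' → MayConv P'

end Proc

/-! ## Expression contexts and the observational preorder on expressions -/

/-- Expression contexts with one hole, at any position of an expression. The binders above the
hole carry names, because plugging captures the free variables of the plugged expression; in
`letrec` the names are bound in the other right hand sides and in the body as well. In `con`,
`letrecRhs` and `caseAlt` the component at the position of the hole is irrelevant. -/
inductive Ctx (S : DataSig) : Type
  | hole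
  | lam (x : ℕ) (C : Ctx S)
  | appL (C : Ctx S) (e : Expr S)
  | appR (e : Expr S) (C : Ctx S)
  | con {T : TCon S.toTySig} (c : Con S T) (es : Fin c.arity → Expr S) (i : Fin c.arity)
      (C : Ctx S)
  | letrecBody {n : ℕ} (xs : Fin n → ℕ) (es : Fin n → Expr S) (C : Ctx S)
  | letrecRhs {n : ℕ} (xs : Fin n → ℕ) (es : Fin n → Expr S) (i : Fin n) (C : Ctx S) (e : Expr S)
  | caseScrut (T : TCon S.toTySig) (C : Ctx S) (alts : Con S T → Expr S)
  | caseAlt {T : TCon S.toTySig} (e : Expr S) (alts : Con S T → Expr S) (c : Con S T)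
      (xs : Fin c.arity → ℕ) (C : Ctx S)
  | seqL (C : Ctx S) (e : Expr S)
  | seqR (e : Expr S) (C : Ctx S)
  | ret (C : Ctx S)
  | bindL (C : Ctx S) (e : Expr S)
  | bindR (e : Expr S) (C : Ctx S)
  | fork (C : Ctx S)
  | take (C : Ctx S)
  | new (C : Ctx S)
  | putL (C : Ctx S) (e : Expr S)
  | putR (e : Expr S) (C : Ctx S)

open Classical in
/-- `C[e]`, with capture. -/
noncomputable def Ctx.plug {S : DataSig} : Ctx S → Expr S → Expr S
  | hole, e => e
  | lam x C, e => .lam ((C.plug e).rename (bindName x))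
  | appL C e', e => .app (C.plug e) e'
  | appR e' C, e => .app e' (C.plug e)
  | con c es i C, e => .con c (Function.update es i (C.plug e))
  | letrecBody (n := n) xs es C, e =>
      .letrec n (fun j => (es j).rename (bindNames xs)) ((C.plug e).rename (bindNames xs))
  | letrecRhs (n := n) xs es i C e', e =>
      .letrec n (fun j => (Function.update es i (C.plug e) j).rename (bindNames xs))
        (e'.rename (bindNames xs))
  | caseScrut T C alts, e => .case T (C.plug e) alts
  | caseAlt (T := T) e' alts c xs C, e =>
      .case T e' (Function.update alts c ((C.plug e).rename (bindNames xs)))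
  | seqL C e', e => .seq (C.plug e) e'
  | seqR e' C, e => .seq e' (C.plug e)
  | ret C, e => .ret (C.plug e)
  | bindL C e', e => .bind (C.plug e) e'
  | bindR e' C, e => .bind e' (C.plug e)
  | fork C, e => .fork (C.plug e)
  | take C, e => .take (C.plug e)
  | new C, e => .new (C.plug e)
  | putL C e', e => .put (C.plug e) e'
  | putR e' C, e => .put e' (C.plug e)

/-- `Γ`, updated by the types `ts` for the pairwise distinct names `xs`. -/
noncomputable def Env.bindNames {S : DataSig} {n : ℕ} (xs : Fin n → ℕ)
    (ts : Fin n → Ty S.toTySig) (Γ : Env S) : Env S :=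
  fun y => Γ.ext ts (_root_.bindNames xs y)

/-- Typing of contexts: `CtxTy Δ s Γ C t` says that `C` has type `t` in the environment `Γ`, where
the hole has type `s` and stands for expressions whose free variables are typed by `Δ`. -/
inductive CtxTy {S : DataSig} (Δ : Env S) (s : Ty S.toTySig) :
    Env S → Ctx S → Ty S.toTySig → Prop
  | hole {Γ : Env S} : (∀ x t, Δ x = some t → Γ x = some t) → CtxTy Δ s Γ .hole s
  | lam {Γ x C t₁ t₂} : CtxTy Δ s (Function.update Γ x (some t₁)) C t₂ →
      CtxTy Δ s Γ (.lam x C) (.fn t₁ t₂)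
  | appL {Γ C e t₁ t₂} : CtxTy Δ s Γ C (.fn t₁ t₂) → HasTy Γ e t₁ → CtxTy Δ s Γ (.appL C e) t₂
  | appR {Γ e C t₁ t₂} : HasTy Γ e (.fn t₁ t₂) → CtxTy Δ s Γ C t₁ → CtxTy Δ s Γ (.appR e C) t₂
  | con {Γ} {T : TCon S.toTySig} {c : Con S T} {es i C ts} :
      (∀ j, j ≠ i → HasTy Γ (es j) (c.fields ts j)) → CtxTy Δ s Γ C (c.fields ts i) →
      CtxTy Δ s Γ (.con c es i C) (.data T ts)
  | letrecBody {Γ : Env S} {n xs es C} {ts : Fin n → Ty S.toTySig} {t} : Function.Injective xs →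
      (∀ j, HasTy (Γ.bindNames xs ts) (es j) (ts j)) → CtxTy Δ s (Γ.bindNames xs ts) C t →
      CtxTy Δ s Γ (.letrecBody xs es C) t
  | letrecRhs {Γ : Env S} {n xs es i C e} {ts : Fin n → Ty S.toTySig} {t} : Function.Injective xs →
      (∀ j, j ≠ i → HasTy (Γ.bindNames xs ts) (es j) (ts j)) →
      CtxTy Δ s (Γ.bindNames xs ts) C (ts i) → HasTy (Γ.bindNames xs ts) e t →
      CtxTy Δ s Γ (.letrecRhs xs es i C e) t
  | caseScrut {Γ : Env S} {T : TCon S.toTySig} {C ts alts t} : CtxTy Δ s Γ C (.data T ts) →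
      (∀ c : Con S T, HasTy (Γ.ext (c.fields ts)) (alts c) t) →
      CtxTy Δ s Γ (.caseScrut T C alts) t
  | caseAlt {Γ : Env S} {T : TCon S.toTySig} {e alts} {c : Con S T} {xs C ts t} :
      Function.Injective xs → HasTy Γ e (.data T ts) →
      (∀ c' : Con S T, c' ≠ c → HasTy (Γ.ext (c'.fields ts)) (alts c') t) →
      CtxTy Δ s (Γ.bindNames xs (c.fields ts)) C t → CtxTy Δ s Γ (.caseAlt e alts c xs C) t
  | seqL {Γ C e t₁ t₂} : CtxTy Δ s Γ C t₁ → SeqTy t₁ → HasTy Γ e t₂ → CtxTy Δ s Γ (.seqL C e) t₂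
  | seqR {Γ e C t₁ t₂} : HasTy Γ e t₁ → SeqTy t₁ → CtxTy Δ s Γ C t₂ → CtxTy Δ s Γ (.seqR e C) t₂
  | ret {Γ C t} : CtxTy Δ s Γ C t → CtxTy Δ s Γ (.ret C) (.io t)
  | bindL {Γ C e t₁ t₂} : CtxTy Δ s Γ C (.io t₁) → HasTy Γ e (.fn t₁ (.io t₂)) →
      CtxTy Δ s Γ (.bindL C e) (.io t₂)
  | bindR {Γ e C t₁ t₂} : HasTy Γ e (.io t₁) → CtxTy Δ s Γ C (.fn t₁ (.io t₂)) →
      CtxTy Δ s Γ (.bindR e C) (.io t₂)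
  | fork {Γ C} : CtxTy Δ s Γ C (.io Ty.unit) → CtxTy Δ s Γ (.fork C) (.io Ty.unit)
  | take {Γ C t} : CtxTy Δ s Γ C (.mvar t) → CtxTy Δ s Γ (.take C) (.io t)
  | new {Γ C t} : CtxTy Δ s Γ C t → CtxTy Δ s Γ (.new C) (.io (.mvar t))
  | putL {Γ C e t} : CtxTy Δ s Γ C (.mvar t) → HasTy Γ e t →
      CtxTy Δ s Γ (.putL C e) (.io Ty.unit)
  | putR {Γ e C t} : HasTy Γ e (.mvar t) → CtxTy Δ s Γ C t →
      CtxTy Δ s Γ (.putR e C) (.io Ty.unit)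

section Observation

variable {S : DataSig}

/-- The name of the variable `stop`. -/
def stopVar : ℕ := 0

/-- The variable that represents the free pi-calculus name `x`. -/
def chanVar (x : ℕ) : ℕ := x + 1

/-- The context `νstop. main ⇐ do {stop ← newMVar (); forkIO [·]; putMVar stop ()}`, filled by `e`;
the free variable `stop` of `e` is captured by the `do`-binder. -/
def outerCtx (e : Expr S) : Proc S :=
  .nu (.thread true (Expr.rename (bindName stopVar)
    (.bind (.new .unit) (.lam
      (.bind (.fork (e.rename (bindName stopVar))) (.lam (.put (.var 1) .unit)))))))

/-- May-convergence of an expression inside the outer context. -/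
def MayConv₀ (e : Expr S) : Prop := (outerCtx e).MayConv

/-- Should-convergence of an expression inside the outer context. -/
def ShouldConv₀ (e : Expr S) : Prop := (outerCtx e).ShouldConv

/-- The environment in which `stop :: MVar ()` is the only variable. -/
def stopEnv : Env S := fun x => if x = stopVar then some (.mvar Ty.unit) else none

/-- The preorder `≤_{c,τ₀}` on expressions of type `t`: all well-typed expression contexts `C` such
that `stop` is the only variable that may occur free in `C[e₁]` and `C[e₂]` (this is expressed by
typing them in `stopEnv`) are used as tests. -/
def LeTau₀ (t : Ty S.toTySig) (e₁ e₂ : Expr S) : Prop :=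
  ∀ (Δ : Env S) (C : Ctx S), HasTy Δ e₁ t → HasTy Δ e₂ t →
    CtxTy Δ t stopEnv C (.io Ty.unit) →
    (MayConv₀ (C.plug e₁) → MayConv₀ (C.plug e₂)) ∧
    (ShouldConv₀ (C.plug e₁) → ShouldConv₀ (C.plug e₂))

end Observation

/-! ## The translation -/

/-- The translation, where `s` is the index of the variable `stop` and `r x` is the index of the
variable for the channel name `x`:
* `τ(x̄y.P) = do {check ← newMVar (); putMVar (unchan x) (y,check); putMVar check (); τ(P)}`
* `τ(x(y).P) = do {(y,check) ← takeMVar (unchan x); takeMVar check; τ(P)}`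
* `τ(P|Q) = do {forkIO τ(Q); τ(P)}`
* `τ(νx.P) = do {chan ← newMVar ⊥; takeMVar chan; letrec x = Chan chan in τ(P)}`
* `τ(0) = return ()`, `τ(Stop) = takeMVar stop`
* `τ(!P) = letrec f = do {forkIO τ(P); f} in f` -/
def tauAux {S : DataSig} : ℕ → (ℕ → ℕ) → PiProc → Expr S
  | s, r, .out x y P =>
      .bind (.new .unit) (.lam
        (.bind (.put (.unchan (.var (r x + 1))) (.pair (.var (r y + 1)) (.var 0))) (.lam
          (.bind (.put (.var 1) .unit) (.lam
            (tauAux (s + 3) (fun z => r z + 3) P))))))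
  | s, r, .inp x P =>
      .bind (.take (.unchan (.var (r x)))) (.lam
        (.case .pair (.var 0) (fun _ =>
          .bind (.take (.var 1)) (.lam
            (tauAux (s + 4) (consName 1 (fun z => r z + 4)) P)))))
  | s, r, .par P Q =>
      .bind (.fork (tauAux s r Q)) (.lam (tauAux (s + 1) (fun z => r z + 1) P))
  | s, r, .nu P =>
      .bind (.new .bot) (.lam
        (.bind (.take (.var 0)) (.lam
          (.letrec 1 (fun _ => .chan (.var 2))
            (tauAux (s + 3) (consName 0 (fun z => r z + 3)) P)))))
  | _, _, .zero => .ret .unit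
  | s, _, .success => .take (.var s)
  | s, r, .bang P =>
      .letrec 1 (fun _ => .bind (.fork (tauAux (s + 1) (fun z => r z + 1) P)) (.lam (.var 1)))
        (.var 0)

/-- The open translation `τ`. -/
def tau (S : DataSig) (P : PiProc) : Expr S := tauAux stopVar chanVar P

end CH

/-!
The proof compares the convergence of a closed process with that of its translation
(`CH.conv₀_tau`: they agree) and then uses that `τ` is compositional.

*The pi-calculus.* Structural congruence is the obstacle to any case analysis of a reduction. It is
a bisimulation for a labelled transition system without congruence rules (`PiProc.Cong.matched`),
and the internal transitions are the standard reductions (`PiProc.Step.exists_ttau`,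
`PiProc.TTau.step`). So if a process is congruent to `νx₁…xₖ.(P₁ | … | Pₙ)`, then each of its
reductions is found by splitting parallel compositions, opening restrictions and unfolding
replications among the `Pᵢ` until two prefixes meet (`PiProc.Step.unfolds`). A translated process
performs exactly these operations. Success means that `Stop` occurs outside of all prefixes
(`PiProc.successful_iff`).

*The calculus CH.* Up to structural congruence, a process is the multiset of its threads, MVars and
bindings below all restrictions. A reduction is a step of a thread against the other components
(`CH.Rep.dstep`, `CH.Rep.exists_step`), threads are deterministic given the heap, and convergence
can be studied for multisets (`CH.Rep.mayConv_iff`, `CH.Rep.shouldConv_iff`).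

*The invariant.* `CH.Run k L q b m` says that the components `m` are a state of the translation of
`νx₁…xₖ.(P₁ | … | Pₙ)`. The components fall into groups, each of which implements a `Pᵢ` at some
stage of its evaluation, or a sender and a receiver between the delivery of the message and the
acknowledgement, which no other thread can disturb. The interaction of the processes is counted at
the moment when the message is taken. A message which has been put into the MVar of a
channel but has not been taken leaves its sender where it was; `q` is the number of such messages.

Each step of a state is explained by the process (`CH.Run.back`); in particular the main thread can
finish only after `stop` has been emptied, that is, if the process is successful. Conversely, an
interaction on a channel `x` is simulated, unless the MVar of `x` holds the message of another
sender (`CH.Run.com`). Then that message is delivered to the receiver instead, which decreases `q`.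
This reaches a different reduct of the process, but if the process should converge, this reduct
converges as well, and the argument is repeated with the smaller `q` (`CH.Sim.mMay`). If `q = 0`,
the second case does not arise, and no hypothesis on the process is needed. Together,
may-convergence and should-convergence are preserved and reflected for closed processes.

*Contexts.* For open processes `P`, `P'` and a context `C` of the pi-calculus, restrict all names of
`C[P]` and `C[P']`. This does not change convergence (`PiProc.mayConv_nuName`,
`PiProc.shouldConv_nuName`). The closed context has a translation, which is a well-typed context of
CH with at most `stop` free (`CH.ctxTy_tauCtx`, `CH.ctxTy_close`), and plugging commutes with
translating (`CH.tauCtx_plug`).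
-/

/-! ### Renamings -/

@[simp] theorem upRen_one_zero (r : ℕ → ℕ) : upRen 1 r 0 = 0 := by simp [upRen]

@[simp] theorem upRen_one_succ (r : ℕ → ℕ) (y : ℕ) : upRen 1 r (y + 1) = r y + 1 := by
  simp [upRen]

theorem upRen_comp (n : ℕ) (f g : ℕ → ℕ) : upRen n f ∘ upRen n g = upRen n (f ∘ g) := by
  funext y
  by_cases h : y < n <;> simp [upRen, h]

@[simp] theorem upRen_id (n : ℕ) : upRen n id = id := by
  funext y
  by_cases h : y < n <;> simp [upRen, h]
  omega

theorem upRen_one_comp_succ (f : ℕ → ℕ) : upRen 1 f ∘ Nat.succ = Nat.succ ∘ f := by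
  funext y
  simp [upRen]

theorem swapName_comp_upRen (f : ℕ → ℕ) :
    swapName ∘ upRen 1 (upRen 1 f) = upRen 1 (upRen 1 f) ∘ swapName := by
  funext y
  rcases y with _ | _ | y <;> simp [swapName]

@[simp] theorem swapName_comp_self : swapName ∘ swapName = id := by
  funext y
  rcases y with _ | _ | y <;> rfl

theorem swapName_comp_succ : swapName ∘ Nat.succ = upRen 1 Nat.succ := by
  funext y
  rcases y with _ | y <;> simp [swapName]

theorem swapName_comp_upRen_succ : swapName ∘ upRen 1 Nat.succ = Nat.succ := by
  funext y
  rcases y with _ | y <;> simp [swapName]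

theorem instName_comp_upRen (z : ℕ) (f : ℕ → ℕ) :
    instName (f z) ∘ upRen 1 f = f ∘ instName z := by
  funext y
  rcases y with _ | y <;> simp [instName]

theorem instName_comp_succ (z : ℕ) : instName z ∘ Nat.succ = id := by
  funext y
  simp [instName]

theorem upRen_instName_comp_swapName (z : ℕ) :
    upRen 1 (instName z) ∘ swapName = instName (z + 1) := by
  funext y
  rcases y with _ | _ | y <;> simp [instName, swapName]

theorem upRen_injective {f : ℕ → ℕ} (hf : Function.Injective f) :
    Function.Injective (upRen 1 f) := by
  intro a b h
  rcases a with _ | a <;> rcases b with _ | b <;> simp_all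
  exact hf h

namespace PiProc

theorem rename_comp (P : PiProc) : ∀ f g : ℕ → ℕ, (P.rename f).rename g = P.rename (g ∘ f) := by
  induction P <;> intro f g <;> simp [rename, upRen_comp, *]

theorem rename_id (P : PiProc) : P.rename id = P := by
  induction P <;> simp [rename, *]

theorem Cong.rename {P Q : PiProc} (h : Cong P Q) : ∀ f, Cong (P.rename f) (Q.rename f) := by
  induction h with
  | refl P => intro f; exact .refl _
  | symm _ ih => intro f; exact .symm (ih f)
  | trans _ _ ih₁ ih₂ => intro f; exact .trans (ih₁ f) (ih₂ f)
  | congrNu _ ih => intro f; exact .congrNu (ih _)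
  | congrOut x y _ ih => intro f; exact .congrOut _ _ (ih _)
  | congrInp x _ ih => intro f; exact .congrInp _ (ih _)
  | congrBang _ ih => intro f; exact .congrBang (ih _)
  | congrPar _ _ ih₁ ih₂ => intro f; exact .congrPar (ih₁ f) (ih₂ f)
  | parAssoc P Q R => intro f; exact .parAssoc _ _ _
  | nuPar P Q =>
    intro f
    have := Cong.nuPar (P.rename f) (Q.rename (upRen 1 f))
    rwa [rename_comp, ← upRen_one_comp_succ, ← rename_comp] at this
  | parZero P => intro f; exact .parZero _
  | nuZero => intro f; exact .nuZero
  | nuSuccess => intro f; exact .nuSuccess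
  | nuSwap P =>
    intro f
    have := Cong.nuSwap (P.rename (upRen 1 (upRen 1 f)))
    rwa [rename_comp, swapName_comp_upRen, ← rename_comp] at this
  | parComm P Q => intro f; exact .parComm _ _
  | bangUnfold P => intro f; exact .bangUnfold _

/-! ### Processes modulo structural congruence -/

/-- Structural congruence as a setoid. -/
instance congSetoid : Setoid PiProc := ⟨Cong, .refl, .symm, .trans⟩

/-- Processes modulo structural congruence. They are a commutative monoid under parallel
composition, so that reasoning up to associativity and commutativity is left to `abel`. -/
def PiCl : Type := Quotient congSetoid

/-- The class of a process. -/
def cl (P : PiProc) : PiCl := Quotient.mk _ P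

theorem cl_eq {P Q : PiProc} : cl P = cl Q ↔ Cong P Q := Quotient.eq (r := congSetoid)

instance : Zero PiCl := ⟨cl zero⟩

instance : Add PiCl := ⟨Quotient.map₂ par fun _ _ h _ _ h' => .congrPar h h'⟩

instance : AddCommMonoid PiCl where
  nsmul := nsmulRec
  add_assoc := by
    rintro ⟨P⟩ ⟨Q⟩ ⟨R⟩
    exact Quotient.sound (.symm (.parAssoc P Q R))
  add_comm := by
    rintro ⟨P⟩ ⟨Q⟩
    exact Quotient.sound (.parComm P Q)
  zero_add := by
    rintro ⟨P⟩
    exact Quotient.sound (.trans (.parComm _ _) (.parZero P))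
  add_zero := by
    rintro ⟨P⟩
    exact Quotient.sound (.parZero P)

/-- Restriction of a class. -/
def PiCl.nu : PiCl → PiCl := Quotient.map PiProc.nu fun _ _ h => .congrNu h

/-- Renaming of a class. -/
def PiCl.ren (f : ℕ → ℕ) : PiCl → PiCl := Quotient.map (PiProc.rename f) fun _ _ h => h.rename f

theorem cl_par (P Q : PiProc) : cl (par P Q) = cl P + cl Q := rfl

theorem cl_nu (P : PiProc) : cl (nu P) = (cl P).nu := rfl

theorem cl_rename (f : ℕ → ℕ) (P : PiProc) : cl (P.rename f) = (cl P).ren f := rfl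

theorem cl_bang (P : PiProc) : cl (bang P) = cl P + cl (bang P) := cl_eq.2 (.bangUnfold P)

theorem PiCl.nu_add (a b : PiCl) : (a.ren Nat.succ + b).nu = a + b.nu := by
  obtain ⟨P⟩ := a
  obtain ⟨Q⟩ := b
  exact Quotient.sound (.nuPar P Q)

theorem PiCl.nu_add' (a b : PiCl) : (b + a.ren Nat.succ).nu = b.nu + a := by
  rw [add_comm, PiCl.nu_add, add_comm]

theorem PiCl.nu_swap (a : PiCl) : (a.ren swapName).nu.nu = a.nu.nu := by
  obtain ⟨P⟩ := a
  exact (cl_eq.2 (.nuSwap P)).symm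

@[simp] theorem PiCl.ren_add (f : ℕ → ℕ) (a b : PiCl) : (a + b).ren f = a.ren f + b.ren f := by
  obtain ⟨P⟩ := a
  obtain ⟨Q⟩ := b
  rfl

@[simp] theorem PiCl.ren_zero (f : ℕ → ℕ) : (0 : PiCl).ren f = 0 := rfl

/-! ### A labelled transition system for the pi-calculus -/

/-- `TIn P x F`: the process `P` can receive on `x` and becomes the abstraction `F`, in which the
index `0` stands for the received name. -/
inductive TIn : PiProc → ℕ → PiProc → Prop
  | inp (x P) : TIn (inp x P) x P
  | parL {P x F} (Q) : TIn P x F → TIn (par P Q) x (par F (Q.rename Nat.succ))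
  | parR (P) {Q x F} : TIn Q x F → TIn (par P Q) x (par (P.rename Nat.succ) F)
  | nu {P x F} : TIn P (x + 1) F → TIn (nu P) x (nu (F.rename swapName))
  | bang {P x F} : TIn P x F → TIn (bang P) x (par F ((bang P).rename Nat.succ))

/-- `TOut P x K`: the process `P` can send on `x`. The function `K` describes the result: if `P`,
renamed by `ρ`, sends to a receiver with the abstraction `F`, then both together become `K ρ F`.
Restrictions of `P` whose scope the sent name leaves are placed around the receiver by `K`, hence
bound outputs need no separate treatment. -/
inductive TOut : PiProc → ℕ → ((ℕ → ℕ) → PiProc → PiProc) → Prop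
  | out (x z P) : TOut (out x z P) x (fun ρ F => par (F.rename (instName (ρ z))) (P.rename ρ))
  | parL {P x K} (Q) : TOut P x K → TOut (par P Q) x (fun ρ F => par (K ρ F) (Q.rename ρ))
  | parR (P) {Q x K} : TOut Q x K → TOut (par P Q) x (fun ρ F => par (P.rename ρ) (K ρ F))
  | nu {P x K} : TOut P (x + 1) K →
      TOut (nu P) x (fun ρ F => nu (K (upRen 1 ρ) (F.rename (upRen 1 Nat.succ))))
  | bang {P x K} : TOut P x K → TOut (bang P) x (fun ρ F => par (K ρ F) ((bang P).rename ρ))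

/-- Internal transitions. -/
inductive TTau : PiProc → PiProc → Prop
  | comL {P Q x F K} : TIn P x F → TOut Q x K → TTau (par P Q) (K id F)
  | comR {P Q x F K} : TOut P x K → TIn Q x F → TTau (par P Q) (K id F)
  | parL {P P'} (Q) : TTau P P' → TTau (par P Q) (par P' Q)
  | parR (P) {Q Q'} : TTau Q Q' → TTau (par P Q) (par P Q')
  | nu {P P'} : TTau P P' → TTau (nu P) (nu P')
  | bang {P P'} : TTau P P' → TTau (bang P) (par P' (bang P))
  | bangCom {P x F K} : TIn P x F → TOut P x K → TTau (bang P) (par (K id F) (bang P))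

theorem TOut.cong {P x K} (h : TOut P x K) : ∀ (ρ : ℕ → ℕ) {F F' : PiProc}, cl F = cl F' →
    cl (K ρ F) = cl (K ρ F') := by
  induction h with
  | out x z P => intro ρ F F' hF; simp only [cl_par, cl_rename, hF]
  | parL Q _ ih => intro ρ F F' hF; simp only [cl_par, ih ρ hF]
  | parR P _ ih => intro ρ F F' hF; simp only [cl_par, ih ρ hF]
  | nu _ ih =>
    intro ρ F F' hF
    simp only [cl_nu]
    rw [ih]
    simp only [cl_rename, hF]
  | bang _ ih => intro ρ F F' hF; simp only [cl_par, ih ρ hF]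

/-- The result of an output is natural in the renamings: this is why `TOut` carries a function
that is applied to a renaming and to the abstraction of the receiver. -/
theorem TOut.rename_result {P x K} (h : TOut P x K) : ∀ (ρ g : ℕ → ℕ) (F : PiProc),
    (K ρ F).rename g = K (g ∘ ρ) (F.rename (upRen 1 g)) := by
  induction h with
  | out x z P =>
    intro ρ g F
    simp only [PiProc.rename, rename_comp, Function.comp_apply, instName_comp_upRen]
  | parL Q _ ih => intro ρ g F; simp only [PiProc.rename, rename_comp, ih]
  | parR P _ ih => intro ρ g F; simp only [PiProc.rename, rename_comp, ih]
  | nu _ ih =>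
    intro ρ g F
    simp only [PiProc.rename, rename_comp, ih, upRen_comp, upRen_one_comp_succ]
  | bang _ ih => intro ρ g F; simp only [PiProc.rename, rename_comp, ih]

theorem TOut.par_result {P x K} (h : TOut P x K) : ∀ (ρ : ℕ → ℕ) (F Q : PiProc),
    cl (K ρ (par F (Q.rename Nat.succ))) = cl (K ρ F) + cl Q := by
  induction h with
  | out x z P =>
    intro ρ F Q
    simp only [PiProc.rename, rename_comp, instName_comp_succ, cl_par, rename_id]
    abel
  | parL Q _ ih => intro ρ F Q; simp only [cl_par, ih]; abel
  | parR P _ ih => intro ρ F Q; simp only [cl_par, ih]; abel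
  | nu _ ih =>
    intro ρ F Q
    simp only [PiProc.rename, rename_comp, cl_nu, upRen_one_comp_succ]
    rw [← rename_comp, ih, cl_rename, PiCl.nu_add']
  | bang _ ih => intro ρ F Q; simp only [cl_par, ih]; abel

/-- A restriction around the receiver can be placed around the result. -/
theorem TOut.nu_result {P x K} (h : TOut P x K) : ∀ (ρ : ℕ → ℕ) (F : PiProc),
    cl (K ρ (PiProc.nu (F.rename swapName))) = (cl (K (Nat.succ ∘ ρ) F)).nu := by
  induction h with
  | out x z P =>
    intro ρ F
    simp only [PiProc.rename, rename_comp, upRen_instName_comp_swapName, cl_par, cl_nu]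
    rw [← rename_comp P, cl_rename Nat.succ, PiCl.nu_add']
    rfl
  | parL Q _ ih =>
    intro ρ F
    simp only [cl_par, ih]
    rw [← rename_comp Q, cl_rename Nat.succ, PiCl.nu_add']
  | parR P _ ih =>
    intro ρ F
    simp only [cl_par, ih]
    rw [← rename_comp P, cl_rename Nat.succ, PiCl.nu_add]
  | nu h ih =>
    intro ρ F
    simp only [PiProc.rename, rename_comp, cl_nu, ← swapName_comp_upRen]
    rw [← rename_comp, ih, ← PiCl.nu_swap, ← cl_rename, h.rename_result]
    simp only [rename_comp, upRen_comp, swapName_comp_upRen_succ]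
    rw [← Function.comp_assoc, swapName_comp_succ, upRen_comp]
  | bang h ih =>
    rename_i P x K
    intro ρ F
    simp only [cl_par, ih]
    rw [← rename_comp (PiProc.bang P), cl_rename Nat.succ, PiCl.nu_add']

theorem TIn.rename {P x F} (h : TIn P x F) :
    ∀ f, TIn (P.rename f) (f x) (F.rename (upRen 1 f)) := by
  induction h with
  | inp x P => intro f; exact .inp _ _
  | parL Q _ ih =>
    intro f
    have := TIn.parL (Q.rename f) (ih f)
    rwa [rename_comp, ← upRen_one_comp_succ, ← rename_comp] at this
  | parR P _ ih =>
    intro f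
    have := TIn.parR (P.rename f) (ih f)
    rwa [rename_comp, ← upRen_one_comp_succ, ← rename_comp] at this
  | @nu P x F _ ih =>
    intro f
    have h := ih (upRen 1 f)
    rw [upRen_one_succ] at h
    have := TIn.nu h
    rwa [rename_comp, swapName_comp_upRen, ← rename_comp] at this
  | @bang P x F _ ih =>
    intro f
    have := TIn.bang (ih f)
    change TIn _ _ (PiProc.par _ (((PiProc.bang P).rename f).rename _)) at this
    rwa [rename_comp, ← upRen_one_comp_succ, ← rename_comp] at this

theorem TIn.of_rename {P : PiProc} : ∀ {f : ℕ → ℕ} {y G}, TIn (P.rename f) y G →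
    ∃ x F, y = f x ∧ G = F.rename (upRen 1 f) ∧ TIn P x F := by
  induction P with
  | nu P ih =>
    intro f y G h
    cases h with
    | nu h =>
      obtain ⟨x, F, hx, rfl, hF⟩ := ih h
      rcases x with _ | x
      · simp at hx
      · simp at hx
        subst hx
        refine ⟨x, _, rfl, ?_, .nu hF⟩
        simp only [PiProc.rename, rename_comp, swapName_comp_upRen]
  | out x y P ih => intro f y G h; cases h
  | inp x P ih => intro f y G h; cases h; exact ⟨x, P, rfl, rfl, .inp x P⟩
  | bang P ih =>
    intro f y G h
    cases h with
    | bang h =>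
      obtain ⟨x, F, rfl, rfl, hF⟩ := ih h
      refine ⟨x, _, rfl, ?_, .bang hF⟩
      simp only [PiProc.rename, rename_comp, upRen_one_comp_succ]
  | par P Q ihP ihQ =>
    intro f y G h
    cases h with
    | parL _ h =>
      obtain ⟨x, F, rfl, rfl, hF⟩ := ihP h
      refine ⟨x, _, rfl, ?_, .parL _ hF⟩
      simp only [PiProc.rename, rename_comp, upRen_one_comp_succ]
    | parR _ h =>
      obtain ⟨x, F, rfl, rfl, hF⟩ := ihQ h
      refine ⟨x, _, rfl, ?_, .parR _ hF⟩
      simp only [PiProc.rename, rename_comp, upRen_one_comp_succ]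
  | zero => intro f y G h; cases h
  | success => intro f y G h; cases h

theorem TOut.rename {P x K} (h : TOut P x K) :
    ∀ f, TOut (P.rename f) (f x) (fun ρ F => K (ρ ∘ f) F) := by
  induction h with
  | out x z P =>
    intro f
    have := TOut.out (f x) (f z) (P.rename f)
    simp only [rename_comp] at this
    exact this
  | parL Q _ ih =>
    intro f
    have := TOut.parL (Q.rename f) (ih f)
    simp only [rename_comp] at this
    exact this
  | parR P _ ih =>
    intro f
    have := TOut.parR (P.rename f) (ih f)
    simp only [rename_comp] at this
    exact this
  | nu _ ih =>
    intro f
    have h := ih (upRen 1 f)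
    rw [upRen_one_succ] at h
    have := TOut.nu h
    simp only [upRen_comp] at this
    exact this
  | @bang P x K _ ih =>
    intro f
    have := TOut.bang (ih f)
    change TOut _ _ (fun ρ F => PiProc.par _ (((PiProc.bang P).rename f).rename _)) at this
    simp only [rename_comp] at this
    exact this

theorem TOut.of_rename {P : PiProc} : ∀ {f : ℕ → ℕ} {y G}, TOut (P.rename f) y G →
    ∃ x K, y = f x ∧ G = (fun ρ F => K (ρ ∘ f) F) ∧ TOut P x K := by
  induction P with
  | nu P ih =>
    intro f y G h
    cases h with
    | nu h =>
      obtain ⟨x, K, hx, rfl, hK⟩ := ih h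
      rcases x with _ | x
      · simp at hx
      · simp at hx
        subst hx
        refine ⟨x, _, rfl, ?_, .nu hK⟩
        simp only [upRen_comp]
  | out x y P ih =>
    intro f y G h
    cases h
    refine ⟨x, _, rfl, ?_, .out _ _ P⟩
    simp only [rename_comp, Function.comp_apply]
  | inp x P ih => intro f y G h; cases h
  | bang P ih =>
    intro f y G h
    cases h with
    | bang h =>
      obtain ⟨x, K, rfl, rfl, hK⟩ := ih h
      refine ⟨x, _, rfl, ?_, .bang hK⟩
      simp only [PiProc.rename, rename_comp]
  | par P Q ihP ihQ =>
    intro f y G h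
    cases h with
    | parL _ h =>
      obtain ⟨x, F, rfl, rfl, hF⟩ := ihP h
      refine ⟨x, _, rfl, ?_, .parL _ hF⟩
      simp only [rename_comp]
    | parR _ h =>
      obtain ⟨x, F, rfl, rfl, hF⟩ := ihQ h
      refine ⟨x, _, rfl, ?_, .parR _ hF⟩
      simp only [rename_comp]
  | zero => intro f y G h; cases h
  | success => intro f y G h; cases h

theorem TTau.rename {P P'} (h : TTau P P') : ∀ f, TTau (P.rename f) (P'.rename f) := by
  induction h with
  | comL hF hK =>
    intro f
    rw [hK.rename_result]
    exact .comL (hF.rename f) (hK.rename f)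
  | comR hK hF =>
    intro f
    rw [hK.rename_result]
    exact .comR (hK.rename f) (hF.rename f)
  | parL Q _ ih => intro f; exact .parL _ (ih f)
  | parR P _ ih => intro f; exact .parR _ (ih f)
  | nu _ ih => intro f; exact .nu (ih _)
  | bang _ ih => intro f; exact .bang (ih f)
  | bangCom hF hK =>
    intro f
    simp only [PiProc.rename]
    rw [hK.rename_result]
    exact .bangCom (hF.rename f) (hK.rename f)

theorem TTau.of_rename {P : PiProc} : ∀ {f : ℕ → ℕ} {G}, Function.Injective f →
    TTau (P.rename f) G → ∃ P', G = P'.rename f ∧ TTau P P' := by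
  induction P with
  | nu P ih =>
    intro f G hf h
    cases h with
    | nu h =>
      obtain ⟨P', rfl, hP'⟩ := ih (upRen_injective hf) h
      exact ⟨_, rfl, .nu hP'⟩
  | out x y P ih => intro f G hf h; cases h
  | inp x P ih => intro f G hf h; cases h
  | bang P ih =>
    intro f G hf h
    cases h with
    | bang h =>
      obtain ⟨P', rfl, hP'⟩ := ih hf h
      exact ⟨_, rfl, .bang hP'⟩
    | bangCom hF hK =>
      obtain ⟨x, F, rfl, rfl, hF'⟩ := hF.of_rename
      obtain ⟨x', K, hx, rfl, hK'⟩ := hK.of_rename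
      obtain rfl := hf hx
      refine ⟨_, ?_, .bangCom hF' hK'⟩
      simp only [PiProc.rename]
      rw [hK'.rename_result]
      rfl
  | par P Q ihP ihQ =>
    intro f G hf h
    cases h with
    | parL _ h =>
      obtain ⟨P', rfl, hP'⟩ := ihP hf h
      exact ⟨_, rfl, .parL _ hP'⟩
    | parR _ h =>
      obtain ⟨P', rfl, hP'⟩ := ihQ hf h
      exact ⟨_, rfl, .parR _ hP'⟩
    | comL hF hK =>
      obtain ⟨x, F, rfl, rfl, hF'⟩ := hF.of_rename
      obtain ⟨x', K, hx, rfl, hK'⟩ := hK.of_rename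
      obtain rfl := hf hx
      refine ⟨_, ?_, .comL hF' hK'⟩
      rw [hK'.rename_result]
      rfl
    | comR hK hF =>
      obtain ⟨x, F, rfl, rfl, hF'⟩ := hF.of_rename
      obtain ⟨x', K, hx, rfl, hK'⟩ := hK.of_rename
      obtain rfl := hf hx
      refine ⟨_, ?_, .comR hK' hF'⟩
      rw [hK'.rename_result]
      rfl
  | zero => intro f G hf h; cases h
  | success => intro f G hf h; cases h

/-! ### Structural congruence is a bisimulation -/

/-- Every transition of `P` is matched by `Q` up to structural congruence. -/
structure Matched (P Q : PiProc) : Prop where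
  tin : ∀ x F, TIn P x F → ∃ F', TIn Q x F' ∧ cl F = cl F'
  tout : ∀ x K, TOut P x K → ∃ K', TOut Q x K' ∧ ∀ ρ F, cl (K ρ F) = cl (K' ρ F)
  ttau : ∀ P', TTau P P' → ∃ Q', TTau Q Q' ∧ cl P' = cl Q'

theorem Matched.trans {P Q R : PiProc} (h₁ : Matched P Q) (h₂ : Matched Q R) : Matched P R where
  tin x F h := by
    obtain ⟨F', h, e⟩ := h₁.tin x F h
    obtain ⟨F'', h, e'⟩ := h₂.tin x F' h
    exact ⟨F'', h, e.trans e'⟩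
  tout x K h := by
    obtain ⟨F', h, e⟩ := h₁.tout x K h
    obtain ⟨F'', h, e'⟩ := h₂.tout x F' h
    exact ⟨F'', h, fun ρ F => (e ρ F).trans (e' ρ F)⟩
  ttau P' h := by
    obtain ⟨F', h, e⟩ := h₁.ttau P' h
    obtain ⟨F'', h, e'⟩ := h₂.ttau F' h
    exact ⟨F'', h, e.trans e'⟩

theorem Matched.nu {P Q : PiProc} (h : Matched P Q) : Matched (nu P) (nu Q) where
  tin x F hF := by
    cases hF with
    | nu hF =>
      obtain ⟨F', hF', e⟩ := h.tin _ _ hF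
      exact ⟨_, .nu hF', by simp only [cl_nu, cl_rename, e]⟩
  tout x K hK := by
    cases hK with
    | nu hK =>
      obtain ⟨K', hK', e⟩ := h.tout _ _ hK
      exact ⟨_, .nu hK', fun ρ F => by simp only [cl_nu, e]⟩
  ttau P' hP := by
    cases hP with
    | nu hP =>
      obtain ⟨Q', hQ, e⟩ := h.ttau _ hP
      exact ⟨_, .nu hQ, by simp only [cl_nu, e]⟩

theorem Matched.out {P Q : PiProc} (x y : ℕ) (h : cl P = cl Q) :
    Matched (out x y P) (out x y Q) where
  tin x F hF := by cases hF
  tout x K hK := by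
    cases hK
    exact ⟨_, .out _ _ _, fun ρ F => by simp only [cl_par, cl_rename, h]⟩
  ttau P' hP := by cases hP

theorem Matched.inp {P Q : PiProc} (x : ℕ) (h : cl P = cl Q) : Matched (inp x P) (inp x Q) where
  tin x F hF := by
    cases hF
    exact ⟨_, .inp _ _, h⟩
  tout x K hK := by cases hK
  ttau P' hP := by cases hP

theorem cl_bang_congr {P Q : PiProc} (h : cl P = cl Q) : cl (bang P) = cl (bang Q) :=
  cl_eq.2 (.congrBang (cl_eq.1 h))

/-- Interactions of matching transitions have congruent results. -/
theorem cl_com_congr {P Q : PiProc} {x K K' F F'} (hK : TOut P x K) (_ : TOut Q x K')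
    (hF : cl F = cl F') (e : ∀ ρ F, cl (K ρ F) = cl (K' ρ F)) : cl (K id F) = cl (K' id F') := by
  rw [hK.cong id hF, e]

theorem Matched.bang {P Q : PiProc} (h : Matched P Q) (hc : cl P = cl Q) :
    Matched (bang P) (bang Q) where
  tin x F hF := by
    cases hF with
    | bang hF =>
      obtain ⟨F', hF', e⟩ := h.tin _ _ hF
      exact ⟨_, .bang hF', by simp only [cl_par, cl_rename, e, cl_bang_congr hc]⟩
  tout x K hK := by
    cases hK with
    | bang hK =>
      obtain ⟨K', hK', e⟩ := h.tout _ _ hK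
      exact ⟨_, .bang hK', fun ρ F => by simp only [cl_par, cl_rename, e, cl_bang_congr hc]⟩
  ttau P' hP := by
    cases hP with
    | bang hP =>
      obtain ⟨Q', hQ, e⟩ := h.ttau _ hP
      exact ⟨_, .bang hQ, by simp only [cl_par, e, cl_bang_congr hc]⟩
    | bangCom hF hK =>
      obtain ⟨F', hF', e⟩ := h.tin _ _ hF
      obtain ⟨K', hK', e'⟩ := h.tout _ _ hK
      exact ⟨_, .bangCom hF' hK', by
        simp only [cl_par, cl_com_congr hK hK' e e', cl_bang_congr hc]⟩

theorem Matched.par {P Q P₂ Q₂ : PiProc} (h : Matched P Q) (hc : cl P = cl Q)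
    (h₂ : Matched P₂ Q₂) (hc₂ : cl P₂ = cl Q₂) : Matched (par P P₂) (par Q Q₂) where
  tin x F hF := by
    cases hF with
    | parL _ hF =>
      obtain ⟨F', hF', e⟩ := h.tin _ _ hF
      exact ⟨_, .parL _ hF', by simp only [cl_par, cl_rename, e, hc₂]⟩
    | parR _ hF =>
      obtain ⟨F', hF', e⟩ := h₂.tin _ _ hF
      exact ⟨_, .parR _ hF', by simp only [cl_par, cl_rename, e, hc]⟩
  tout x K hK := by
    cases hK with
    | parL _ hK =>
      obtain ⟨K', hK', e⟩ := h.tout _ _ hK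
      exact ⟨_, .parL _ hK', fun ρ F => by simp only [cl_par, cl_rename, e, hc₂]⟩
    | parR _ hK =>
      obtain ⟨K', hK', e⟩ := h₂.tout _ _ hK
      exact ⟨_, .parR _ hK', fun ρ F => by simp only [cl_par, cl_rename, e, hc]⟩
  ttau P' hP := by
    cases hP with
    | parL _ hP =>
      obtain ⟨Q', hQ, e⟩ := h.ttau _ hP
      exact ⟨_, .parL _ hQ, by simp only [cl_par, e, hc₂]⟩
    | parR _ hP =>
      obtain ⟨Q', hQ, e⟩ := h₂.ttau _ hP
      exact ⟨_, .parR _ hQ, by simp only [cl_par, e, hc]⟩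
    | comL hF hK =>
      obtain ⟨F', hF', e⟩ := h.tin _ _ hF
      obtain ⟨K', hK', e'⟩ := h₂.tout _ _ hK
      exact ⟨_, .comL hF' hK', cl_com_congr hK hK' e e'⟩
    | comR hK hF =>
      obtain ⟨F', hF', e⟩ := h₂.tin _ _ hF
      obtain ⟨K', hK', e'⟩ := h.tout _ _ hK
      exact ⟨_, .comR hK' hF', cl_com_congr hK hK' e e'⟩

theorem matched_parComm (P Q : PiProc) : Matched (par P Q) (par Q P) where
  tin x F hF := by
    cases hF with
    | parL _ hF => exact ⟨_, .parR _ hF, by simp only [cl_par, add_comm]⟩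
    | parR _ hF => exact ⟨_, .parL _ hF, by simp only [cl_par, add_comm]⟩
  tout x K hK := by
    cases hK with
    | parL _ hK => exact ⟨_, .parR _ hK, fun ρ F => by simp only [cl_par, add_comm]⟩
    | parR _ hK => exact ⟨_, .parL _ hK, fun ρ F => by simp only [cl_par, add_comm]⟩
  ttau P' hP := by
    cases hP with
    | parL _ hP => exact ⟨_, .parR _ hP, by simp only [cl_par, add_comm]⟩
    | parR _ hP => exact ⟨_, .parL _ hP, by simp only [cl_par, add_comm]⟩
    | comL hF hK => exact ⟨_, .comR hK hF, rfl⟩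
    | comR hK hF => exact ⟨_, .comL hF hK, rfl⟩

theorem matched_parAssoc (P Q R : PiProc) : Matched (par P (par Q R)) (par (par P Q) R) where
  tin x F hF := by
    cases hF with
    | parL _ hF => exact ⟨_, .parL _ (.parL _ hF), by simp only [PiProc.rename, cl_par, add_assoc]⟩
    | parR _ hF =>
      cases hF with
      | parL _ hF =>
        exact ⟨_, .parL _ (.parR _ hF), by simp only [cl_par, add_assoc]⟩
      | parR _ hF => exact ⟨_, .parR _ hF, by simp only [PiProc.rename, cl_par, add_assoc]⟩
  tout x K hK := by
    cases hK with
    | parL _ hK =>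
      exact ⟨_, .parL _ (.parL _ hK), fun ρ F => by simp only [PiProc.rename, cl_par, add_assoc]⟩
    | parR _ hK =>
      cases hK with
      | parL _ hK =>
        exact ⟨_, .parL _ (.parR _ hK), fun ρ F => by simp only [cl_par, add_assoc]⟩
      | parR _ hK =>
        exact ⟨_, .parR _ hK, fun ρ F => by simp only [PiProc.rename, cl_par, add_assoc]⟩
  ttau P' hP := by
    cases hP with
    | parL _ hP => exact ⟨_, .parL _ (.parL _ hP), by simp only [cl_par, add_assoc]⟩
    | parR _ hP =>
      cases hP with
      | parL _ hP => exact ⟨_, .parL _ (.parR _ hP), by simp only [cl_par, add_assoc]⟩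
      | parR _ hP => exact ⟨_, .parR _ hP, by simp only [cl_par, add_assoc]⟩
      | comL hF hK =>
        exact ⟨_, .comL (.parR _ hF) hK, by
          rw [hK.cong id (cl_eq.2 (.parComm (P.rename Nat.succ) _)), hK.par_result, cl_par,
            add_comm]⟩
      | comR hK hF =>
        exact ⟨_, .comR (.parR _ hK) hF, by simp only [cl_par, rename_id]⟩
    | comL hF hK =>
      cases hK with
      | parL _ hK => exact ⟨_, .parL _ (.comL hF hK), by simp only [rename_id]⟩
      | parR _ hK =>
        exact ⟨_, .comL (.parL _ hF) hK, by
          simp only [cl_par, rename_id]; rw [hK.par_result, add_comm]⟩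
    | comR hK hF =>
      cases hF with
      | parL _ hF =>
        exact ⟨_, .parL _ (.comR hK hF), by rw [hK.par_result, cl_par]⟩
      | parR _ hF =>
        refine ⟨_, .comR (.parL _ hK) hF, ?_⟩
        rw [hK.cong id (cl_eq.2 (.parComm _ _)), hK.par_result]
        simp only [cl_par, rename_id]

theorem Matched.refl (P : PiProc) : Matched P P where
  tin _ F h := ⟨F, h, rfl⟩
  tout _ K h := ⟨K, h, fun _ _ => rfl⟩
  ttau P' h := ⟨P', h, rfl⟩

theorem matched_parAssoc_symm (P Q R : PiProc) :
    Matched (par (par P Q) R) (par P (par Q R)) :=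
  ((matched_parComm _ _).trans (.par (.refl R) rfl (matched_parComm _ _)
    (cl_eq.2 (.parComm P Q)))).trans ((matched_parAssoc R Q P).trans
      ((matched_parComm _ _).trans (.par (.refl P) rfl (matched_parComm _ _)
        (cl_eq.2 (.parComm R Q)))))

theorem matched_nuPar (P Q : PiProc) :
    Matched (nu (par (P.rename Nat.succ) Q)) (par P (nu Q)) where
  tin x F hF := by
    rcases hF with _ | _ | _ | ⟨hF⟩
    rcases hF with _ | ⟨_, hF⟩ | ⟨_, hF⟩
    · obtain ⟨y, F, hy, rfl, hF⟩ := hF.of_rename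
      obtain rfl : x = y := by simpa using hy
      refine ⟨_, .parL _ hF, ?_⟩
      simp only [PiProc.rename, rename_comp, swapName_comp_upRen_succ, swapName_comp_succ,
        cl_nu, cl_par]
      rw [cl_rename Nat.succ, PiCl.nu_add]
    · refine ⟨_, .parR _ (.nu hF), ?_⟩
      simp only [PiProc.rename, rename_comp, cl_nu, cl_par]
      rw [← Function.comp_assoc, swapName_comp_succ, upRen_one_comp_succ, ← rename_comp,
        cl_rename Nat.succ, PiCl.nu_add]
  tout x K hK := by
    rcases hK with _ | _ | _ | ⟨hK⟩
    rcases hK with _ | ⟨_, hK⟩ | ⟨_, hK⟩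
    · obtain ⟨y, K, hy, rfl, hK⟩ := hK.of_rename
      obtain rfl : x = y := by simpa using hy
      refine ⟨_, .parL _ hK, fun ρ F => ?_⟩
      simp only [cl_nu, cl_par, upRen_one_comp_succ]
      rw [← hK.rename_result, cl_rename Nat.succ, PiCl.nu_add]
      rfl
    · refine ⟨_, .parR _ (.nu hK), fun ρ F => ?_⟩
      simp only [cl_nu, cl_par, rename_comp, upRen_one_comp_succ]
      rw [← rename_comp, cl_rename Nat.succ, PiCl.nu_add]
  ttau P' hP := by
    rcases hP with _ | _ | _ | _ | ⟨hP⟩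
    cases hP with
    | parL _ hP =>
      obtain ⟨P', rfl, hP'⟩ := hP.of_rename Nat.succ_injective
      exact ⟨_, .parL _ hP', cl_eq.2 (.nuPar _ _)⟩
    | parR _ hP => exact ⟨_, .parR _ (.nu hP), cl_eq.2 (.nuPar _ _)⟩
    | comL hF hK =>
      obtain ⟨y, F, rfl, rfl, hF'⟩ := hF.of_rename
      exact ⟨_, .comL hF' (.nu hK), by simp only [upRen_id]⟩
    | comR hK hF =>
      obtain ⟨y, K, rfl, rfl, hK'⟩ := hK.of_rename
      exact ⟨_, .comR hK' (.nu hF), (hK'.nu_result _ _).symm⟩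

theorem matched_nuPar_symm (P Q : PiProc) :
    Matched (par P (nu Q)) (nu (par (P.rename Nat.succ) Q)) where
  tin x F hF := by
    rcases hF with _ | ⟨_, hF⟩ | ⟨_, hF⟩
    · refine ⟨_, .nu (.parL _ (hF.rename _)), ?_⟩
      simp only [PiProc.rename, rename_comp, swapName_comp_upRen_succ, swapName_comp_succ,
        cl_nu, cl_par]
      rename_i F
      rw [← PiCl.nu_add]
      rfl
    · rcases hF with _ | _ | _ | ⟨hF⟩
      refine ⟨_, .nu (.parR _ hF), ?_⟩
      simp only [PiProc.rename, rename_comp, cl_nu, cl_par]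
      rw [← Function.comp_assoc, swapName_comp_succ, upRen_one_comp_succ, ← rename_comp,
        cl_rename Nat.succ (P.rename Nat.succ), PiCl.nu_add]
  tout x K hK := by
    rcases hK with _ | ⟨_, hK⟩ | ⟨_, hK⟩
    · refine ⟨_, .nu (.parL _ (hK.rename _)), fun ρ F => ?_⟩
      simp only [cl_nu, cl_par, upRen_one_comp_succ]
      rw [← hK.rename_result, cl_rename Nat.succ, PiCl.nu_add]
      rfl
    · rcases hK with _ | _ | _ | ⟨hK⟩
      refine ⟨_, .nu (.parR _ hK), fun ρ F => ?_⟩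
      simp only [cl_nu, cl_par, rename_comp, upRen_one_comp_succ]
      rw [← rename_comp, cl_rename Nat.succ, PiCl.nu_add]
  ttau P' hP := by
    cases hP with
    | parL _ hP => exact ⟨_, .nu (.parL _ (hP.rename _)), (cl_eq.2 (.nuPar _ _)).symm⟩
    | parR _ hP =>
      rcases hP with _ | _ | _ | _ | ⟨hP⟩
      exact ⟨_, .nu (.parR _ hP), (cl_eq.2 (.nuPar _ _)).symm⟩
    | comL hF hK =>
      rcases hK with _ | _ | _ | ⟨hK⟩
      exact ⟨_, .nu (.comL (hF.rename _) hK), by simp only [upRen_id]⟩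
    | comR hK hF =>
      rcases hF with _ | _ | _ | ⟨hF⟩
      exact ⟨_, .nu (.comR (hK.rename _) hF), hK.nu_result _ _⟩

theorem matched_parZero (P : PiProc) : Matched (par P zero) P where
  tin x F hF := by
    rcases hF with _ | ⟨_, hF⟩ | ⟨_, ⟨⟩⟩
    exact ⟨_, hF, cl_eq.2 (.parZero _)⟩
  tout x K hK := by
    rcases hK with _ | ⟨_, hK⟩ | ⟨_, ⟨⟩⟩
    exact ⟨_, hK, fun ρ F => cl_eq.2 (.parZero _)⟩
  ttau P' hP := by
    rcases hP with ⟨_, ⟨⟩⟩ | ⟨_, ⟨⟩⟩ | ⟨_, hP⟩ | ⟨_, ⟨⟩⟩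
    exact ⟨_, hP, cl_eq.2 (.parZero _)⟩

theorem matched_parZero_symm (P : PiProc) : Matched P (par P zero) where
  tin _ _ hF := ⟨_, .parL _ hF, (cl_eq.2 (.parZero _)).symm⟩
  tout _ _ hK := ⟨_, .parL _ hK, fun _ _ => (cl_eq.2 (.parZero _)).symm⟩
  ttau _ hP := ⟨_, .parL _ hP, (cl_eq.2 (.parZero _)).symm⟩

/-- The process `P` has no transitions. -/
structure Inert (P : PiProc) : Prop where
  tin : ∀ x F, ¬ TIn P x F
  tout : ∀ x K, ¬ TOut P x K
  ttau : ∀ P', ¬ TTau P P'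

theorem Inert.matched {P : PiProc} (h : Inert P) (Q : PiProc) : Matched P Q where
  tin x F hF := (h.tin x F hF).elim
  tout x K hK := (h.tout x K hK).elim
  ttau P' hP := (h.ttau P' hP).elim

theorem inert_zero : Inert zero := ⟨nofun, nofun, nofun⟩

theorem inert_success : Inert success := ⟨nofun, nofun, nofun⟩

theorem Inert.nu {P : PiProc} (h : Inert P) : Inert (nu P) where
  tin x F hF := by
    rcases hF with _ | _ | _ | ⟨hF⟩
    exact h.tin _ _ hF
  tout x K hK := by
    rcases hK with _ | _ | _ | ⟨hK⟩
    exact h.tout _ _ hK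
  ttau P' hP := by
    rcases hP with _ | _ | _ | _ | ⟨hP⟩
    exact h.ttau _ hP

theorem matched_nuSwap (P : PiProc) : Matched (nu (nu P)) (nu (nu (P.rename swapName))) where
  tin x F hF := by
    rcases hF with _ | _ | _ | ⟨hF⟩
    rcases hF with _ | _ | _ | ⟨hF⟩
    refine ⟨_, .nu (.nu (hF.rename swapName)), ?_⟩
    have e : swapName ∘ upRen 1 swapName ∘ swapName =
        (upRen 1 swapName ∘ swapName) ∘ upRen 1 swapName := by
      funext y
      rcases y with _ | _ | _ | y <;> simp [swapName]
    simp only [PiProc.rename, rename_comp, cl_nu]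
    rw [← PiCl.nu_swap, ← cl_rename, rename_comp, e, Function.comp_assoc]
  tout x K hK := by
    rcases hK with _ | _ | _ | ⟨hK⟩
    rcases hK with _ | _ | _ | ⟨hK⟩
    refine ⟨_, .nu (.nu (hK.rename swapName)), fun ρ F => ?_⟩
    have e : upRen 1 swapName ∘ upRen 1 Nat.succ ∘ upRen 1 Nat.succ =
        upRen 1 Nat.succ ∘ upRen 1 Nat.succ := by
      funext y
      rcases y with _ | y <;> simp [swapName]
    simp only [rename_comp, cl_nu]
    rw [← PiCl.nu_swap, ← cl_rename, hK.rename_result, rename_comp, e, swapName_comp_upRen]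
  ttau P' hP := by
    rcases hP with _ | _ | _ | _ | ⟨hP⟩
    rcases hP with _ | _ | _ | _ | ⟨hP⟩
    exact ⟨_, .nu (.nu (hP.rename _)), cl_eq.2 (.nuSwap _)⟩

theorem matched_bangUnfold (P : PiProc) : Matched (bang P) (par P (bang P)) where
  tin x F hF := by
    cases hF with
    | bang hF => exact ⟨_, .parL _ hF, rfl⟩
  tout x K hK := by
    cases hK with
    | bang hK => exact ⟨_, .parL _ hK, fun _ _ => rfl⟩
  ttau P' hP := by
    cases hP with
    | bang hP => exact ⟨_, .parL _ hP, rfl⟩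
    | bangCom hF hK => exact ⟨_, .comL hF (.bang hK), by simp only [rename_id]⟩

theorem matched_bangUnfold_symm (P : PiProc) : Matched (par P (bang P)) (bang P) where
  tin x F hF := by
    rcases hF with _ | ⟨_, hF⟩ | ⟨_, hF⟩
    · exact ⟨_, .bang hF, rfl⟩
    · cases hF with
      | bang hF =>
        refine ⟨_, .bang hF, ?_⟩
        conv_rhs => rw [cl_par, cl_rename, cl_bang, PiCl.ren_add, ← cl_rename, ← cl_rename]
        simp only [cl_par]
        abel
  tout x K hK := by
    rcases hK with _ | ⟨_, hK⟩ | ⟨_, hK⟩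
    · exact ⟨_, .bang hK, fun _ _ => rfl⟩
    · cases hK with
      | bang hK =>
        refine ⟨_, .bang hK, fun ρ F => ?_⟩
        conv_rhs => rw [cl_par, cl_rename, cl_bang, PiCl.ren_add, ← cl_rename, ← cl_rename]
        simp only [cl_par]
        abel
  ttau P' hP := by
    cases hP with
    | parL _ hP => exact ⟨_, .bang hP, rfl⟩
    | parR _ hP =>
      cases hP with
      | bang hP =>
        refine ⟨_, .bang hP, ?_⟩
        conv_rhs => rw [cl_par, cl_bang]
        simp only [cl_par]
        abel
      | bangCom hF hK =>
        refine ⟨_, .bangCom hF hK, ?_⟩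
        conv_rhs => rw [cl_par, cl_bang]
        simp only [cl_par]
        abel
    | comL hF hK =>
      cases hK with
      | bang hK => exact ⟨_, .bangCom hF hK, by simp only [rename_id]⟩
    | comR hK hF =>
      cases hF with
      | bang hF => exact ⟨_, .bangCom hF hK, by rw [hK.par_result, cl_par]⟩

/-- Structurally congruent processes have the same transitions, up to structural congruence. -/
theorem Cong.matched {P Q : PiProc} (h : Cong P Q) : Matched P Q ∧ Matched Q P := by
  induction h with
  | refl P => exact ⟨.refl P, .refl P⟩
  | symm _ ih => exact ih.symm
  | trans _ _ ih₁ ih₂ => exact ⟨ih₁.1.trans ih₂.1, ih₂.2.trans ih₁.2⟩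
  | congrNu _ ih => exact ⟨ih.1.nu, ih.2.nu⟩
  | congrOut x y h => exact ⟨.out _ _ (cl_eq.2 h), .out _ _ (cl_eq.2 h.symm)⟩
  | congrInp x h => exact ⟨.inp _ (cl_eq.2 h), .inp _ (cl_eq.2 h.symm)⟩
  | congrBang h ih => exact ⟨ih.1.bang (cl_eq.2 h), ih.2.bang (cl_eq.2 h.symm)⟩
  | congrPar h₁ h₂ ih₁ ih₂ =>
    exact ⟨ih₁.1.par (cl_eq.2 h₁) ih₂.1 (cl_eq.2 h₂),
      ih₁.2.par (cl_eq.2 h₁.symm) ih₂.2 (cl_eq.2 h₂.symm)⟩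
  | parAssoc P Q R => exact ⟨matched_parAssoc P Q R, matched_parAssoc_symm P Q R⟩
  | nuPar P Q => exact ⟨matched_nuPar P Q, matched_nuPar_symm P Q⟩
  | parZero P => exact ⟨matched_parZero P, matched_parZero_symm P⟩
  | nuZero => exact ⟨inert_zero.nu.matched _, inert_zero.matched _⟩
  | nuSuccess => exact ⟨inert_success.nu.matched _, inert_success.matched _⟩
  | nuSwap P =>
    refine ⟨matched_nuSwap P, ?_⟩
    have := matched_nuSwap (P.rename swapName)
    rwa [rename_comp, swapName_comp_self, rename_id] at this
  | parComm P Q => exact ⟨matched_parComm P Q, matched_parComm Q P⟩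
  | bangUnfold P => exact ⟨matched_bangUnfold P, matched_bangUnfold_symm P⟩

/-! ### Reduction and success, structurally -/

/-- An interaction inside a reduction context is an internal transition. -/
theorem exists_ttau_plug (D : RCtx) (x z : ℕ) (P Q : PiProc) :
    ∃ R, TTau (D.plug (par (inp x P) (out x z Q))) R ∧
      cl (D.plug (par (P.rename (instName z)) Q)) = cl R := by
  induction D with
  | hole => exact ⟨_, .comL (.inp x P) (.out x z Q), by simp only [RCtx.plug, id, rename_id]⟩
  | parL D R ih =>
    obtain ⟨S, hS, e⟩ := ih
    exact ⟨_, .parL _ hS, by simp only [RCtx.plug, cl_par, e]⟩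
  | parR R D ih =>
    obtain ⟨S, hS, e⟩ := ih
    exact ⟨_, .parR _ hS, by simp only [RCtx.plug, cl_par, e]⟩
  | nu D ih =>
    obtain ⟨S, hS, e⟩ := ih
    exact ⟨_, .nu hS, by simp only [RCtx.plug, cl_nu, e]⟩

/-- Standard reduction is an internal transition up to structural congruence. -/
theorem Step.exists_ttau {P Q R : PiProc} (h : Step P Q) (hR : cl P = cl R) :
    ∃ R', TTau R R' ∧ cl Q = cl R' := by
  obtain ⟨D, P', Q', hP, ⟨x, z, P₁, P₂⟩, hQ⟩ := h
  obtain ⟨S, hS, e⟩ := exists_ttau_plug D x z P₁ P₂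
  obtain ⟨R', hR', e'⟩ := (Cong.trans (cl_eq.1 hR.symm) hP).matched.2.ttau S hS
  exact ⟨R', hR', by rw [← e', ← e, cl_eq.2 hQ]⟩

theorem Step.cl_left {P P' Q : PiProc} (h : Step P Q) (e : cl P = cl P') : Step P' Q := by
  obtain ⟨D, A, B, hP, hi, hQ⟩ := h
  exact ⟨D, A, B, (cl_eq.1 e).symm.trans hP, hi, hQ⟩

theorem Step.cl_right {P Q Q' : PiProc} (h : Step P Q) (e : cl Q = cl Q') : Step P Q' := by
  obtain ⟨D, A, B, hP, hi, hQ⟩ := h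
  exact ⟨D, A, B, hP, hi, hQ.trans (cl_eq.1 e)⟩

theorem Step.nu {P Q : PiProc} (h : Step P Q) : Step (nu P) (nu Q) := by
  obtain ⟨D, A, B, hP, hi, hQ⟩ := h
  exact ⟨.nu D, A, B, .congrNu hP, hi, .congrNu hQ⟩

theorem Step.parL {P Q : PiProc} (h : Step P Q) (R : PiProc) : Step (par P R) (par Q R) := by
  obtain ⟨D, A, B, hP, hi, hQ⟩ := h
  exact ⟨.parL D R, A, B, .congrPar hP (.refl _), hi, .congrPar hQ (.refl _)⟩

/-- The success constant occurs in the process, not below a prefix. -/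
def HasStop : PiProc → Prop
  | nu P => HasStop P
  | bang P => HasStop P
  | par P Q => HasStop P ∨ HasStop Q
  | success => True
  | _ => False

@[simp] theorem hasStop_rename (P : PiProc) : ∀ f, HasStop (P.rename f) ↔ HasStop P := by
  induction P <;> intro f <;> simp [rename, HasStop, *]

theorem Cong.hasStop {P Q : PiProc} (h : Cong P Q) : HasStop P ↔ HasStop Q := by
  induction h <;> simp [HasStop, *, or_assoc, or_comm]

theorem HasStop.cl {P Q : PiProc} (h : HasStop P) (e : cl P = cl Q) : HasStop Q :=
  (cl_eq.1 e).hasStop.1 h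

theorem HasStop.exists_ctx {P : PiProc} (h : HasStop P) :
    ∃ D : RCtx, PiProc.cl P = PiProc.cl (D.plug success) := by
  induction P with
  | nu P ih =>
    obtain ⟨D, e⟩ := ih h
    exact ⟨.nu D, by simp only [RCtx.plug, cl_nu, e]⟩
  | bang P ih =>
    obtain ⟨D, e⟩ := ih h
    exact ⟨.parL D (.bang P), by rw [cl_bang]; simp only [RCtx.plug, cl_par, e]⟩
  | par P Q ihP ihQ =>
    rcases h with h | h
    · obtain ⟨D, e⟩ := ihP h
      exact ⟨.parL D Q, by simp only [RCtx.plug, cl_par, e]⟩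
    · obtain ⟨D, e⟩ := ihQ h
      exact ⟨.parR P D, by simp only [RCtx.plug, cl_par, e]⟩
  | success => exact ⟨.hole, rfl⟩
  | _ => exact h.elim

/-- Success is decided by the syntax, hence it can be followed through structural congruence. -/
theorem successful_iff {P : PiProc} : Successful P ↔ HasStop P := by
  constructor
  · rintro ⟨D, h⟩
    rw [h.hasStop]
    clear h
    induction D <;> simp [RCtx.plug, HasStop, *]
  · intro h
    obtain ⟨D, e⟩ := h.exists_ctx
    exact ⟨D, cl_eq.1 e⟩

/-! ### Unfolding a process to its prefixes -/

/-- All free names of the process are smaller than `k`. -/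
def Below : ℕ → PiProc → Prop
  | k, nu P => Below (k + 1) P
  | k, out x y P => x < k ∧ y < k ∧ Below k P
  | k, inp x P => x < k ∧ Below (k + 1) P
  | k, bang P => Below k P
  | k, par P Q => Below k P ∧ Below k Q
  | _, zero => True
  | _, success => True

theorem upRen_lt {k k' : ℕ} {f : ℕ → ℕ} (hf : ∀ x < k, f x < k') :
    ∀ x < k + 1, upRen 1 f x < k' + 1 := by
  intro x hx
  rcases x with _ | x
  · simp
  · simp only [upRen_one_succ]
    have := hf x (by omega)
    omega

theorem Below.rename {P : PiProc} : ∀ {k k' : ℕ} {f : ℕ → ℕ}, Below k P →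
    (∀ x < k, f x < k') → Below k' (P.rename f) := by
  induction P with
  | nu P ih => intro k k' f h hf; exact ih (k := k + 1) h (upRen_lt hf)
  | out x y P ih => intro k k' f h hf; exact ⟨hf _ h.1, hf _ h.2.1, ih h.2.2 hf⟩
  | inp x P ih => intro k k' f h hf; exact ⟨hf _ h.1, ih h.2 (upRen_lt hf)⟩
  | bang P ih => intro k k' f h hf; exact ih (k := k) h hf
  | par P Q ihP ihQ => intro k k' f h hf; exact ⟨ihP h.1 hf, ihQ h.2 hf⟩
  | zero => intros; trivial
  | success => intros; trivial

theorem Below.mono {P : PiProc} {k k' : ℕ} (h : Below k P) (hk : k ≤ k') : Below k' P := by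
  have := h.rename (k' := k') (f := id) fun x hx => hx.trans_le hk
  rwa [rename_id] at this

theorem exists_below (P : PiProc) : ∃ k, Below k P := by
  induction P with
  | nu P ih => obtain ⟨k, h⟩ := ih; exact ⟨k, h.mono (Nat.le_succ k)⟩
  | out x y P ih =>
    obtain ⟨k, h⟩ := ih
    exact ⟨k + x + y + 1, by omega, by omega, h.mono (by omega)⟩
  | inp x P ih =>
    obtain ⟨k, h⟩ := ih
    exact ⟨k + x + 1, by omega, h.mono (by omega)⟩
  | bang P ih => obtain ⟨k, h⟩ := ih; exact ⟨k, h⟩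
  | par P Q ihP ihQ =>
    obtain ⟨k, h⟩ := ihP
    obtain ⟨l, h'⟩ := ihQ
    exact ⟨k + l, h.mono (by omega), h'.mono (by omega)⟩
  | zero => exact ⟨0, trivial⟩
  | success => exact ⟨0, trivial⟩

/-- The class of `νx₁…xₖ.(P₁ | … | Pₙ)` for the multiset `L` of the `Pᵢ`. -/
def rd (k : ℕ) (L : Multiset PiProc) : PiCl := PiCl.nu^[k] (L.map cl).sum

theorem sum_cl_rename (f : ℕ → ℕ) (L : Multiset PiProc) :
    ((L.map (PiProc.rename f)).map cl).sum = (L.map cl).sum.ren f := by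
  induction L using Multiset.induction_on with
  | empty => simp
  | cons P L ih => simp only [Multiset.map_cons, Multiset.sum_cons, ih, PiCl.ren_add, cl_rename]

/-- Opening a restriction. -/
theorem rd_nu (k : ℕ) (P : PiProc) (L : Multiset PiProc) :
    rd (k + 1) (P ::ₘ L.map (PiProc.rename Nat.succ)) = rd k (nu P ::ₘ L) := by
  simp only [rd, Function.iterate_succ_apply, Multiset.map_cons, Multiset.sum_cons,
    sum_cl_rename, PiCl.nu_add', cl_nu]

theorem rd_congr {k : ℕ} {L L' : Multiset PiProc} (h : (L.map cl).sum = (L'.map cl).sum) :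
    rd k L = rd k L' := by rw [rd, rd, h]

/-- `Unfolds G k L`: by splitting parallel compositions, opening restrictions and unfolding
replications at the top level, the multiset `L` of processes below `k` restrictions can be
transformed such that `G` holds. -/
inductive Unfolds (G : ℕ → Multiset PiProc → Prop) : ℕ → Multiset PiProc → Prop
  | base {k L} : G k L → Unfolds G k L
  | par {k P Q L} : Unfolds G k (P ::ₘ Q ::ₘ L) → Unfolds G k (par P Q ::ₘ L)
  | nu {k P L} : Unfolds G (k + 1) (P ::ₘ L.map (PiProc.rename Nat.succ)) →
      Unfolds G k (nu P ::ₘ L)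
  | bang {k P L} : Unfolds G k (P ::ₘ bang P ::ₘ L) → Unfolds G k (bang P ::ₘ L)

/-- Two of the processes can interact, and the result belongs to the class `a`. -/
def ComGoal (a : PiCl) (k : ℕ) (L : Multiset PiProc) : Prop :=
  ∃ x z P Q L₀, L = inp x P ::ₘ out x z Q ::ₘ L₀ ∧
    a = rd k (P.rename (instName z) ::ₘ Q ::ₘ L₀)

/-- One of the processes is the success constant. -/
def StopGoal (_ : ℕ) (L : Multiset PiProc) : Prop := success ∈ L

/-- The class `a | L` below `k` restrictions. -/
def rdAdd (k : ℕ) (a : PiCl) (L : Multiset PiProc) : PiCl := PiCl.nu^[k] (a + (L.map cl).sum)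

theorem rdAdd_cons (k : ℕ) (a : PiCl) (P : PiProc) (L : Multiset PiProc) :
    rdAdd k a (P ::ₘ L) = rdAdd k (a + cl P) L := by
  simp only [rdAdd, Multiset.map_cons, Multiset.sum_cons, add_assoc]

theorem rdAdd_nu (k : ℕ) (a : PiCl) (L : Multiset PiProc) :
    rdAdd (k + 1) a (L.map (PiProc.rename Nat.succ)) = rdAdd k a.nu L := by
  simp only [rdAdd, Function.iterate_succ_apply, sum_cl_rename, PiCl.nu_add']

/-- If `P` can receive on `x`, then unfolding `P` next to a sender on `x` exposes the two
prefixes. -/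
theorem TIn.unfolds {P x F} (h : TIn P x F) : ∀ (k z : ℕ) (Q : PiProc) (L : Multiset PiProc),
    Unfolds (ComGoal (rdAdd k (cl (F.rename (instName z)) + cl Q) L)) k
      (P ::ₘ PiProc.out x z Q ::ₘ L) := by
  induction h with
  | inp x P =>
    intro k z Q L
    exact .base ⟨x, z, P, Q, L, rfl, by simp [rd, rdAdd, add_assoc]⟩
  | parL Q' _ ih =>
    intro k z Q L
    have := ih k z Q (Q' ::ₘ L)
    rw [rdAdd_cons] at this
    refine .par ?_
    rw [Multiset.cons_swap Q']
    simp only [PiProc.rename, rename_comp, instName_comp_succ, rename_id, cl_par]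
    rwa [add_right_comm]
  | parR P' _ ih =>
    intro k z Q L
    have := ih k z Q (P' ::ₘ L)
    rw [rdAdd_cons] at this
    refine .par ?_
    rw [Multiset.cons_swap P', Multiset.cons_swap P']
    simp only [PiProc.rename, rename_comp, instName_comp_succ, rename_id, cl_par]
    rwa [add_comm (cl P'), add_right_comm]
  | nu _ ih =>
    intro k z Q L
    have := ih (k + 1) (z + 1) (Q.rename Nat.succ) (L.map (PiProc.rename Nat.succ))
    rw [rdAdd_nu, cl_rename Nat.succ, PiCl.nu_add'] at this
    refine .nu ?_
    rw [Multiset.map_cons]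
    simpa only [PiProc.rename, rename_comp, upRen_instName_comp_swapName, cl_nu] using this
  | @bang P' _ _ _ ih =>
    intro k z Q L
    have := ih k z Q (PiProc.bang P' ::ₘ L)
    rw [rdAdd_cons] at this
    refine .bang ?_
    rw [Multiset.cons_swap (PiProc.bang P')]
    rw [PiProc.rename.eq_5, rename_comp, instName_comp_succ, rename_id, cl_par]
    rwa [add_right_comm]

/-- The same for a sender that is not yet unfolded. Its restrictions are opened around the
receiver, as `TOut` prescribes. -/
theorem TOut.unfolds {Q x K} (h : TOut Q x K) : ∀ {P F} (_ : TIn P x F) (k : ℕ)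
    (L : Multiset PiProc), Unfolds (ComGoal (rdAdd k (cl (K id F)) L)) k (P ::ₘ Q ::ₘ L) := by
  induction h with
  | out x z Q =>
    intro P F hF k L
    simpa [cl_par, rename_id] using hF.unfolds k z Q L
  | parL R _ ih =>
    intro P F hF k L
    have := ih hF k (R ::ₘ L)
    rw [rdAdd_cons] at this
    rw [Multiset.cons_swap]
    refine .par ?_
    rw [Multiset.cons_swap R, Multiset.cons_swap]
    rwa [cl_par, rename_id]
  | parR R _ ih =>
    intro P F hF k L
    have := ih hF k (R ::ₘ L)
    rw [rdAdd_cons] at this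
    rw [Multiset.cons_swap]
    refine .par ?_
    rw [Multiset.cons_swap R, Multiset.cons_swap R, Multiset.cons_swap]
    rwa [cl_par, rename_id, add_comm]
  | nu _ ih =>
    intro P F hF k L
    have := ih (hF.rename Nat.succ) (k + 1) (L.map (PiProc.rename Nat.succ))
    rw [rdAdd_nu] at this
    rw [Multiset.cons_swap]
    refine .nu ?_
    rw [Multiset.map_cons, Multiset.cons_swap]
    simpa only [upRen_id, cl_nu] using this
  | @bang R _ _ _ ih =>
    intro P F hF k L
    have := ih hF k (PiProc.bang R ::ₘ L)
    rw [rdAdd_cons] at this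
    rw [Multiset.cons_swap]
    refine .bang ?_
    rw [Multiset.cons_swap _ P, Multiset.cons_swap _ P]
    rwa [cl_par, rename_id]

/-- An internal transition of `P` arises from two prefixes that unfolding `P` exposes. -/
theorem TTau.unfolds {P P'} (h : TTau P P') : ∀ (k : ℕ) (L : Multiset PiProc),
    Unfolds (ComGoal (rdAdd k (cl P') L)) k (P ::ₘ L) := by
  induction h with
  | comL hF hK => intro k L; exact .par (hK.unfolds hF k L)
  | comR hK hF =>
    intro k L
    refine .par ?_
    rw [Multiset.cons_swap]
    exact hK.unfolds hF k L
  | parL Q _ ih =>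
    intro k L
    have := ih k (Q ::ₘ L)
    rw [rdAdd_cons] at this
    exact .par this
  | parR P _ ih =>
    intro k L
    have := ih k (P ::ₘ L)
    rw [rdAdd_cons, add_comm] at this
    refine .par ?_
    rwa [Multiset.cons_swap]
  | nu _ ih =>
    intro k L
    have := ih (k + 1) (L.map (PiProc.rename Nat.succ))
    rw [rdAdd_nu] at this
    exact .nu this
  | @bang P P' _ ih =>
    intro k L
    have := ih k (PiProc.bang P ::ₘ L)
    rw [rdAdd_cons] at this
    exact .bang this
  | @bangCom P x F K hF hK =>
    intro k L
    have := hK.unfolds hF k (PiProc.bang P ::ₘ L)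
    rw [rdAdd_cons] at this
    refine .bang ?_
    rw [Multiset.cons_swap]
    refine .bang ?_
    rwa [Multiset.cons_swap _ P, Multiset.cons_swap _ P]

/-- `P₁ | … | Pₙ`. -/
def parList : List PiProc → PiProc
  | [] => zero
  | P :: l => par P (parList l)

theorem cl_parList (l : List PiProc) : cl (parList l) = ((l : Multiset PiProc).map cl).sum := by
  induction l with
  | nil => rfl
  | cons P l ih => simp only [parList, cl_par, ih, ← Multiset.cons_coe, Multiset.map_cons,
      Multiset.sum_cons]

theorem TIn.unfolds_parList (l : List PiProc) : ∀ {x F Q K} (_ : TIn (parList l) x F)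
    (_ : TOut Q x K) (k : ℕ) (L : Multiset PiProc),
    Unfolds (ComGoal (rdAdd k (cl (K id F)) L)) k (Q ::ₘ ((l : Multiset PiProc) + L)) := by
  induction l with
  | nil => intro x F Q K hF; cases hF
  | cons A l ih =>
    intro x F Q K hF hK k L
    cases hF with
    | parL _ hF =>
      have := hK.unfolds hF k ((l : Multiset PiProc) + L)
      rw [Multiset.cons_swap] at this
      rw [← Multiset.cons_coe, Multiset.cons_add]
      rw [hK.par_result, cl_parList]
      simpa only [rdAdd, Multiset.map_add, Multiset.sum_add, add_assoc] using this
    | parR _ hF =>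
      have := ih hF hK k (A ::ₘ L)
      rw [hK.cong id (cl_eq.2 (.parComm _ _)), hK.par_result, ← rdAdd_cons]
      rwa [← Multiset.cons_coe, Multiset.cons_add, ← Multiset.add_cons]

theorem TOut.unfolds_parList (l : List PiProc) : ∀ {x F P K} (_ : TOut (parList l) x K)
    (_ : TIn P x F) (k : ℕ) (L : Multiset PiProc),
    Unfolds (ComGoal (rdAdd k (cl (K id F)) L)) k (P ::ₘ ((l : Multiset PiProc) + L)) := by
  induction l with
  | nil => intro x F Q K hF; cases hF
  | cons A l ih =>
    intro x F P K hK hF k L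
    cases hK with
    | parL _ hK =>
      have := hK.unfolds hF k ((l : Multiset PiProc) + L)
      rw [← Multiset.cons_coe, Multiset.cons_add]
      rw [cl_par, rename_id, cl_parList]
      simpa only [rdAdd, Multiset.map_add, Multiset.sum_add, add_assoc] using this
    | parR _ hK =>
      have := ih hK hF k (A ::ₘ L)
      rw [cl_par, rename_id, add_comm, ← rdAdd_cons]
      rwa [← Multiset.cons_coe, Multiset.cons_add, ← Multiset.add_cons]

theorem TTau.unfolds_parList (l : List PiProc) : ∀ {P'} (_ : TTau (parList l) P') (k : ℕ)
    (L : Multiset PiProc),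
    Unfolds (ComGoal (rdAdd k (cl P') L)) k ((l : Multiset PiProc) + L) := by
  induction l with
  | nil => intro P' h; cases h
  | cons A l ih =>
    intro P' h k L
    rw [← Multiset.cons_coe, Multiset.cons_add]
    cases h with
    | parL _ h =>
      have := h.unfolds k ((l : Multiset PiProc) + L)
      rw [cl_par, cl_parList]
      simpa only [rdAdd, Multiset.map_add, Multiset.sum_add, add_assoc] using this
    | parR _ h =>
      have := ih h k (A ::ₘ L)
      rw [cl_par, add_comm, ← rdAdd_cons]
      rwa [← Multiset.add_cons]
    | comL hF hK => exact hK.unfolds_parList l hF k L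
    | comR hK hF => exact hF.unfolds_parList l hK k L

/-- `νx₁…xₖ.P`. -/
def nus : ℕ → PiProc → PiProc
  | 0, P => P
  | k + 1, P => nus k (nu P)

theorem cl_nus (k : ℕ) : ∀ P, cl (nus k P) = PiCl.nu^[k] (cl P) := by
  induction k with
  | zero => intro P; rfl
  | succ k ih => intro P; rw [nus, ih]; rfl

theorem TTau.of_nus (k : ℕ) : ∀ {P Q}, TTau (nus k P) Q → ∃ P', Q = nus k P' ∧ TTau P P' := by
  induction k with
  | zero => intro P Q h; exact ⟨Q, rfl, h⟩
  | succ k ih =>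
    intro P Q h
    obtain ⟨R, rfl, h'⟩ := ih h
    cases h' with
    | nu h' => exact ⟨_, rfl, h'⟩

/-- Every reduction comes from an interaction of two prefixes, which are uncovered by unfolding. -/
theorem Step.unfolds {P P' : PiProc} (h : Step P P') {k : ℕ} {L : Multiset PiProc}
    (e : cl P = rd k L) : Unfolds (ComGoal (cl P')) k L := by
  obtain ⟨l, rfl⟩ := Quot.exists_rep L
  have e' : cl P = cl (nus k (parList l)) := by
    rw [e, cl_nus, cl_parList]
    rfl
  obtain ⟨Q, hQ, eQ⟩ := h.exists_ttau e'
  obtain ⟨Q, rfl, hQ'⟩ := hQ.of_nus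
  have := hQ'.unfolds_parList l k 0
  rw [eQ, cl_nus]
  simpa [rdAdd] using this

theorem HasStop.unfolds {P : PiProc} (h : HasStop P) : ∀ (k : ℕ) (L : Multiset PiProc),
    Unfolds StopGoal k (P ::ₘ L) := by
  induction P with
  | nu P ih => intro k L; exact .nu (ih h _ _)
  | bang P ih => intro k L; exact .bang (ih h _ _)
  | par P Q ihP ihQ =>
    intro k L
    refine .par ?_
    rcases h with h | h
    · exact ihP h _ _
    · rw [Multiset.cons_swap]
      exact ihQ h _ _
  | success => intro k L; exact .base (Multiset.mem_cons_self _ _)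
  | _ => exact h.elim

theorem hasStop_nus (k : ℕ) : ∀ P, HasStop (nus k P) ↔ HasStop P := by
  induction k with
  | zero => intro P; rfl
  | succ k ih => intro P; exact ih _

theorem hasStop_parList (l : List PiProc) : HasStop (parList l) ↔ ∃ P ∈ l, HasStop P := by
  induction l with
  | nil => simp [parList, HasStop]
  | cons P l ih => simp [parList, HasStop, ih]

/-- Success of a process can be read off from any of its decompositions, as it is invariant under
structural congruence. -/
theorem hasStop_rd {P : PiProc} {k : ℕ} {L : Multiset PiProc} (e : cl P = rd k L) :
    HasStop P ↔ ∃ Q ∈ L, HasStop Q := by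
  obtain ⟨l, rfl⟩ := Quot.exists_rep L
  have e' : cl P = cl (nus k (parList l)) := by
    rw [e, cl_nus, cl_parList]
    rfl
  rw [(cl_eq.1 e').hasStop, hasStop_nus, hasStop_parList]
  rfl

theorem HasStop.unfolds_rd {P : PiProc} (h : HasStop P) {k : ℕ} {L : Multiset PiProc}
    (e : PiProc.cl P = rd k L) : Unfolds StopGoal k L := by
  obtain ⟨Q, hQ, h⟩ := (hasStop_rd e).1 h
  obtain ⟨L, rfl⟩ := Multiset.exists_cons_of_mem hQ
  exact h.unfolds k L

/-- Interaction inside a multiset of processes. -/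
theorem step_rd {P P' : PiProc} {k x z : ℕ} {A B : PiProc} {L : Multiset PiProc}
    (e : cl P = rd k (inp x A ::ₘ out x z B ::ₘ L))
    (e' : cl P' = rd k (A.rename (instName z) ::ₘ B ::ₘ L)) : Step P P' := by
  obtain ⟨l, rfl⟩ := Quot.exists_rep L
  have h₀ : Step (par (par (inp x A) (out x z B)) (parList l))
      (par (par (A.rename (instName z)) B) (parList l)) :=
    Step.parL ⟨.hole, _, _, .refl _, .ia x z A B, .refl _⟩ _
  have h₁ : ∀ (k : ℕ) {R S : PiProc}, Step R S → Step (nus k R) (nus k S) := by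
    intro k
    induction k with
    | zero => intro R S h; exact h
    | succ k ih => intro R S h; exact ih h.nu
  refine ((h₁ k h₀).cl_left ?_).cl_right ?_
  · rw [e, cl_nus]
    simp only [cl_par, cl_parList, rd, Multiset.map_cons, Multiset.sum_cons, add_assoc]
    rfl
  · rw [e', cl_nus]
    simp only [cl_par, cl_parList, rd, Multiset.map_cons, Multiset.sum_cons, add_assoc]
    rfl

theorem exists_rd (k : ℕ) (L : Multiset PiProc) : ∃ P, cl P = rd k L := by
  obtain ⟨P, h⟩ := Quotient.exists_rep (rd k L)
  exact ⟨P, h⟩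

end PiProc

namespace CH

/-! ### Renaming and substitution of expressions -/

namespace Expr

variable {S : DataSig}

theorem rename_comp (e : Expr S) : ∀ f g : ℕ → ℕ, (e.rename f).rename g = e.rename (g ∘ f) := by
  induction e <;> intro f g <;> simp [rename, upRen_comp, *]

theorem rename_id (e : Expr S) : e.rename id = e := by
  induction e <;> simp [rename, *]

theorem rename_eq_subst (e : Expr S) : ∀ f : ℕ → ℕ, e.rename f = e.subst (fun y => var (f y)) := by
  have key : ∀ (n : ℕ) (f : ℕ → ℕ),
      upSubst (S := S) n (fun y => var (f y)) = fun y => var (upRen n f y) := by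
    intro n f
    funext y
    by_cases h : y < n <;> simp [upSubst, upRen, h, rename]
  induction e <;> intro f <;> simp [rename, subst, *]

theorem subst_rename (e : Expr S) : ∀ (f : ℕ → ℕ) (s : ℕ → Expr S),
    (e.rename f).subst s = e.subst (s ∘ f) := by
  have key : ∀ (n : ℕ) (f : ℕ → ℕ) (s : ℕ → Expr S),
      upSubst n s ∘ upRen n f = upSubst n (s ∘ f) := by
    intro n f s
    funext y
    by_cases h : y < n <;> simp [upSubst, upRen, h]
  induction e <;> intro f s <;> simp [rename, subst, *]

theorem rename_subst (e : Expr S) : ∀ (s : ℕ → Expr S) (f : ℕ → ℕ),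
    (e.subst s).rename f = e.subst (fun y => (s y).rename f) := by
  have key : ∀ (n : ℕ) (s : ℕ → Expr S) (f : ℕ → ℕ),
      upSubst n (fun y => (s y).rename f) = fun y => (upSubst n s y).rename (upRen n f) := by
    intro n s f
    funext y
    by_cases h : y < n
    · simp [upSubst, upRen, h, rename]
    · simp only [upSubst, h, if_false, rename_comp]
      congr 1
      funext z
      simp [upRen]
  induction e <;> intro s f <;> simp [rename, subst, *]

theorem subst_var (e : Expr S) : e.subst var = e := by
  have := rename_eq_subst e id
  rw [rename_id] at this
  exact this.symm

theorem rename_inst {n : ℕ} (es : Fin n → Expr S) (e : Expr S) (f : ℕ → ℕ) :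
    (e.inst es).rename f = (e.rename (upRen n f)).inst (fun i => (es i).rename f) := by
  rw [inst, inst, rename_subst, subst_rename]
  congr 1
  funext y
  by_cases h : y < n <;> simp [upRen, h, rename]

@[simp] theorem rename_unit (f : ℕ → ℕ) : (unit : Expr S).rename f = unit := by
  simp only [unit, rename]
  congr 1
  funext i
  exact i.elim0

@[simp] theorem rename_pair (f : ℕ → ℕ) (a b : Expr S) :
    (pair a b).rename f = pair (a.rename f) (b.rename f) := by
  simp only [pair, rename]
  congr 1
  funext i
  match i with
  | 0 => rfl
  | 1 => rfl

@[simp] theorem rename_chan (f : ℕ → ℕ) (a : Expr S) : (chan a).rename f = chan (a.rename f) := by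
  simp only [chan, rename]
  congr 1
  funext i
  match i with
  | 0 => rfl

@[simp] theorem rename_unchan (f : ℕ → ℕ) (a : Expr S) :
    (unchan a).rename f = unchan (a.rename f) := by
  simp only [unchan, rename]
  congr 1
  funext c
  cases c
  rfl

@[simp] theorem rename_bot (f : ℕ → ℕ) : (bot : Expr S).rename f = bot := rfl

@[simp] theorem subst_unit (s : ℕ → Expr S) : (unit : Expr S).subst s = unit := by
  simp only [unit, subst]
  congr 1
  funext i
  exact i.elim0

@[simp] theorem subst_pair (s : ℕ → Expr S) (a b : Expr S) :
    (pair a b).subst s = pair (a.subst s) (b.subst s) := by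
  simp only [pair, subst]
  congr 1
  funext i
  match i with
  | 0 => rfl
  | 1 => rfl

@[simp] theorem subst_chan (s : ℕ → Expr S) (a : Expr S) :
    (chan a).subst s = chan (a.subst s) := by
  simp only [chan, subst]
  congr 1
  funext i
  match i with
  | 0 => rfl

@[simp] theorem subst_unchan (s : ℕ → Expr S) (a : Expr S) :
    (unchan a).subst s = unchan (a.subst s) := by
  simp only [unchan, subst]
  congr 1
  funext c
  cases c
  rfl

@[simp] theorem subst_bot (s : ℕ → Expr S) : (bot : Expr S).subst s = bot := rfl

end Expr

/-! ### Structural lemmas on contexts -/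

section EvalContexts

variable {S : DataSig}

theorem ECtx.rename_plug (E : ECtx S) (e : Expr S) (f : ℕ → ℕ) :
    (E.plug e).rename f = (E.rename f).plug (e.rename f) := by
  induction E <;> simp [ECtx.plug, ECtx.rename, Expr.rename, *]

theorem FCtx.rename_plug (F : FCtx S) (e : Expr S) (f : ℕ → ℕ) :
    (F.plug e).rename f = (F.rename f).plug (e.rename f) := by
  cases F <;> simp [FCtx.plug, FCtx.rename, Expr.rename, ECtx.rename_plug]

theorem MCtx.rename_plug (M : MCtx S) (e : Expr S) (f : ℕ → ℕ) :
    (M.plug e).rename f = (M.rename f).plug (e.rename f) := by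
  induction M <;> simp [MCtx.plug, MCtx.rename, Expr.rename, *]

theorem ECtx.rename_rename (E : ECtx S) (f g : ℕ → ℕ) :
    (E.rename f).rename g = E.rename (g ∘ f) := by
  induction E <;> simp [ECtx.rename, Expr.rename_comp, upRen_comp, *]

theorem FCtx.rename_rename (F : FCtx S) (f g : ℕ → ℕ) :
    (F.rename f).rename g = F.rename (g ∘ f) := by
  cases F <;> simp [FCtx.rename, Expr.rename_comp, ECtx.rename_rename]

theorem MCtx.rename_rename (M : MCtx S) (f g : ℕ → ℕ) :
    (M.rename f).rename g = M.rename (g ∘ f) := by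
  induction M <;> simp [MCtx.rename, Expr.rename_comp, *]

end EvalContexts

/-! ### Actions of a thread -/

/-- What a thread does next: a local step, the allocation of letrec-bindings, the lookup of a
variable, or a monadic operation. A function describes the thread that results from a value which
is found in the heap. -/
inductive Act (S : DataSig) : Type
  | loc (e : Expr S)
  | binds (n : ℕ) (es : Fin n → Expr S) (e : Expr S)
  | look (x : ℕ) (K : Expr S → Expr S)
  | new (v e : Expr S)
  | fork (e' e : Expr S)
  | take (x : ℕ) (K : Expr S → Expr S)
  | put (x : ℕ) (v e : Expr S)

section Red

variable {S : DataSig}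

/-- The action of a thread inside a context: `C` fills the context, and `C' n` fills the context
transported below `n` binders. -/
def Act.wrap (C : Expr S → Expr S) (C' : ℕ → Expr S → Expr S) : Act S → Act S
  | loc e => loc (C e)
  | binds n es e => binds n es (C' n e)
  | look x K => look x (fun v => C (K v))
  | new v e => new v (C' 1 e)
  | fork e' e => fork e' (C e)
  | take x K => take x (fun v => C (K v))
  | put x v e => put x v (C e)

/-- Functional redexes. -/
inductive EBase : Expr S → Act S → Prop
  | var (x) : EBase (.var x) (.look x id)
  | letrec (n es e) : EBase (.letrec n es e) (.binds n es e)
  | beta (e₁ e₂) : EBase (.app (.lam e₁) e₂) (.loc (e₁.inst ![e₂]))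
  | case {T : TCon S.toTySig} (c : Con S T) (es alts) :
      EBase (.case T (.con c es) alts) (.loc ((alts c).inst es))
  | seq {v} (e) : Expr.FunValue v → EBase (.seq v e) (.loc e)

/-- Monadic redexes. -/
inductive MBase : Expr S → Act S → Prop
  | lunit (e₁ e₂) : MBase (.bind (.ret e₁) e₂) (.loc (.app e₂ e₁))
  | take (x) : MBase (.take (.var x)) (.take x .ret)
  | put (x e) : MBase (.put (.var x) e) (.put x e (.ret .unit))
  | new (e) : MBase (.new e) (.new e (.ret (.var 0)))
  | fork (e) : MBase (.fork e) (.fork e (.ret .unit))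

/-- A functional redex inside an expression evaluation context. -/
inductive ERed : Expr S → Act S → Prop
  | base {e a} : EBase e a → ERed e a
  | app {e a} (e') : ERed e a →
      ERed (.app e e') (a.wrap (fun x => .app x e') (fun n x => .app x (e'.rename (· + n))))
  | seq {e a} (e') : ERed e a →
      ERed (.seq e e') (a.wrap (fun x => .seq x e') (fun n x => .seq x (e'.rename (· + n))))
  | case {e a} (T : TCon S.toTySig) (alts) : ERed e a →
      ERed (.case T e alts) (a.wrap (fun x => .case T x alts)
        (fun n x => .case T x (fun c => (alts c).rename (upRen c.arity (· + n)))))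

/-- A functional redex inside a forcing context. -/
inductive FRed : Expr S → Act S → Prop
  | eval {e a} : ERed e a → FRed e a
  | take {e a} : ERed e a → FRed (.take e) (a.wrap .take (fun _ => .take))
  | put {e a} (e') : ERed e a →
      FRed (.put e e') (a.wrap (fun x => .put x e') (fun n x => .put x (e'.rename (· + n))))

/-- `MRed e a`: a thread with the expression `e` can perform the action `a`. -/
inductive MRed : Expr S → Act S → Prop
  | force {e a} : FRed e a → MRed e a
  | base {e a} : MBase e a → MRed e a
  | bind {e a} (e') : MRed e a →
      MRed (.bind e e') (a.wrap (fun x => .bind x e') (fun n x => .bind x (e'.rename (· + n))))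

theorem Act.wrap_wrap (a : Act S) (C D : Expr S → Expr S) (C' D' : ℕ → Expr S → Expr S) :
    (a.wrap C C').wrap D D' = a.wrap (fun e => D (C e)) (fun n e => D' n (C' n e)) := by
  cases a <;> rfl

theorem Act.wrap_id (a : Act S) : a.wrap (fun e => e) (fun _ e => e) = a := by
  cases a <;> rfl

theorem ERed.plug {e : Expr S} {a} (h : ERed e a) (E : ECtx S) :
    ERed (E.plug e) (a.wrap E.plug (fun n => (E.rename (· + n)).plug)) := by
  induction E with
  | hole => simpa [ECtx.plug, ECtx.rename, Act.wrap_id] using h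
  | app E e' ih =>
    have := ih.app e'
    rw [Act.wrap_wrap] at this
    exact this
  | seq E e' ih =>
    have := ih.seq e'
    rw [Act.wrap_wrap] at this
    exact this
  | case T E alts ih =>
    have := ih.case T alts
    rw [Act.wrap_wrap] at this
    exact this

theorem EBase.plugF {e : Expr S} {a} (h : EBase e a) (F : FCtx S) :
    FRed (F.plug e) (a.wrap F.plug (fun n => (F.rename (· + n)).plug)) := by
  cases F with
  | eval E => exact .eval (ERed.plug (.base h) E)
  | take E =>
    have := FRed.take (ERed.plug (.base h) E)
    rw [Act.wrap_wrap] at this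
    exact this
  | put E e' =>
    have := FRed.put e' (ERed.plug (.base h) E)
    rw [Act.wrap_wrap] at this
    exact this

theorem MRed.plug {e : Expr S} {a} (h : MRed e a) (M : MCtx S) :
    MRed (M.plug e) (a.wrap M.plug (fun n => (M.rename (· + n)).plug)) := by
  induction M with
  | hole => simpa [MCtx.plug, MCtx.rename, Act.wrap_id] using h
  | bind M e' ih =>
    have := ih.bind e'
    rw [Act.wrap_wrap] at this
    exact this

theorem EBase.plugMF {e : Expr S} {a} (h : EBase e a) (M : MCtx S) (F : FCtx S) :
    MRed (M.plug (F.plug e)) (a.wrap (fun e => M.plug (F.plug e))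
      (fun n e => (M.rename (· + n)).plug ((F.rename (· + n)).plug e))) := by
  simpa only [Act.wrap_wrap] using (MRed.force (h.plugF F)).plug M

theorem ERed.exists_ctx {e : Expr S} {a} (h : ERed e a) :
    ∃ (E : ECtx S) (r : Expr S) (a₀ : Act S), EBase r a₀ ∧ e = E.plug r ∧
      a = a₀.wrap E.plug (fun n => (E.rename (· + n)).plug) := by
  induction h with
  | base h => exact ⟨.hole, _, _, h, rfl, (Act.wrap_id _).symm⟩
  | app e' _ ih =>
    obtain ⟨E, r, a₀, h, rfl, rfl⟩ := ih
    exact ⟨.app E e', r, a₀, h, rfl, Act.wrap_wrap _ _ _ _ _⟩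
  | seq e' _ ih =>
    obtain ⟨E, r, a₀, h, rfl, rfl⟩ := ih
    exact ⟨.seq E e', r, a₀, h, rfl, Act.wrap_wrap _ _ _ _ _⟩
  | case T alts _ ih =>
    obtain ⟨E, r, a₀, h, rfl, rfl⟩ := ih
    exact ⟨.case T E alts, r, a₀, h, rfl, Act.wrap_wrap _ _ _ _ _⟩

theorem FRed.exists_ctx {e : Expr S} {a} (h : FRed e a) :
    ∃ (F : FCtx S) (r : Expr S) (a₀ : Act S), EBase r a₀ ∧ e = F.plug r ∧
      a = a₀.wrap F.plug (fun n => (F.rename (· + n)).plug) := by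
  cases h with
  | eval h =>
    obtain ⟨E, r, a₀, h', rfl, rfl⟩ := h.exists_ctx
    exact ⟨.eval E, r, a₀, h', rfl, rfl⟩
  | take h =>
    obtain ⟨E, r, a₀, h', rfl, rfl⟩ := h.exists_ctx
    exact ⟨.take E, r, a₀, h', rfl, Act.wrap_wrap _ _ _ _ _⟩
  | put e' h =>
    obtain ⟨E, r, a₀, h', rfl, rfl⟩ := h.exists_ctx
    exact ⟨.put E e', r, a₀, h', rfl, Act.wrap_wrap _ _ _ _ _⟩

/-- A reducible thread is a redex in an evaluation context: the recursive description of the redex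
by `MRed` agrees with the one by contexts. -/
theorem MRed.exists_ctx {e : Expr S} {a} (h : MRed e a) :
    (∃ (M : MCtx S) (F : FCtx S) (r : Expr S) (a₀ : Act S), EBase r a₀ ∧
      e = M.plug (F.plug r) ∧ a = a₀.wrap (fun e => M.plug (F.plug e))
        (fun n e => (M.rename (· + n)).plug ((F.rename (· + n)).plug e))) ∨
    (∃ (M : MCtx S) (r : Expr S) (a₀ : Act S), MBase r a₀ ∧ e = M.plug r ∧
      a = a₀.wrap M.plug (fun n => (M.rename (· + n)).plug)) := by
  induction h with
  | force h =>
    obtain ⟨F, r, a₀, h', rfl, rfl⟩ := h.exists_ctx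
    exact .inl ⟨.hole, F, r, a₀, h', rfl, rfl⟩
  | base h => exact .inr ⟨.hole, _, _, h, rfl, (Act.wrap_id _).symm⟩
  | bind e' _ ih =>
    rcases ih with ⟨M, F, r, a₀, h', rfl, rfl⟩ | ⟨M, r, a₀, h', rfl, rfl⟩
    · exact .inl ⟨.bind M e', F, r, a₀, h', rfl, Act.wrap_wrap _ _ _ _ _⟩
    · exact .inr ⟨.bind M e', r, a₀, h', rfl, Act.wrap_wrap _ _ _ _ _⟩

end Red

/-! ### Processes as multisets of components -/

/-- The components of a process: threads, MVars and bindings. -/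
inductive Comp (S : DataSig) : Type
  | thread (main : Bool) (e : Expr S)
  | mvar (x : ℕ) (e : Expr S)
  | empty (x : ℕ)
  | share (x : ℕ) (e : Expr S)

variable {S : DataSig}

namespace Comp

/-- Renaming of the free variables, among them the variable that the component introduces. -/
def rename (f : ℕ → ℕ) : Comp S → Comp S
  | thread b e => thread b (e.rename f)
  | mvar x e => mvar (f x) (e.rename f)
  | empty x => empty (f x)
  | share x e => share (f x) (e.rename f)

/-- A component as a process. -/
def toProc : Comp S → Proc S
  | thread b e => .thread b e
  | mvar x e => .mvar x e
  | empty x => .emptyMVar x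
  | share x e => .share x e

/-- The variable that is introduced by the component. -/
def intro? : Comp S → Option ℕ
  | thread _ _ => none
  | mvar x _ => some x
  | empty x => some x
  | share x _ => some x

/-- Is the component a main thread? -/
def isMain : Comp S → Bool
  | thread b _ => b
  | _ => false

theorem rename_comp (c : Comp S) (f g : ℕ → ℕ) : (c.rename f).rename g = c.rename (g ∘ f) := by
  cases c <;> simp [rename, Expr.rename_comp]

@[simp] theorem rename_id (c : Comp S) : c.rename id = c := by
  cases c <;> simp [rename, Expr.rename_id]

@[simp] theorem intro?_rename (c : Comp S) (f : ℕ → ℕ) : (c.rename f).intro? = c.intro?.map f := by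
  cases c <;> rfl

@[simp] theorem isMain_rename (c : Comp S) (f : ℕ → ℕ) : (c.rename f).isMain = c.isMain := by
  cases c <;> rfl

end Comp

/-- Renaming of a multiset of components. -/
def ren (f : ℕ → ℕ) (m : Multiset (Comp S)) : Multiset (Comp S) := m.map (Comp.rename f)

@[simp] theorem ren_add (f : ℕ → ℕ) (m m' : Multiset (Comp S)) :
    ren f (m + m') = ren f m + ren f m' := Multiset.map_add _ _ _

@[simp] theorem ren_cons (f : ℕ → ℕ) (c : Comp S) (m : Multiset (Comp S)) :
    ren f (c ::ₘ m) = c.rename f ::ₘ ren f m := Multiset.map_cons _ _ _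

@[simp] theorem ren_singleton (f : ℕ → ℕ) (c : Comp S) : ren f {c} = {c.rename f} := rfl

@[simp] theorem ren_zero (f : ℕ → ℕ) : ren f (0 : Multiset (Comp S)) = 0 := rfl

theorem ren_ren (f g : ℕ → ℕ) (m : Multiset (Comp S)) : ren g (ren f m) = ren (g ∘ f) m := by
  simp [ren, Multiset.map_map, Function.comp_def, Comp.rename_comp]

@[simp] theorem ren_id (m : Multiset (Comp S)) : ren id m = m := by
  simp [ren]

/-- The bindings `xᵢ = esᵢ` for the `n` innermost bound variables. -/
def shares {n : ℕ} (es : Fin n → Expr S) : Multiset (Comp S) :=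
  (List.ofFn fun i : Fin n => Comp.share (i : ℕ) (es i) : Multiset (Comp S))

/-- The effect of an action of a thread, which is a main thread if `b = true`, on the remaining
components. Allocation shifts the variables, as the new ones get the indices `0, …, n-1`. -/
inductive AStep (b : Bool) : Act S → Multiset (Comp S) → Multiset (Comp S) → Prop
  | loc (e m) : AStep b (.loc e) m (.thread b e ::ₘ m)
  | binds (n es e m) : AStep b (.binds n es e) m (.thread b e ::ₘ (shares es + ren (· + n) m))
  | look (x K v m) : AStep b (.look x K) (.share x v ::ₘ m) (.thread b (K v) ::ₘ .share x v ::ₘ m)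
  | new (v e m) : AStep b (.new v e) m
      (.thread b e ::ₘ .mvar 0 (v.rename Nat.succ) ::ₘ ren Nat.succ m)
  | fork (e' e m) : AStep b (.fork e' e) m (.thread b e ::ₘ .thread false e' ::ₘ m)
  | take (x K v m) : AStep b (.take x K) (.mvar x v ::ₘ m) (.thread b (K v) ::ₘ .empty x ::ₘ m)
  | put (x v e m) : AStep b (.put x v e) (.empty x ::ₘ m) (.thread b e ::ₘ .mvar x v ::ₘ m)

/-- Reduction of multisets of components. -/
def DStep (m m' : Multiset (Comp S)) : Prop :=
  ∃ b e m₀ a, m = Comp.thread b e ::ₘ m₀ ∧ MRed e a ∧ AStep b a m₀ m'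

/-! ### Flattening of processes -/

/-- The number of restrictions of a process and its components, below all restrictions. -/
def flat : Proc S → ℕ × Multiset (Comp S)
  | .par P Q => ((flat P).1 + (flat Q).1,
      ren (upRen (flat P).1 (· + (flat Q).1)) (flat P).2 + ren (· + (flat P).1) (flat Q).2)
  | .nu P => ((flat P).1 + 1, (flat P).2)
  | .thread b e => (0, {.thread b e})
  | .mvar x e => (0, {.mvar x e})
  | .emptyMVar x => (0, {.empty x})
  | .share x e => (0, {.share x e})

theorem upRen_of_lt {n y : ℕ} (f : ℕ → ℕ) (h : y < n) : upRen n f y = y := if_pos h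

theorem upRen_add (n z : ℕ) (f : ℕ → ℕ) : upRen n f (n + z) = f z + n := by
  simp [upRen]

theorem upRen_zero (f : ℕ → ℕ) : upRen 0 f = f := by
  funext y
  simp [upRen]

theorem upRen_upRen (n k : ℕ) (f : ℕ → ℕ) : upRen n (upRen k f) = upRen (n + k) f := by
  funext y
  rcases Nat.lt_or_ge y n with h | h
  · rw [upRen_of_lt _ h, upRen_of_lt _ (by omega)]
  · obtain ⟨z, rfl⟩ := Nat.exists_eq_add_of_le h
    rw [upRen_add]
    rcases Nat.lt_or_ge z k with h' | h'
    · rw [upRen_of_lt _ h', upRen_of_lt _ (by omega), add_comm]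
    · obtain ⟨w, rfl⟩ := Nat.exists_eq_add_of_le h'
      rw [upRen_add, ← Nat.add_assoc, upRen_add]
      omega

/-- Renaming a process renames the variables above the block of the restricted ones. -/
theorem flat_rename (P : Proc S) : ∀ f : ℕ → ℕ,
    flat (P.rename f) = ((flat P).1, ren (upRen (flat P).1 f) (flat P).2) := by
  induction P with
  | par P Q ihP ihQ =>
    intro f
    simp only [Proc.rename, flat, ihP, ihQ, ren_add, ren_ren, Prod.mk.injEq, true_and]
    congr 2
    · funext y
      simp only [Function.comp]
      rcases Nat.lt_or_ge y (flat P).1 with h | h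
      · simp only [upRen_of_lt _ h]
        exact (upRen_of_lt _ (by omega)).symm
      · obtain ⟨z, rfl⟩ := Nat.exists_eq_add_of_le h
        rw [upRen_add, upRen_add, Nat.add_comm (f z), upRen_add,
          show z + (flat Q).1 + (flat P).1 = (flat P).1 + (flat Q).1 + z by omega, upRen_add]
        omega
    · funext y
      simp only [Function.comp]
      rcases Nat.lt_or_ge y (flat Q).1 with h | h
      · rw [upRen_of_lt _ h, upRen_of_lt _ (by omega)]
      · obtain ⟨z, rfl⟩ := Nat.exists_eq_add_of_le h
        rw [upRen_add,
          show (flat Q).1 + z + (flat P).1 = (flat P).1 + (flat Q).1 + z by omega, upRen_add]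
        omega
  | nu P ih => intro f; simp only [Proc.rename, flat, ih, upRen_upRen]
  | _ => intro f; simp [Proc.rename, flat, upRen_zero, Comp.rename]

/-- A permutation, transported below `n` binders. -/
def upPerm (n : ℕ) (π : Equiv.Perm ℕ) : Equiv.Perm ℕ where
  toFun := upRen n π
  invFun := upRen n π.symm
  left_inv y := by
    by_cases h : y < n <;> simp [upRen, h]
    omega
  right_inv y := by
    by_cases h : y < n <;> simp [upRen, h]
    omega

/-- Exchange of two neighbouring blocks of binders, of `a` and `b` variables. -/
def blockFun (a b : ℕ) : ℕ → ℕ :=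
  fun y => if y < a then y + b else if y < a + b then y - a else y

/-- The permutation that exchanges the blocks `0, …, a-1` and `a, …, a+b-1` of variables. -/
def blockSwap (a b : ℕ) : Equiv.Perm ℕ where
  toFun := blockFun a b
  invFun := blockFun b a
  left_inv y := by
    simp only [blockFun]
    split_ifs <;> omega
  right_inv y := by
    simp only [blockFun]
    split_ifs <;> omega

/-- The exchange of the two innermost variables as a permutation. -/
def swapPerm : Equiv.Perm ℕ where
  toFun := swapName
  invFun := swapName
  left_inv y := congrFun swapName_comp_self y
  right_inv y := congrFun swapName_comp_self y

/-- The flattened processes are equal up to a permutation of the restricted variables. -/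
def FlatEq (P Q : Proc S) : Prop :=
  (flat Q).1 = (flat P).1 ∧ ∃ π : Equiv.Perm ℕ, (∀ y, (flat P).1 ≤ y → π y = y) ∧
    (flat Q).2 = ren π (flat P).2

theorem perm_lt {π : Equiv.Perm ℕ} {n : ℕ} (h : ∀ y, n ≤ y → π y = y) {y : ℕ} (hy : y < n) :
    π y < n := by
  by_contra hlt
  have h' := h (π y) (by omega)
  have := π.injective h'
  omega

theorem FlatEq.symm {P Q : Proc S} (h : FlatEq P Q) : FlatEq Q P := by
  obtain ⟨h₁, π, h₂, h₃⟩ := h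
  refine ⟨h₁.symm, π.symm, fun y hy => ?_, ?_⟩
  · rw [Equiv.symm_apply_eq]
    exact (h₂ y (h₁ ▸ hy)).symm
  · rw [h₃, ren_ren, Equiv.symm_comp_self, ren_id]

theorem FlatEq.trans {P Q R : Proc S} (h : FlatEq P Q) (h' : FlatEq Q R) : FlatEq P R := by
  obtain ⟨h₁, π, h₂, h₃⟩ := h
  obtain ⟨h₁', π', h₂', h₃'⟩ := h'
  refine ⟨h₁'.trans h₁, π.trans π', fun y hy => ?_, ?_⟩
  · simp [h₂ y hy, h₂' y (h₁ ▸ hy)]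
  · rw [h₃', h₃, ren_ren]
    rfl

theorem FlatEq.par {P P' Q Q' : Proc S} (h : FlatEq P P') (h' : FlatEq Q Q') :
    FlatEq (.par P Q) (.par P' Q') := by
  obtain ⟨h₁, π, h₂, h₃⟩ := h
  obtain ⟨h₁', π', h₂', h₃'⟩ := h'
  refine ⟨by simp only [flat, h₁, h₁'], (upPerm (flat P).1 π').trans π, fun y hy => ?_, ?_⟩
  · simp only [flat] at hy
    have : upPerm (flat P).1 π' y = y := by
      simp only [upPerm, upRen, Equiv.coe_fn_mk]
      rw [if_neg (by omega), h₂' _ (by omega)]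
      omega
    rw [Equiv.trans_apply, this, h₂ _ (by omega)]
  · simp only [flat, h₁, h₁', h₃, h₃', ren_add, ren_ren]
    congr 2
    · funext y
      simp only [Function.comp, Equiv.coe_trans, upPerm, Equiv.coe_fn_mk]
      by_cases hy : y < (flat P).1
      · simp [upRen, hy, perm_lt h₂ hy]
      · simp only [upRen, h₂ y (by omega), hy, if_false]
        rw [if_neg (by omega), h₂' _ (by omega), h₂ _ (by omega)]
        omega
    · funext y
      simp only [Function.comp, Equiv.coe_trans, upPerm, Equiv.coe_fn_mk, upRen]
      rw [if_neg (by omega), Nat.add_sub_cancel, h₂ _ (by omega)]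

/-- Structural congruence does nothing but permute components and restricted variables. -/
theorem FlatEq.of_cong {P Q : Proc S} (h : Proc.Cong P Q) : FlatEq P Q := by
  induction h with
  | refl P => exact ⟨rfl, Equiv.refl _, fun _ _ => rfl, (ren_id _).symm⟩
  | symm _ ih => exact ih.symm
  | trans _ _ ih₁ ih₂ => exact ih₁.trans ih₂
  | congrPar _ _ ih₁ ih₂ => exact ih₁.par ih₂
  | congrNu _ ih =>
    obtain ⟨h₁, π, h₂, h₃⟩ := ih
    refine ⟨by simp only [flat, h₁], π, fun y hy => h₂ y ?_, h₃⟩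
    simp only [flat] at hy
    omega
  | parComm P Q =>
    refine ⟨by simp only [flat, add_comm], blockSwap (flat P).1 (flat Q).1, fun y hy => ?_, ?_⟩
    · simp only [flat] at hy
      simp only [blockSwap, blockFun, Equiv.coe_fn_mk]
      split_ifs <;> omega
    · simp only [flat, ren_add, ren_ren]
      rw [add_comm]
      congr 2 <;>
      · funext y
        simp only [blockSwap, blockFun, Equiv.coe_fn_mk, Function.comp, upRen]
        split_ifs <;> omega
  | parAssoc P Q R =>
    refine ⟨by simp only [flat, add_assoc], Equiv.refl _, fun _ _ => rfl, ?_⟩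
    simp only [flat, ren_add, ren_ren, Equiv.coe_refl, add_assoc]
    refine congr_arg₂ _ (congr_arg (ren · _) ?_)
      (congr_arg₂ _ (congr_arg (ren · _) ?_) (congr_arg (ren · _) ?_)) <;>
    · funext y
      simp only [Function.comp, upRen, id]
      (try split_ifs) <;> omega
  | nuSwap P =>
    refine ⟨by simp only [flat, flat_rename], upPerm (flat P).1 swapPerm, fun y hy => ?_, ?_⟩
    · simp only [flat] at hy
      simp only [upPerm, swapPerm, upRen, Equiv.coe_fn_mk]
      rw [if_neg (by omega)]
      obtain ⟨z, rfl⟩ := Nat.exists_eq_add_of_le hy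
      rw [show (flat P).1 + 1 + 1 + z - (flat P).1 = z + 2 by omega]
      simp only [swapName]
      omega
    · simp only [flat, flat_rename]
      rfl
  | nuPar P Q =>
    refine ⟨by simp only [flat, flat_rename]; omega,
      upPerm (flat P).1 (blockSwap 1 (flat Q).1), fun y hy => ?_, ?_⟩
    · simp only [flat] at hy
      simp only [upPerm, blockSwap, blockFun, upRen, Equiv.coe_fn_mk]
      split_ifs <;> omega
    · simp only [flat, flat_rename, ren_add, ren_ren]
      congr 2 <;>
      · funext y
        simp only [upPerm, blockSwap, blockFun, upRen, Equiv.coe_fn_mk, Function.comp,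
          Nat.succ_eq_add_one]
        split_ifs <;> omega

/-! ### Rebuilding a process from its components -/

/-- Structural congruence as a setoid. -/
instance procSetoid : Setoid (Proc S) := ⟨Proc.Cong, .refl, .symm, .trans⟩

/-- Processes modulo structural congruence. They are a commutative semigroup under parallel
composition; a zero is adjoined in order to have the sum of a multiset. -/
def ProcCl (S : DataSig) : Type := Quotient (procSetoid (S := S))

instance : Add (ProcCl S) :=
  ⟨Quotient.map₂ .par fun _ _ h _ _ h' => .congrPar h h'⟩

instance : AddCommSemigroup (ProcCl S) where
  add_assoc := by
    rintro ⟨P⟩ ⟨Q⟩ ⟨R⟩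
    exact Quotient.sound (.parAssoc P Q R)
  add_comm := by
    rintro ⟨P⟩ ⟨Q⟩
    exact Quotient.sound (.parComm P Q)

/-- The class of a process. -/
def procCl (P : Proc S) : ProcCl S := Quotient.mk _ P

/-- The class of a process, where classes have a zero. -/
def pcl (P : Proc S) : WithZero (ProcCl S) := procCl P

theorem pcl_eq {P Q : Proc S} : pcl P = pcl Q ↔ Proc.Cong P Q := by
  rw [pcl, pcl, WithZero.coe_inj]
  exact Quotient.eq (r := procSetoid)

theorem pcl_par (P Q : Proc S) : pcl (.par P Q) = pcl P + pcl Q := rfl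

/-- The sum of the classes of the components. -/
def psum (m : Multiset (Comp S)) : WithZero (ProcCl S) := (m.map fun c => pcl c.toProc).sum

theorem psum_add (m m' : Multiset (Comp S)) : psum (m + m') = psum m + psum m' := by
  simp [psum]

theorem psum_cons (c : Comp S) (m : Multiset (Comp S)) :
    psum (c ::ₘ m) = pcl c.toProc + psum m := by
  simp [psum]

/-- The parallel composition of the components of a nonempty list. -/
def parComps : Comp S → List (Comp S) → Proc S
  | c, [] => c.toProc
  | c, d :: l => .par c.toProc (parComps d l)

theorem pcl_parComps (l : List (Comp S)) : ∀ c, pcl (parComps c l) = psum (c ::ₘ l) := by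
  induction l with
  | nil => intro c; simp [parComps, psum]
  | cons d l ih =>
    intro c
    rw [parComps, pcl_par, ih, psum_cons, psum_cons, ← Multiset.cons_coe, psum_cons]

theorem flat_toProc (c : Comp S) : flat c.toProc = (0, {c}) := by
  cases c <;> rfl

theorem upRen_add_zero (n : ℕ) : upRen n (· + 0) = id := upRen_id n

theorem ren_add_zero (m : Multiset (Comp S)) : ren (· + 0) m = m := ren_id m

theorem flat_parComps (l : List (Comp S)) : ∀ c, flat (parComps c l) = (0, c ::ₘ l) := by
  induction l with
  | nil => intro c; exact flat_toProc c
  | cons d l ih =>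
    intro c
    simp only [parComps, flat, ih, flat_toProc, upRen_add_zero, ren_add_zero, ren_id]
    rfl

theorem flat_nus (n : ℕ) (P : Proc S) : flat (Proc.nus n P) = ((flat P).1 + n, (flat P).2) := by
  induction n with
  | zero => rfl
  | succ n ih => simp only [Proc.nus, flat, ih]; rfl

theorem cong_nus {P Q : Proc S} (n : ℕ) (h : Proc.Cong P Q) :
    Proc.Cong (Proc.nus n P) (Proc.nus n Q) := by
  induction n with
  | zero => exact h
  | succ n ih => exact .congrNu ih

theorem rename_nus (n : ℕ) : ∀ (P : Proc S) (f : ℕ → ℕ),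
    (Proc.nus n P).rename f = Proc.nus n (P.rename (upRen n f)) := by
  induction n with
  | zero => intro P f; rw [upRen_zero]; rfl
  | succ n ih =>
    intro P f
    simp only [Proc.nus, Proc.rename, ih]
    rw [upRen_upRen]

theorem nus_nus (n k : ℕ) (P : Proc S) : Proc.nus n (Proc.nus k P) = Proc.nus (n + k) P := by
  induction n with
  | zero => rw [Nat.zero_add]; rfl
  | succ n ih => rw [Nat.succ_add, Proc.nus, ih]; rfl

theorem Proc.rename_comp (P : Proc S) : ∀ f g : ℕ → ℕ,
    (P.rename f).rename g = P.rename (g ∘ f) := by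
  induction P <;> intro f g <;> simp [Proc.rename, Expr.rename_comp, upRen_comp, *]

theorem Proc.rename_id (P : Proc S) : P.rename id = P := by
  induction P <;> simp [Proc.rename, Expr.rename_id, *]

theorem cong_nus_par (n : ℕ) : ∀ (P Q : Proc S),
    Proc.Cong (.par (Proc.nus n P) Q) (Proc.nus n (.par P (Q.rename (· + n)))) := by
  induction n with
  | zero => intro P Q; rw [show (· + 0 : ℕ → ℕ) = id from rfl, Proc.rename_id]; exact .refl _
  | succ n ih =>
    intro P Q
    refine .trans (.nuPar _ _) (.trans (.congrNu (ih _ _)) ?_)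
    rw [Proc.rename_comp, show (· + n : ℕ → ℕ) ∘ Nat.succ = (· + (n + 1)) from by
      funext y; simp [Nat.succ_eq_add_one]; omega]
    exact .refl _

theorem rename_parComps (f : ℕ → ℕ) (l : List (Comp S)) : ∀ c,
    (parComps c l).rename f = parComps (c.rename f) (l.map (Comp.rename f)) := by
  have key : ∀ c : Comp S, c.toProc.rename f = (c.rename f).toProc := by
    intro c
    cases c <;> rfl
  induction l with
  | nil => intro c; exact key c
  | cons d l ih => intro c; simp only [parComps, Proc.rename, key, ih, List.map]

/-- Every process is congruent to the restricted parallel composition of its components. -/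
theorem exists_cong_parComps (P : Proc S) : ∃ (c : Comp S) (l : List (Comp S)),
    (flat P).2 = c ::ₘ (l : Multiset (Comp S)) ∧
    Proc.Cong P (Proc.nus (flat P).1 (parComps c l)) := by
  induction P with
  | par P Q ihP ihQ =>
    obtain ⟨c, l, h₁, h₂⟩ := ihP
    obtain ⟨d, l', h₁', h₂'⟩ := ihQ
    refine ⟨c.rename (upRen (flat P).1 (· + (flat Q).1)),
      l.map (Comp.rename (upRen (flat P).1 (· + (flat Q).1))) ++
        (d :: l').map (Comp.rename (· + (flat P).1)), ?_, ?_⟩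
    · simp only [flat, h₁, h₁', ren]
      simp
    · refine .trans (.congrPar h₂ h₂') (.trans (.parComm _ _) (.trans (cong_nus_par _ _ _) ?_))
      rw [rename_nus]
      refine .trans (cong_nus _ (.parComm _ _)) (.trans (cong_nus _ (cong_nus_par _ _ _)) ?_)
      rw [nus_nus, Nat.add_comm (flat Q).1]
      refine cong_nus _ (pcl_eq.1 ?_)
      rw [pcl_par, rename_parComps, rename_parComps, pcl_parComps, pcl_parComps, pcl_parComps,
        ← psum_add]
      congr 1
  | nu P ih =>
    obtain ⟨c, l, h₁, h₂⟩ := ih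
    exact ⟨c, l, h₁, .congrNu h₂⟩
  | _ => exact ⟨_, [], rfl, .refl _⟩

/-- Some components of a process can be put into the hole of a process context. -/
theorem exists_ctx_of_flat {P X : Proc S} {m : Multiset (Comp S)} (hX : (flat X).1 = 0)
    (hP : (flat P).2 = (flat X).2 + m) : ∃ D : Proc.PCtx S, Proc.Cong P (D.plug X) ∧
      ∀ Y, (flat (D.plug Y)).2 = (flat Y).2 + ren (· + (flat Y).1) m := by
  obtain ⟨c, l, h₁, h₂⟩ := exists_cong_parComps P
  obtain ⟨d, l', h₁', h₂'⟩ := exists_cong_parComps X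
  have hnus : ∀ (n : ℕ) (D : Proc.PCtx S), ∃ D' : Proc.PCtx S,
      ∀ Y, D'.plug Y = Proc.nus n (D.plug Y) := by
    intro n D
    induction n with
    | zero => exact ⟨D, fun _ => rfl⟩
    | succ n ih =>
      obtain ⟨D', h⟩ := ih
      exact ⟨.nu D', fun Y => by simp only [Proc.PCtx.plug, h, Proc.nus]⟩
  rw [hX] at h₂'
  have hXcl : pcl X = psum (flat X).2 := by
    rw [pcl_eq.2 h₂', h₁']
    exact pcl_parComps l' d
  have hPcl : pcl (parComps c l) = pcl X + psum m := by
    rw [hXcl, pcl_parComps, ← h₁, hP, psum_add]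
  rcases Multiset.empty_or_exists_mem m with rfl | ⟨t, ht⟩
  · obtain ⟨D, hD⟩ := hnus (flat P).1 .hole
    refine ⟨D, .trans h₂ ?_, fun Y => ?_⟩
    · rw [hD]
      exact cong_nus _ (pcl_eq.1 (by rw [hPcl]; simp [psum, Proc.PCtx.plug]))
    · rw [hD, flat_nus]
      simp [Proc.PCtx.plug]
  · obtain ⟨m, rfl⟩ := Multiset.exists_cons_of_mem ht
    obtain ⟨l, rfl⟩ := Quot.exists_rep m
    obtain ⟨D, hD⟩ := hnus (flat P).1 (.parL .hole (parComps t l))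
    refine ⟨D, .trans h₂ ?_, fun Y => ?_⟩
    · rw [hD]
      refine cong_nus _ (pcl_eq.1 ?_)
      rw [hPcl, Proc.PCtx.plug, pcl_par, pcl_parComps]
      rfl
    · rw [hD, flat_nus]
      simp only [Proc.PCtx.plug, flat, flat_parComps, upRen_add_zero, ren_id]
      rfl

/-! ### Reduction of processes and of multisets of components -/

theorem AStep.dstep {b : Bool} {e : Expr S} {a m m'} (h : MRed e a) (h' : AStep b a m m') :
    DStep (Comp.thread b e ::ₘ m) m' := ⟨b, e, m, a, rfl, h, h'⟩

theorem foldl_par_flat (l : List (Comp S)) : ∀ P : Proc S, (flat P).1 = 0 →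
    flat ((l.map Comp.toProc).foldl Proc.par P) = (0, (flat P).2 + (l : Multiset (Comp S))) := by
  induction l with
  | nil => intro P h; simp [← h]
  | cons c l ih =>
    intro P h
    simp only [List.map, List.foldl]
    rw [ih]
    · simp only [flat, h, flat_toProc, upRen_add_zero, ren_add_zero, ren_id, add_assoc]
      rfl
    · simp [flat, h, flat_toProc]

theorem flat_addShares {n : ℕ} (b : Bool) (e : Expr S) (es : Fin n → Expr S) :
    flat (Proc.addShares (.thread b e) es) = (0, .thread b e ::ₘ shares es) := by
  have := foldl_par_flat (List.ofFn fun i : Fin n => Comp.share (i : ℕ) (es i)) (.thread b e) rfl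
  rw [List.map_ofFn] at this
  exact this

theorem upRen_comp_add (n : ℕ) (f : ℕ → ℕ) : upRen n f ∘ (· + n) = (· + n) ∘ f := by
  funext y
  simp [upRen]

theorem flat_thread_thread (b b' : Bool) (e v : Expr S) :
    flat (.par (.thread b e) (.thread b' v)) = (0, .thread b e ::ₘ {.thread b' v}) := by
  simp only [flat, upRen_add_zero, ren_add_zero, ren_id]
  rfl

theorem flat_thread_share (b : Bool) (e v : Expr S) (x : ℕ) :
    flat (.par (.thread b e) (.share x v)) = (0, .thread b e ::ₘ {.share x v}) := by
  simp only [flat, upRen_add_zero, ren_add_zero, ren_id]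
  rfl

theorem flat_thread_mvar (b : Bool) (e v : Expr S) (x : ℕ) :
    flat (.par (.thread b e) (.mvar x v)) = (0, .thread b e ::ₘ {.mvar x v}) := by
  simp only [flat, upRen_add_zero, ren_add_zero, ren_id]
  rfl

theorem flat_thread_empty (b : Bool) (e : Expr S) (x : ℕ) :
    flat (.par (.thread b e) (.emptyMVar x)) = (0, .thread b e ::ₘ {.empty x}) := by
  simp only [flat, upRen_add_zero, ren_add_zero, ren_id]
  rfl

theorem flat_thread (b : Bool) (e : Expr S) :
    flat (.thread b e) = (0, {.thread b e}) := rfl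

theorem flat_nu_thread_mvar (b : Bool) (e v : Expr S) (x : ℕ) :
    flat (.nu (.par (.thread b e) (.mvar x v))) = (1, .thread b e ::ₘ {.mvar x v}) := by
  rw [flat, flat_thread_mvar]

theorem rename_foldl_par (f : ℕ → ℕ) (l : List (Proc S)) : ∀ P : Proc S,
    (l.foldl Proc.par P).rename f = (l.map (Proc.rename f)).foldl Proc.par (P.rename f) := by
  induction l with
  | nil => intro P; rfl
  | cons Q l ih => intro P; exact ih _

theorem rename_addShares {n : ℕ} (P : Proc S) (es : Fin n → Expr S) (f : ℕ → ℕ) :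
    (Proc.addShares P es).rename (upRen n f) =
      Proc.addShares (P.rename (upRen n f)) (fun i => (es i).rename (upRen n f)) := by
  rw [Proc.addShares, rename_foldl_par, Proc.addShares, List.map_ofFn]
  congr 2
  funext i
  simp [Proc.rename, upRen_of_lt]

/-- The reduction rules are closed under renaming. -/
theorem rule_rename {P Q : Proc S} (h : Proc.Rule P Q) (f : ℕ → ℕ) :
    Proc.Rule (P.rename f) (Q.rename f) := by
  have lift : ∀ (M : MCtx S) (F : FCtx S) (r : Expr S) (f : ℕ → ℕ),
      (M.plug (F.plug r)).rename f = (M.rename f).plug ((F.rename f).plug (r.rename f)) := by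
    intro M F r f
    rw [MCtx.rename_plug, FCtx.rename_plug]
  cases h with
  | cpce b M F x e =>
    simp only [Proc.rename, lift, Expr.rename]
    exact .cpce b _ _ _ _
  | mkbinds b M F n es e =>
    simp only [Proc.rename, lift, Expr.rename, rename_nus, rename_addShares]
    have := Proc.Rule.mkbinds b (M.rename f) (F.rename f) n (fun i => (es i).rename (upRen n f))
      (e.rename (upRen n f))
    simp only [MCtx.rename_rename, FCtx.rename_rename, upRen_comp_add] at this ⊢
    exact this
  | beta b M F e₁ e₂ =>
    have hv : (fun i => (![e₂] i).rename f) = ![e₂.rename f] := by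
      funext i
      match i with
      | 0 => rfl
    simp only [Proc.rename, lift, Expr.rename, Expr.rename_inst, hv]
    exact .beta b _ _ _ _
  | case b M F c es alts =>
    simp only [Proc.rename, lift, Expr.rename, Expr.rename_inst]
    exact .case b _ _ c _ (fun c => (alts c).rename (upRen c.arity f))
  | seq b M F e hv =>
    simp only [Proc.rename, lift, Expr.rename]
    refine .seq b _ _ _ ?_
    cases hv
    · exact .lam _
    · exact .con _ _
  | lunit b M e₁ e₂ =>
    simp only [Proc.rename, MCtx.rename_plug, Expr.rename]
    exact .lunit b _ _ _
  | tmvar b M x e =>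
    simp only [Proc.rename, MCtx.rename_plug, Expr.rename]
    exact .tmvar b _ _ _
  | pmvar b M x e =>
    simp only [Proc.rename, MCtx.rename_plug, Expr.rename, Expr.rename_unit]
    exact .pmvar b _ _ _
  | nmvar b M e =>
    have := Proc.Rule.nmvar b (M.rename f) (e.rename f)
    simp only [Proc.rename, MCtx.rename_plug, MCtx.rename_rename, Expr.rename, Expr.rename_comp,
      upRen_one_comp_succ, upRen_one_zero] at this ⊢
    exact this
  | fork b M e =>
    simp only [Proc.rename, MCtx.rename_plug, Expr.rename, Expr.rename_unit]
    exact .fork b _ _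

/-- A reduction rule, read as a reduction of multisets of components. -/
theorem dstep_of_rule {P Q : Proc S} (h : Proc.Rule P Q) (m : Multiset (Comp S)) :
    DStep ((flat P).2 + m) ((flat Q).2 + ren (· + (flat Q).1) m) := by
  have hloc : ∀ {b : Bool} {e e' : Expr S}, MRed e (.loc e') →
      DStep ((flat (.thread b e)).2 + m)
        ((flat (.thread b e')).2 + ren (· + (flat (.thread b e')).1) m) := by
    intro b e e' h
    simp only [flat_thread, ren_add_zero, Multiset.singleton_add]
    exact (AStep.loc e' m).dstep h
  cases h with
  | cpce b M F x e =>
    simp only [flat_thread_share, ren_add_zero, Multiset.cons_add, Multiset.singleton_add]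
    exact (AStep.look x _ e m).dstep ((EBase.var x).plugMF M F)
  | mkbinds b M F n es e =>
    simp only [flat_nus, flat_addShares, flat_thread, Nat.zero_add, Multiset.cons_add,
      Multiset.singleton_add]
    exact (AStep.binds n es _ m).dstep ((EBase.letrec n es e).plugMF M F)
  | beta b M F e₁ e₂ => exact hloc ((EBase.beta e₁ e₂).plugMF M F)
  | case b M F c es alts => exact hloc ((EBase.case c es alts).plugMF M F)
  | seq b M F e hv => exact hloc ((EBase.seq e hv).plugMF M F)
  | lunit b M e₁ e₂ => exact hloc ((MRed.base (MBase.lunit e₁ e₂)).plug M)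
  | tmvar b M x e =>
    simp only [flat_thread_mvar, flat_thread_empty, ren_add_zero, Multiset.cons_add,
      Multiset.singleton_add]
    exact (AStep.take x _ e m).dstep ((MRed.base (MBase.take x)).plug M)
  | pmvar b M x e =>
    simp only [flat_thread_mvar, flat_thread_empty, ren_add_zero, Multiset.cons_add,
      Multiset.singleton_add]
    exact (AStep.put x e _ m).dstep ((MRed.base (MBase.put x e)).plug M)
  | nmvar b M e =>
    simp only [flat_nu_thread_mvar, flat_thread, Multiset.cons_add, Multiset.singleton_add]
    exact (AStep.new e _ m).dstep ((MRed.base (MBase.new e)).plug M)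
  | fork b M e =>
    simp only [flat_thread_thread, flat_thread, ren_add_zero, Multiset.cons_add,
      Multiset.singleton_add]
    exact (AStep.fork e _ m).dstep ((MRed.base (MBase.fork e)).plug M)

theorem rule_flat {P Q : Proc S} (h : Proc.Rule P Q) : (flat P).1 = 0 := by
  cases h <;> rfl

/-- A reduction of a multiset of components is an instance of a reduction rule. -/
theorem DStep.exists_rule {m m' : Multiset (Comp S)} (h : DStep m m') :
    ∃ (P Q : Proc S) (m₀ : Multiset (Comp S)), Proc.Rule P Q ∧ m = (flat P).2 + m₀ ∧
      m' = (flat Q).2 + ren (· + (flat Q).1) m₀ := by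
  obtain ⟨b, e, m₀, a, rfl, he, ha⟩ := h
  rcases he.exists_ctx with ⟨M, F, r, a, hr, rfl, rfl⟩ | ⟨M, r, a, hr, rfl, rfl⟩
  · cases hr with
    | var x =>
      cases ha with
      | look _ _ v m =>
        refine ⟨_, _, m, .cpce b M F x v, ?_, ?_⟩
        · simp only [flat_thread_share, Multiset.cons_add, Multiset.singleton_add]
        · simp only [flat_thread_share, ren_add_zero, Multiset.cons_add, Multiset.singleton_add, id]
    | letrec n es e =>
      cases ha with
      | binds =>
        refine ⟨_, _, m₀, .mkbinds b M F n es e, ?_, ?_⟩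
        · simp [flat]
        · simp [flat_nus, flat_addShares]
    | beta e₁ e₂ =>
      cases ha with
      | loc => exact ⟨_, _, m₀, .beta b M F e₁ e₂, by simp [flat],
          by simp only [flat, ren_add_zero, Multiset.singleton_add]⟩
    | case c es alts =>
      cases ha with
      | loc => exact ⟨_, _, m₀, .case b M F c es alts, by simp [flat],
          by simp only [flat, ren_add_zero, Multiset.singleton_add]⟩
    | seq e hv =>
      cases ha with
      | loc => exact ⟨_, _, m₀, .seq b M F e hv, by simp [flat],
          by simp only [flat, ren_add_zero, Multiset.singleton_add]⟩
  · cases hr with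
    | lunit e₁ e₂ =>
      cases ha with
      | loc => exact ⟨_, _, m₀, .lunit b M e₁ e₂, by simp [flat],
          by simp only [flat, ren_add_zero, Multiset.singleton_add]⟩
    | take x =>
      cases ha with
      | take _ _ v m =>
        exact ⟨_, _, m, .tmvar b M x v,
          by simp only [flat_thread_mvar, Multiset.cons_add, Multiset.singleton_add],
          by simp only [flat_thread_empty, ren_add_zero, Multiset.cons_add, Multiset.singleton_add]⟩
    | put x e =>
      cases ha with
      | put _ _ _ m =>
        exact ⟨_, _, m, .pmvar b M x e,
          by simp only [flat_thread_empty, Multiset.cons_add, Multiset.singleton_add],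
          by simp only [flat_thread_mvar, ren_add_zero, Multiset.cons_add, Multiset.singleton_add]⟩
    | new e =>
      cases ha with
      | new => exact ⟨_, _, m₀, .nmvar b M e, by simp [flat],
          by simp only [flat_nu_thread_mvar, Multiset.cons_add, Multiset.singleton_add]⟩
    | fork e =>
      cases ha with
      | fork => exact ⟨_, _, m₀, .fork b M e, by simp [flat],
          by simp only [flat_thread_thread, ren_add_zero, Multiset.cons_add,
            Multiset.singleton_add]⟩

/-- The multiset `m` consists of the components of `P`, up to a permutation of the variables. -/
def Rep (P : Proc S) (m : Multiset (Comp S)) : Prop :=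
  ∃ π : Equiv.Perm ℕ, (flat P).2 = ren π m

theorem Rep.cong {P Q : Proc S} {m : Multiset (Comp S)} (h : Rep P m) (hc : Proc.Cong P Q) :
    Rep Q m := by
  obtain ⟨π, h⟩ := h
  obtain ⟨-, π', -, h'⟩ := FlatEq.of_cong hc
  exact ⟨π.trans π', by rw [h', h, ren_ren]; rfl⟩

theorem upRen_add_right (a b : ℕ) (f : ℕ → ℕ) : upRen (a + b) f = upRen a (upRen b f) :=
  (upRen_upRen a b f).symm

/-- Flattening of a process in a reduction context. -/
theorem exists_flat_plug (D : Proc.PCtx S) : ∃ (d : ℕ) (f : ℕ → ℕ) (m : Multiset (Comp S)),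
    ∀ X, ∃ Y, Proc.Cong (D.plug X) Y ∧ (flat Y).1 = (flat X).1 + d ∧
      (flat Y).2 = ren (upRen (flat X).1 f) (flat X).2 + ren (· + (flat X).1) m := by
  have step : ∀ (D : Proc.PCtx S) (P : Proc S), (∃ (d : ℕ) (f : ℕ → ℕ) (m : Multiset (Comp S)),
      ∀ X, ∃ Y, Proc.Cong (D.plug X) Y ∧ (flat Y).1 = (flat X).1 + d ∧
        (flat Y).2 = ren (upRen (flat X).1 f) (flat X).2 + ren (· + (flat X).1) m) →
      ∃ (d : ℕ) (f : ℕ → ℕ) (m : Multiset (Comp S)),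
      ∀ X, ∃ Y, Proc.Cong (.par (D.plug X) P) Y ∧ (flat Y).1 = (flat X).1 + d ∧
        (flat Y).2 = ren (upRen (flat X).1 f) (flat X).2 + ren (· + (flat X).1) m := by
    rintro D P ⟨d, f, m, h⟩
    refine ⟨d + (flat P).1, upRen d (· + (flat P).1) ∘ f,
      ren (upRen d (· + (flat P).1)) m + ren (· + d) (flat P).2, fun X => ?_⟩
    obtain ⟨Y, h₁, h₂, h₃⟩ := h X
    refine ⟨.par Y P, .congrPar h₁ (.refl _), by simp only [flat, h₂, add_assoc], ?_⟩
    simp only [flat, h₂, h₃, ren_add, ren_ren, upRen_add_right, upRen_comp, upRen_comp_add]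
    rw [add_assoc]
    congr 3
    funext y
    simp only [Function.comp]
    omega
  induction D with
  | hole => exact ⟨0, id, 0, fun X => ⟨X, .refl _, rfl, by simp⟩⟩
  | parL D P ih => exact step D P ih
  | parR P D ih =>
    obtain ⟨d, f, m, h⟩ := step D P ih
    refine ⟨d, f, m, fun X => ?_⟩
    obtain ⟨Y, h₁, h₂⟩ := h X
    exact ⟨Y, .trans (.parComm _ _) h₁, h₂⟩
  | nu D ih =>
    obtain ⟨d, f, m, h⟩ := ih
    refine ⟨d + 1, f, m, fun X => ?_⟩
    obtain ⟨Y, h₁, h₂, h₃⟩ := h X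
    exact ⟨.nu Y, .congrNu h₁, by simp only [flat, h₂, add_assoc], h₃⟩

theorem ren_symm_ren (π : Equiv.Perm ℕ) (m : Multiset (Comp S)) : ren π.symm (ren π m) = m := by
  rw [ren_ren, Equiv.symm_comp_self, ren_id]

theorem ren_ren_symm (π : Equiv.Perm ℕ) (m : Multiset (Comp S)) : ren π (ren π.symm m) = m := by
  rw [ren_ren, Equiv.self_comp_symm, ren_id]

/-- A reduction of a process is a reduction of its components. -/
theorem Rep.dstep {P Q : Proc S} {m : Multiset (Comp S)} (h : Rep P m) {D : Proc.PCtx S}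
    {P' Q' : Proc S} (hP : Proc.Cong P (D.plug P')) (hr : Proc.Rule P' Q')
    (hQ : Proc.Cong Q (D.plug Q')) : ∃ m', DStep m m' ∧ Rep Q m' := by
  obtain ⟨d, f, m₀, hD⟩ := exists_flat_plug D
  obtain ⟨X, hX, -, hX'⟩ := hD P'
  obtain ⟨Y, hY, -, hY'⟩ := hD Q'
  obtain ⟨π, hπ⟩ := h.cong (hP.trans hX)
  have hd := dstep_of_rule (rule_rename hr (π.symm ∘ f)) (ren π.symm m₀)
  have hm : m = ren (π.symm ∘ f) (flat P').2 + ren π.symm m₀ := by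
    rw [← ren_symm_ren π m, ← hπ, hX', rule_flat hr, upRen_zero, ren_add_zero, ren_add, ren_ren]
  simp only [flat_rename, rule_flat hr, upRen_zero, ← hm] at hd
  refine ⟨_, hd, Rep.cong ⟨upPerm (flat Q').1 π, ?_⟩ (hQ.trans hY).symm⟩
  have hu : ⇑(upPerm (flat Q').1 π) = upRen (flat Q').1 π := rfl
  rw [hY', ren_add, hu, ren_ren, upRen_comp, ← Function.comp_assoc, Equiv.self_comp_symm,
    Function.id_comp, ren_ren, upRen_comp_add, ← ren_ren, ren_ren_symm]

/-- A reduction of the components is a reduction of the process. -/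
theorem Rep.exists_step {P : Proc S} {m m' : Multiset (Comp S)} (h : Rep P m) (hm : DStep m m') :
    ∃ (Q : Proc S) (D : Proc.PCtx S) (P' Q' : Proc S), Proc.Cong P (D.plug P') ∧
      Proc.Rule P' Q' ∧ Proc.Cong Q (D.plug Q') ∧ Rep Q m' := by
  obtain ⟨A, B, m₀, hr, rfl, rfl⟩ := hm.exists_rule
  obtain ⟨π, hπ⟩ := h
  have hA := flat_rename A π
  rw [rule_flat hr, upRen_zero] at hA
  have hP : (flat P).2 = (flat (A.rename π)).2 + ren π m₀ := by rw [hπ, hA, ren_add]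
  obtain ⟨D, hD, hD'⟩ := exists_ctx_of_flat (by rw [hA]) hP
  refine ⟨_, D, _, _, hD, rule_rename hr π, .refl _, upPerm (flat B).1 π, ?_⟩
  have hu : ⇑(upPerm (flat B).1 π) = upRen (flat B).1 π := rfl
  rw [hD', flat_rename, ren_add, hu, ren_ren, ren_ren, upRen_comp_add]

/-! ### Well-formedness and success -/

@[simp] theorem Comp.isMain_thread (b : Bool) (e : Expr S) : (thread b e).isMain = b := rfl

@[simp] theorem Comp.isMain_mvar (x : ℕ) (e : Expr S) : (mvar x e).isMain = false := rfl

@[simp] theorem Comp.isMain_empty (x : ℕ) : (empty x : Comp S).isMain = false := rfl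

@[simp] theorem Comp.isMain_share (x : ℕ) (e : Expr S) : (share x e).isMain = false := rfl

/-- The variables that are introduced by a multiset of components. -/
def intros (m : Multiset (Comp S)) : Multiset ℕ := m.filterMap Comp.intro?

/-- The number of main threads. -/
def mains (m : Multiset (Comp S)) : ℕ := (m.map fun c => cond c.isMain 1 0).sum

theorem mains_add (m m' : Multiset (Comp S)) : mains (m + m') = mains m + mains m' := by
  simp [mains]

theorem mains_cons (c : Comp S) (m : Multiset (Comp S)) :
    mains (c ::ₘ m) = cond c.isMain 1 0 + mains m := by
  simp [mains]

/-- The introduced variables are distinct, and there is at most one main thread. -/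
def Good (m : Multiset (Comp S)) : Prop :=
  (intros m).Nodup ∧ mains m ≤ 1

/-- The main thread has finished. -/
def HasRet (m : Multiset (Comp S)) : Prop := ∃ e, Comp.thread true (.ret e) ∈ m

theorem intros_add (m m' : Multiset (Comp S)) : intros (m + m') = intros m + intros m' :=
  Multiset.filterMap_add _ _ _

theorem intros_cons_thread (b : Bool) (e : Expr S) (m : Multiset (Comp S)) :
    intros (.thread b e ::ₘ m) = intros m :=
  Multiset.filterMap_cons_none _ _ rfl

theorem intros_cons_mvar (x : ℕ) (e : Expr S) (m : Multiset (Comp S)) :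
    intros (.mvar x e ::ₘ m) = x ::ₘ intros m :=
  Multiset.filterMap_cons_some _ _ _ rfl

theorem intros_cons_empty (x : ℕ) (m : Multiset (Comp S)) :
    intros (.empty x ::ₘ m) = x ::ₘ intros m :=
  Multiset.filterMap_cons_some _ _ _ rfl

theorem intros_cons_share (x : ℕ) (e : Expr S) (m : Multiset (Comp S)) :
    intros (.share x e ::ₘ m) = x ::ₘ intros m :=
  Multiset.filterMap_cons_some _ _ _ rfl

theorem intros_ren (f : ℕ → ℕ) (m : Multiset (Comp S)) : intros (ren f m) = (intros m).map f := by
  simp only [intros, ren, Multiset.filterMap_map, Multiset.map_filterMap]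
  congr 1
  funext c
  exact Comp.intro?_rename c f

theorem mains_ren (f : ℕ → ℕ) (m : Multiset (Comp S)) : mains (ren f m) = mains m := by
  simp [mains, ren]

theorem intros_shares {n : ℕ} (es : Fin n → Expr S) :
    intros (shares es) = (List.ofFn fun i : Fin n => (i : ℕ) : Multiset ℕ) := by
  simp only [intros, shares, Multiset.filterMap_coe, List.ofFn_eq_map, List.filterMap_map]
  congr 1
  have : (Comp.intro? ∘ fun i : Fin n => Comp.share (i : ℕ) (es i)) =
      some ∘ fun i : Fin n => (i : ℕ) := rfl
  rw [this, List.filterMap_eq_map]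

theorem mains_shares {n : ℕ} (es : Fin n → Expr S) : mains (shares es) = 0 := by
  rw [mains, Multiset.sum_eq_zero_iff]
  intro a ha
  obtain ⟨c, hc, rfl⟩ := Multiset.mem_map.1 ha
  simp only [shares, Multiset.mem_coe, List.mem_ofFn] at hc
  obtain ⟨i, rfl⟩ := hc
  rfl

theorem Good.ren_iff {f : ℕ → ℕ} (hf : Function.Injective f) (m : Multiset (Comp S)) :
    Good (ren f m) ↔ Good m := by
  rw [Good, Good, intros_ren, mains_ren, Multiset.nodup_map_iff_of_injective hf]

/-- Reduction preserves well-formedness. -/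
theorem Good.dstep {m m' : Multiset (Comp S)} (h : Good m) (hs : DStep m m') : Good m' := by
  obtain ⟨b, e, m₀, a, rfl, -, ha⟩ := hs
  obtain ⟨h₁, h₂⟩ := h
  cases ha with
  | binds n es e' =>
    refine ⟨?_, ?_⟩
    · rw [intros_cons_thread] at h₁ ⊢
      rw [intros_add, intros_ren, intros_shares, Multiset.nodup_add]
      refine ⟨?_, h₁.map (add_left_injective n), ?_⟩
      · rw [Multiset.coe_nodup, List.nodup_ofFn]
        exact Fin.val_injective
      · rw [Multiset.disjoint_left]
        intro y hy hy'
        simp only [Multiset.mem_coe, List.mem_ofFn] at hy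
        obtain ⟨i, rfl⟩ := hy
        obtain ⟨z, -, hz⟩ := Multiset.mem_map.1 hy'
        have := i.2
        omega
    · simpa [mains_cons, mains_add, mains_shares, mains_ren] using h₂
  | new v e' =>
    refine ⟨?_, ?_⟩
    · rw [intros_cons_thread] at h₁
      rw [intros_cons_thread, intros_cons_mvar, intros_ren, Multiset.nodup_cons]
      exact ⟨by simp, h₁.map Nat.succ_injective⟩
    · simpa [mains_cons, mains_ren] using h₂
  | _ =>
    simp only [Good, intros_cons_thread, intros_cons_mvar, intros_cons_empty, intros_cons_share,
      mains_cons, Comp.isMain_thread, Comp.isMain_mvar, Comp.isMain_empty,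
      Comp.isMain_share] at h₁ h₂ ⊢
    refine ⟨h₁, by simpa using h₂⟩

theorem mem_introduced (P : Proc S) :
    ∀ x, x ∈ P.introduced ↔ x + (flat P).1 ∈ intros (flat P).2 := by
  induction P with
  | par P Q ihP ihQ =>
    intro x
    simp only [Proc.introduced, Set.mem_union, ihP, ihQ, flat, intros_add, intros_ren,
      Multiset.mem_add, Multiset.mem_map]
    refine or_congr ⟨fun h => ⟨_, h, ?_⟩, ?_⟩ ⟨fun h => ⟨_, h, ?_⟩, ?_⟩
    · rw [Nat.add_comm x, upRen_add]
      omega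
    · rintro ⟨y, hy, e⟩
      rcases Nat.lt_or_ge y (flat P).1 with h | h
      · rw [upRen_of_lt _ h] at e
        omega
      · obtain ⟨z, rfl⟩ := Nat.exists_eq_add_of_le h
        rw [upRen_add] at e
        rwa [show x + (flat P).1 = (flat P).1 + z by omega]
    · omega
    · rintro ⟨y, hy, e⟩
      rwa [show x + (flat Q).1 = y by omega]
  | nu P ih =>
    intro x
    simp only [Proc.introduced, Set.mem_ofPred_eq, ih, flat]
    rw [show x + 1 + (flat P).1 = x + ((flat P).1 + 1) by omega]
  | _ => intro x; simp [Proc.introduced, flat, intros, Comp.intro?, eq_comm]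

theorem distinctIntro_of_nodup (P : Proc S) : (intros (flat P).2).Nodup → P.DistinctIntro := by
  induction P with
  | par P Q ihP ihQ =>
    intro h
    simp only [flat, intros_add, intros_ren, Multiset.nodup_add] at h
    obtain ⟨h₁, h₂, h₃⟩ := h
    refine ⟨ihP h₁.of_map, ihQ h₂.of_map, Set.disjoint_left.2 fun x hx hx' => ?_⟩
    rw [mem_introduced] at hx hx'
    refine Multiset.disjoint_left.1 h₃ (Multiset.mem_map_of_mem _ hx) ?_
    rw [Nat.add_comm x, upRen_add]
    rw [show x + (flat Q).1 + (flat P).1 = (x + (flat Q).1) + (flat P).1 from rfl]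
    exact Multiset.mem_map_of_mem (· + (flat P).1) hx'
  | nu P ih => intro h; exact ih h
  | _ => intro _; trivial

theorem mainCount_eq (P : Proc S) :
    P.mainCount = mains (flat P).2 := by
  induction P with
  | par P Q ihP ihQ => simp [Proc.mainCount, flat, mains_add, mains_ren, ihP, ihQ]
  | nu P ih => exact ih
  | thread b e => cases b <;> rfl
  | _ => rfl

theorem Rep.wellFormed {P : Proc S} {m : Multiset (Comp S)} (h : Rep P m) (hm : Good m) :
    P.WellFormed := by
  obtain ⟨π, h⟩ := h
  rw [← Good.ren_iff π.injective, ← h] at hm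
  exact ⟨distinctIntro_of_nodup P hm.1, by rw [mainCount_eq]; exact hm.2⟩

theorem hasRet_ren {m : Multiset (Comp S)} (h : HasRet m) (f : ℕ → ℕ) : HasRet (ren f m) := by
  obtain ⟨e, he⟩ := h
  exact ⟨e.rename f, Multiset.mem_map_of_mem (Comp.rename f) he⟩

/-- A well-formed process is successful if its main thread has finished. -/
theorem Rep.successful_iff {P : Proc S} {m : Multiset (Comp S)} (h : Rep P m) (hm : Good m) :
    P.Successful ↔ HasRet m := by
  constructor
  · rintro ⟨-, n, e, hP⟩
    have key : ∀ Q : Proc S, Proc.Cong P Q → HasRet (flat Q).2 → HasRet m := by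
      intro Q hQ hr
      obtain ⟨π, hπ⟩ := h.cong hQ
      rw [hπ] at hr
      have := hasRet_ren hr π.symm
      rwa [ren_symm_ren] at this
    rcases hP with hP | ⟨P', hP⟩
    · refine key _ hP ⟨e, ?_⟩
      simp [flat_nus, flat]
    · refine key _ hP ?_
      simp only [flat_nus, flat]
      obtain ⟨e', he'⟩ := hasRet_ren (m := {Comp.thread true (.ret e)}) ⟨e, by simp⟩
        (upRen 0 (· + (flat P').1))
      exact ⟨e', Multiset.mem_add.2 (.inl he')⟩
  · intro hr
    refine ⟨h.wellFormed hm, ?_⟩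
    obtain ⟨π, hπ⟩ := h
    obtain ⟨e, he⟩ := hasRet_ren hr π
    rw [← hπ] at he
    obtain ⟨m', hm'⟩ := Multiset.exists_cons_of_mem he
    obtain ⟨c, l, h₁, h₂⟩ := exists_cong_parComps P
    refine ⟨(flat P).1, e, ?_⟩
    have hcl : pcl (parComps c l) = pcl (.thread true (.ret e)) + psum m' := by
      rw [pcl_parComps, ← h₁, hm', psum_cons]
      rfl
    rcases Multiset.empty_or_exists_mem m' with rfl | ⟨t, ht⟩
    · refine .inl (.trans h₂ (cong_nus _ (pcl_eq.1 ?_)))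
      rw [hcl]
      simp [psum]
    · obtain ⟨m'', rfl⟩ := Multiset.exists_cons_of_mem ht
      obtain ⟨l, rfl⟩ := Quot.exists_rep m''
      refine .inr ⟨parComps t l, .trans h₂ (cong_nus _ (pcl_eq.1 ?_))⟩
      rw [hcl, pcl_par, pcl_parComps]
      rfl

/-! ### Convergence of multisets of components -/

/-- Standard reduction of multisets of components. -/
def SStep (m m' : Multiset (Comp S)) : Prop := ¬ HasRet m ∧ DStep m m'

/-- May-convergence of a multiset of components. -/
def MMay (m : Multiset (Comp S)) : Prop := ∃ m', Relation.ReflTransGen SStep m m' ∧ HasRet m'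

/-- Should-convergence of a multiset of components. -/
def MShould (m : Multiset (Comp S)) : Prop :=
  ∀ m', Relation.ReflTransGen SStep m m' → MMay m'

theorem Rep.steps_of_proc {P Q : Proc S} (hs : Relation.ReflTransGen Proc.Step P Q) :
    ∀ {m : Multiset (Comp S)}, Rep P m → Good m →
      ∃ m', Relation.ReflTransGen SStep m m' ∧ Rep Q m' ∧ Good m' := by
  induction hs using Relation.ReflTransGen.head_induction_on with
  | refl => intro m h hm; exact ⟨m, .refl, h, hm⟩
  | head hs _ ih =>
    intro m h hm
    obtain ⟨-, hns, D, P', Q', hP, hr, hQ⟩ := hs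
    obtain ⟨m₁, h₁, h₁'⟩ := h.dstep hP hr hQ
    obtain ⟨m', h₂, h₃⟩ := ih h₁' (hm.dstep h₁)
    exact ⟨m', .head ⟨fun hr => hns ((h.successful_iff hm).2 hr), h₁⟩ h₂, h₃⟩

theorem Rep.steps_of_comps {m m' : Multiset (Comp S)} (hs : Relation.ReflTransGen SStep m m') :
    ∀ {P : Proc S}, Rep P m → Good m →
      ∃ Q, Relation.ReflTransGen Proc.Step P Q ∧ Rep Q m' ∧ Good m' := by
  induction hs using Relation.ReflTransGen.head_induction_on with
  | refl => intro P h hm; exact ⟨P, .refl, h, hm⟩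
  | head hs _ ih =>
    intro P h hm
    obtain ⟨Q, D, P', Q', hP, hr, hQ, hQ'⟩ := h.exists_step hs.2
    obtain ⟨R, h₂, h₃⟩ := ih hQ' (hm.dstep hs.2)
    exact ⟨R, .head ⟨h.wellFormed hm, fun hsu => hs.1 ((h.successful_iff hm).1 hsu),
      D, P', Q', hP, hr, hQ⟩ h₂, h₃⟩

/-- Convergence of a process depends on its components only. -/
theorem Rep.mayConv_iff {P : Proc S} {m : Multiset (Comp S)} (h : Rep P m) (hm : Good m) :
    P.MayConv ↔ MMay m := by
  constructor
  · rintro ⟨-, Q, hs, hQ⟩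
    obtain ⟨m', h₁, h₂, h₃⟩ := Rep.steps_of_proc hs h hm
    exact ⟨m', h₁, (h₂.successful_iff h₃).1 hQ⟩
  · rintro ⟨m', hs, hr⟩
    obtain ⟨Q, h₁, h₂, h₃⟩ := Rep.steps_of_comps hs h hm
    exact ⟨h.wellFormed hm, Q, h₁, (h₂.successful_iff h₃).2 hr⟩

theorem Rep.shouldConv_iff {P : Proc S} {m : Multiset (Comp S)} (h : Rep P m) (hm : Good m) :
    P.ShouldConv ↔ MShould m := by
  constructor
  · rintro ⟨-, hP⟩ m' hs
    obtain ⟨Q, h₁, h₂, h₃⟩ := Rep.steps_of_comps hs h hm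
    exact (h₂.mayConv_iff h₃).1 (hP Q h₁)
  · intro hs
    refine ⟨h.wellFormed hm, fun Q hQ => ?_⟩
    obtain ⟨m', h₁, h₂, h₃⟩ := Rep.steps_of_proc hQ h hm
    exact (h₂.mayConv_iff h₃).2 (hs m' h₁)

/-! ### Substitution in the translation -/

namespace Expr

theorem upSubst_add (n x : ℕ) (σ : ℕ → Expr S) :
    upSubst n σ (x + n) = (σ x).rename (· + n) := by
  simp [upSubst]

theorem upSubst_lt {n x : ℕ} (σ : ℕ → Expr S) (h : x < n) : upSubst n σ x = var x := if_pos h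

theorem inst_single (e v : Expr S) :
    e.inst ![v] = e.subst fun y => Nat.casesOn y v fun x => var x := by
  rw [inst]
  congr 1
  funext y
  cases y <;> simp

theorem inst_two (e v w : Expr S) :
    e.inst ![v, w] = e.subst fun y => Nat.casesOn y v fun y => Nat.casesOn y w fun x => var x := by
  rw [inst]
  congr 1
  funext y
  rcases y with _ | _ | y <;> simp

end Expr

/-- A substitution that replaces variables by variables maps translations to translations. -/
theorem tauAux_subst (P : PiProc) : ∀ {s s' : ℕ} {r r' h : ℕ → ℕ} {σ : ℕ → Expr S},
    σ s = .var s' → (∀ x, σ (r x) = .var (r' (h x))) →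
    (tauAux s r P).subst σ = tauAux s' r' (P.rename h) := by
  have up : ∀ (n x x' : ℕ) (σ : ℕ → Expr S), σ x = .var x' →
      Expr.upSubst n σ (x + n) = .var (x' + n) := by
    intro n x x' σ h
    rw [Expr.upSubst_add, h]
    rfl
  induction P with
  | nu P ih =>
    intro s s' r r' h σ hs hr
    have h3 : ∀ x x', σ x = .var x' →
        Expr.upSubst 1 (Expr.upSubst 1 (Expr.upSubst 1 σ)) (x + 3) = .var (x' + 3) :=
      fun x x' e => up 1 _ _ _ (up 1 _ _ _ (up 1 _ _ _ e))
    simp only [tauAux, Expr.subst, Expr.subst_bot, Expr.subst_chan, PiProc.rename]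
    congr 4
    refine (congrArg (Expr.letrec 1 _) (ih (r' := consName 0 fun z => r' z + 3) (h := upRen 1 h)
      (h3 _ _ hs) ?_)).trans rfl
    rintro (_ | x)
    · rfl
    · exact h3 _ _ (hr x)
  | out x y P ih =>
    intro s s' r r' h σ hs hr
    have h3 : ∀ x x', σ x = .var x' →
        Expr.upSubst 1 (Expr.upSubst 1 (Expr.upSubst 1 σ)) (x + 3) = .var (x' + 3) :=
      fun x x' e => up 1 _ _ _ (up 1 _ _ _ (up 1 _ _ _ e))
    simp only [tauAux, Expr.subst, Expr.subst_unit, Expr.subst_unchan, Expr.subst_pair,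
      PiProc.rename, up 1 _ _ _ (hr x), up 1 _ _ _ (hr y),
      ih (r' := fun z => r' z + 3) (h3 _ _ hs) fun x => h3 _ _ (hr x)]
    rfl
  | inp x P ih =>
    intro s s' r r' h σ hs hr
    have h4 : ∀ x x', σ x = .var x' →
        Expr.upSubst 1 (Expr.upSubst 2 (Expr.upSubst 1 σ)) (x + 4) = .var (x' + 4) :=
      fun x x' e => up 1 _ _ _ (up 2 _ _ _ (up 1 _ _ _ e))
    simp only [tauAux, Expr.subst, Expr.subst_unchan, PiProc.rename, hr x]
    congr 3
    funext c
    cases c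
    refine congrArg (Expr.bind _) (congrArg Expr.lam ?_)
    apply ih (h4 _ _ hs)
    rintro (_ | x)
    · rfl
    · exact h4 _ _ (hr x)
  | bang P ih =>
    intro s s' r r' h σ hs hr
    simp only [tauAux, Expr.subst, PiProc.rename,
      ih (r' := fun z => r' z + 1) (up 1 _ _ _ hs) fun x => up 1 _ _ _ (hr x)]
    rfl
  | par P Q ihP ihQ =>
    intro s s' r r' h σ hs hr
    simp only [tauAux, Expr.subst, PiProc.rename, ihQ hs hr,
      ihP (r' := fun z => r' z + 1) (up 1 _ _ _ hs) fun x => up 1 _ _ _ (hr x)]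
  | zero => intro s s' r r' h σ hs hr; simp [tauAux, Expr.subst, PiProc.rename]
  | success => intro s s' r r' h σ hs hr; simp [tauAux, Expr.subst, PiProc.rename, hs]

theorem tauAux_rename (P : PiProc) {s s' : ℕ} {r r' h f : ℕ → ℕ} (hs : f s = s')
    (hr : ∀ x, f (r x) = r' (h x)) :
    (tauAux s r P : Expr S).rename f = tauAux s' r' (P.rename h) := by
  rw [Expr.rename_eq_subst]
  exact tauAux_subst P (congrArg _ hs) fun x => congrArg _ (hr x)

theorem tauAux_congr {P : PiProc} : ∀ {k s : ℕ} {r r' : ℕ → ℕ}, PiProc.Below k P →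
    (∀ x < k, r x = r' x) → (tauAux s r P : Expr S) = tauAux s r' P := by
  have up : ∀ {k a m : ℕ} {r r' : ℕ → ℕ}, (∀ x < k, r x = r' x) →
      ∀ x < k + 1, consName a (fun z => r z + m) x = consName a (fun z => r' z + m) x := by
    rintro k a m r r' h (_ | x) hx
    · rfl
    · simp [consName, h x (by omega)]
  induction P with
  | nu P ih => intro k s r r' hP h; simp only [tauAux, ih (k := k + 1) hP (up h)]
  | out x y P ih =>
    intro k s r r' hP h
    simp only [tauAux, h x hP.1, h y hP.2.1]
    rw [ih (k := k) hP.2.2 fun x hx => by rw [h x hx]]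
  | inp x P ih => intro k s r r' hP h; simp only [tauAux, h x hP.1, ih (k := k + 1) hP.2 (up h)]
  | bang P ih =>
    intro k s r r' hP h
    simp only [tauAux]
    rw [ih (k := k) (r := fun z => r z + 1) hP fun x hx => by rw [h x hx]]
  | par P Q ihP ihQ =>
    intro k s r r' hP h
    simp only [tauAux]
    rw [ihQ hP.2 h, ihP (r := fun z => r z + 1) hP.1 fun x hx => by rw [h x hx]]
  | zero => intros; rfl
  | success => intros; rfl

/-! ### Determinism of threads -/

theorem EBase.det {e : Expr S} {a a' : Act S} (h : EBase e a) (h' : EBase e a') : a = a' := by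
  cases h <;> cases h' <;> rfl

theorem EBase.not_eRed {e : Expr S} {a : Act S} (h : EBase e a) :
    ∀ {e' : Expr S} {a'}, ERed e' a' → (∀ f, e ≠ .app e' f) ∧ (∀ f, e ≠ .seq e' f) ∧
      (∀ T f, e ≠ .case T e' f) := by
  intro e' a' h'
  refine ⟨?_, ?_, ?_⟩
  · rintro f rfl
    cases h
    cases h' with | base h => cases h
  · rintro f rfl
    cases h with
    | seq _ hv => cases hv <;> (cases h' with | base h => cases h)
  · rintro T f rfl
    cases h
    cases h' with | base h => cases h

theorem ERed.det {e : Expr S} {a : Act S} (h : ERed e a) : ∀ {a'}, ERed e a' → a = a' := by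
  induction h with
  | base h =>
    intro a' h'
    cases h' with
    | base h' => exact h.det h'
    | app e' h' => exact absurd rfl ((h.not_eRed h').1 _)
    | seq e' h' => exact absurd rfl ((h.not_eRed h').2.1 _)
    | case T alts h' => exact absurd rfl ((h.not_eRed h').2.2 _ _)
  | app e' h ih =>
    intro a' h'
    cases h' with
    | base h' => exact absurd rfl ((h'.not_eRed h).1 _)
    | app e' h' => rw [ih h']
  | seq e' h ih =>
    intro a' h'
    cases h' with
    | base h' => exact absurd rfl ((h'.not_eRed h).2.1 _)
    | seq e' h' => rw [ih h']
  | case T alts h ih =>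
    intro a' h'
    cases h' with
    | base h' => exact absurd rfl ((h'.not_eRed h).2.2 _ _)
    | case T alts h' => rw [ih h']

theorem FRed.det {e : Expr S} {a a' : Act S} (h : FRed e a) (h' : FRed e a') : a = a' := by
  cases h with
  | eval h =>
    cases h' with
    | eval h' => exact h.det h'
    | take h' => cases h with | base h => cases h
    | put e' h' => cases h with | base h => cases h
  | take h =>
    cases h' with
    | eval h' => cases h' with | base h => cases h
    | take h' => rw [h.det h']
  | put e' h =>
    cases h' with
    | eval h' => cases h' with | base h => cases h
    | put e' h' => rw [h.det h']

/-- The variable that an action looks up among the bindings. -/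
def Act.looks : Act S → Option ℕ
  | .look x _ => some x
  | _ => none

/-- The MVar that an action accesses. -/
def Act.accesses : Act S → Option ℕ
  | .take x _ => some x
  | .put x _ _ => some x
  | _ => none

/-- One action looks up the variable that the other one accesses as an MVar. -/
def Act.Clash (a a' : Act S) : Prop :=
  ∃ x, a.looks = some x ∧ a'.accesses = some x ∨ a.accesses = some x ∧ a'.looks = some x

theorem Act.Clash.symm {a a' : Act S} (h : a.Clash a') : a'.Clash a := by
  obtain ⟨x, h | h⟩ := h
  · exact ⟨x, .inr ⟨h.2, h.1⟩⟩
  · exact ⟨x, .inl ⟨h.2, h.1⟩⟩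

theorem Act.looks_wrap (a : Act S) (C C') : (a.wrap C C').looks = a.looks := by
  cases a <;> rfl

theorem Act.accesses_wrap (a : Act S) (C C') : (a.wrap C C').accesses = a.accesses := by
  cases a <;> rfl

theorem MBase.clash {e : Expr S} {a a' : Act S} (h : MBase e a) (h' : FRed e a') : a.Clash a' := by
  cases h with
  | lunit => cases h' with | eval h => cases h with | base h => cases h
  | take x =>
    cases h' with
    | eval h => cases h with | base h => cases h
    | take h =>
      cases h with | base h => ?_
      cases h
      exact ⟨x, .inr ⟨rfl, rfl⟩⟩
  | put x e =>
    cases h' with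
    | eval h => cases h with | base h => cases h
    | put _ h =>
      cases h with | base h => ?_
      cases h
      exact ⟨x, .inr ⟨rfl, rfl⟩⟩
  | new => cases h' with | eval h => cases h with | base h => cases h
  | fork => cases h' with | eval h => cases h with | base h => cases h

/-- A thread determines its action, except that a variable in the position of an MVar can be looked
up if it is bound, and accessed if it is an MVar. -/
theorem MRed.det {e : Expr S} {a : Act S} (h : MRed e a) :
    ∀ {a'}, MRed e a' → a = a' ∨ a.Clash a' := by
  induction h with
  | force h =>
    intro a' h'
    cases h' with
    | force h' => exact .inl (h.det h')
    | base h' => exact .inr (h'.clash h).symm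
    | bind e' h' => cases h with | eval h => cases h with | base h => cases h
  | base h =>
    intro a' h'
    cases h' with
    | force h' => exact .inr (h.clash h')
    | base h' => cases h <;> cases h' <;> exact .inl rfl
    | bind e' h' =>
      cases h
      cases h' with
      | force h => cases h with | eval h => cases h with | base h => cases h
      | base h => cases h
  | bind e' h ih =>
    intro a' h'
    cases h' with
    | force h' => cases h' with | eval h => cases h with | base h => cases h
    | base h' =>
      cases h'
      cases h with
      | force h => cases h with | eval h => cases h with | base h => cases h
      | base h => cases h
    | bind e' h' =>
      rcases ih h' with rfl | ⟨x, h⟩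
      · exact .inl rfl
      · exact .inr ⟨x, by simpa only [Act.looks_wrap, Act.accesses_wrap] using h⟩

/-- Well-formedness makes the heap a function: two components that introduce the same variable are
equal. -/
theorem eq_of_intro {m : Multiset (Comp S)} (h : (intros m).Nodup) {c c' : Comp S} {x : ℕ}
    (hc : c ∈ m) (hc' : c' ∈ m) (hx : c.intro? = some x) (hx' : c'.intro? = some x) : c = c' := by
  by_contra hne
  obtain ⟨m, rfl⟩ := Multiset.exists_cons_of_mem hc
  obtain ⟨m, rfl⟩ := Multiset.exists_cons_of_mem
    ((Multiset.mem_cons.1 hc').resolve_left (Ne.symm hne))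
  rw [intros, Multiset.filterMap_cons_some _ _ _ hx, Multiset.filterMap_cons_some _ _ _ hx'] at h
  simp at h

theorem AStep.exists_looks {b : Bool} {a : Act S} {m m' : Multiset (Comp S)} (h : AStep b a m m')
    {x : ℕ} (hx : a.looks = some x) : ∃ v, Comp.share x v ∈ m := by
  cases h <;> cases hx
  exact ⟨_, Multiset.mem_cons_self _ _⟩

theorem AStep.exists_accesses {b : Bool} {a : Act S} {m m' : Multiset (Comp S)}
    (h : AStep b a m m') {x : ℕ} (hx : a.accesses = some x) :
    Comp.empty x ∈ m ∨ ∃ v, Comp.mvar x v ∈ m := by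
  cases h <;> cases hx
  · exact .inr ⟨_, Multiset.mem_cons_self _ _⟩
  · exact .inl (Multiset.mem_cons_self _ _)

theorem AStep.det {b : Bool} {a : Act S} {m m₁ m₂ : Multiset (Comp S)} (hm : (intros m).Nodup)
    (h₁ : AStep b a m m₁) (h₂ : AStep b a m m₂) : m₁ = m₂ := by
  cases h₁ with
  | look x K v m₀ =>
    generalize hn : Comp.share x v ::ₘ m₀ = n at h₂ hm
    cases h₂ with
    | look _ _ v' m₀' =>
      cases eq_of_intro hm (c := .share x v) (c' := .share x v') (by simp [← hn]) (by simp) rfl rfl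
      rfl
  | take x K v m₀ =>
    generalize hn : Comp.mvar x v ::ₘ m₀ = n at h₂ hm
    cases h₂ with
    | take _ _ v' m₀' =>
      cases eq_of_intro hm (c := .mvar x v) (c' := .mvar x v') (by simp [← hn]) (by simp) rfl rfl
      rw [Multiset.cons_inj_right] at hn
      rw [hn]
  | put x v e m₀ =>
    generalize hn : Comp.empty x ::ₘ m₀ = n at h₂ hm
    cases h₂ with
    | put =>
      rw [Multiset.cons_inj_right] at hn
      rw [hn]
  | _ => cases h₂; rfl

/-- `TStep b e m m'`: the thread with the expression `e` can make a step which changes the remaining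
components `m` and the thread to `m'`. -/
def TStep (b : Bool) (e : Expr S) (m m' : Multiset (Comp S)) : Prop :=
  ∃ a, MRed e a ∧ AStep b a m m'

theorem dStep_iff {m m' : Multiset (Comp S)} :
    DStep m m' ↔ ∃ b e m₀, m = Comp.thread b e ::ₘ m₀ ∧ TStep b e m₀ m' :=
  ⟨fun ⟨b, e, m₀, a, h, h', h''⟩ => ⟨b, e, m₀, h, a, h', h''⟩,
    fun ⟨b, e, m₀, h, a, h', h''⟩ => ⟨b, e, m₀, a, h, h', h''⟩⟩

theorem TStep.dStep {b : Bool} {e : Expr S} {m m' : Multiset (Comp S)} (h : TStep b e m m') :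
    DStep (Comp.thread b e ::ₘ m) m' := dStep_iff.2 ⟨b, e, m, rfl, h⟩

theorem AStep.not_clash {b : Bool} {a a' : Act S} {m m₁ m₂ : Multiset (Comp S)}
    (hm : (intros m).Nodup) (h₁ : AStep b a m m₁) (h₂ : AStep b a' m m₂) : ¬ a.Clash a' := by
  have key : ∀ {a a' : Act S} {m₁ m₂}, AStep b a m m₁ → AStep b a' m m₂ → ∀ x,
      a.looks = some x → a'.accesses = some x → False := by
    intro a a' m₁ m₂ h₁ h₂ x hx hx'
    obtain ⟨v, hv⟩ := h₁.exists_looks hx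
    rcases h₂.exists_accesses hx' with h | ⟨w, h⟩
    · cases eq_of_intro hm hv h rfl rfl
    · cases eq_of_intro hm hv h rfl rfl
  rintro ⟨x, h | h⟩
  · exact key h₁ h₂ x h.1 h.2
  · exact key h₂ h₁ x h.2 h.1

/-- A thread of a well-formed process has at most one reduct. -/
theorem TStep.det {b : Bool} {e : Expr S} {m m₁ m₂ : Multiset (Comp S)} (hm : (intros m).Nodup)
    (h₁ : TStep b e m m₁) (h₂ : TStep b e m m₂) : m₁ = m₂ := by
  obtain ⟨a, ha, h₁⟩ := h₁
  obtain ⟨a', ha', h₂⟩ := h₂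
  rcases ha.det ha' with rfl | h
  · exact h₁.det hm h₂
  · exact absurd h (h₁.not_clash hm h₂)

/-! ### The code of a translated process -/

/-- A sender `x̄y.P` with private MVar `k`, where `d` evaluates to the MVar of the channel `x`. -/
def sendCode (s : ℕ) (r : ℕ → ℕ) (d : Expr S) (y k : ℕ) (P : PiProc) : Expr S :=
  .bind (.put d (.pair (.var (r y)) (.var k)))
    (.lam (.bind (.put (.var (k + 1)) .unit) (.lam (tauAux (s + 2) (fun z => r z + 2) P))))

/-- A sender, continued by `P`, which waits for the acknowledgement on its private MVar `k`. -/
def ackCode (s : ℕ) (r : ℕ → ℕ) (k : ℕ) (P : PiProc) : Expr S :=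
  .bind (.put (.var k) .unit) (.lam (tauAux (s + 1) (fun z => r z + 1) P))

/-- The continuation of a receiver that has got the message `e`. -/
def splitCode (s : ℕ) (r : ℕ → ℕ) (e : Expr S) (P : PiProc) : Expr S :=
  .case .pair e (fun _ => .bind (.take (.var 1)) (.lam
    (tauAux (s + 3) (consName 1 (fun z => r z + 3)) P)))

/-- A receiver, where `d` evaluates to the MVar of the channel. -/
def recvCode (s : ℕ) (r : ℕ → ℕ) (d : Expr S) (P : PiProc) : Expr S :=
  .bind (.take d) (.lam (splitCode (s + 1) (fun z => r z + 1) (.var 0) P))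

/-- A receiver, continued by `P`, which is about to acknowledge the message on the private MVar
`k` of the sender. -/
def takeCode (s : ℕ) (r : ℕ → ℕ) (k : ℕ) (P : PiProc) : Expr S :=
  .bind (.take (.var k)) (.lam (tauAux (s + 1) (fun z => r z + 1) P))

/-- The allocation of a channel with the MVar `m`. -/
def bindCode (s : ℕ) (r : ℕ → ℕ) (m : ℕ) (P : PiProc) : Expr S :=
  .letrec 1 (fun _ => .chan (.var (m + 1))) (tauAux (s + 1) (consName 0 (fun z => r z + 1)) P)

/-- The same, before the MVar `m` is emptied. -/
def clearCode (s : ℕ) (r : ℕ → ℕ) (m : ℕ) (P : PiProc) : Expr S :=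
  .bind (.take (.var m)) (.lam (bindCode (s + 1) (fun z => r z + 1) (m + 1) P))

/-- The body of the loop `f` of a replication. -/
def loopCode (s : ℕ) (r : ℕ → ℕ) (f : ℕ) (P : PiProc) : Expr S :=
  .bind (.fork (tauAux s r P)) (.lam (.var (f + 1)))

section Subst

variable {s s' : ℕ} {r r' h : ℕ → ℕ} {σ : ℕ → Expr S}

theorem upSubst_var {n x x' : ℕ} (hx : σ x = .var x') :
    Expr.upSubst n σ (x + n) = .var (x' + n) := by
  rw [Expr.upSubst_add, hx]
  rfl

theorem upSubst_consName {n a : ℕ} (ha : a < n) (hr : ∀ x, σ (r x) = .var (r' (h x))) (x : ℕ) :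
    Expr.upSubst n σ (consName a (fun z => r z + n) x) =
      .var (consName a (fun z => r' z + n) (upRen 1 h x)) := by
  rcases x with _ | x
  · exact Expr.upSubst_lt _ ha
  · exact upSubst_var (hr x)

theorem ackCode_subst {k k' : ℕ} (P : PiProc) (hs : σ s = .var s')
    (hr : ∀ x, σ (r x) = .var (r' (h x))) (hk : σ k = .var k') :
    (ackCode s r k P).subst σ = ackCode s' r' k' (P.rename h) := by
  simp only [ackCode, Expr.subst, hk, Expr.subst_unit,
    tauAux_subst (r' := fun z => r' z + 1) (h := h) P (upSubst_var hs) fun x => upSubst_var (hr x)]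

theorem takeCode_subst {k k' : ℕ} (P : PiProc) (hs : σ s = .var s')
    (hr : ∀ x, σ (r x) = .var (r' (h x))) (hk : σ k = .var k') :
    (takeCode s r k P).subst σ = takeCode s' r' k' (P.rename h) := by
  simp only [takeCode, Expr.subst, hk,
    tauAux_subst (r' := fun z => r' z + 1) (h := h) P (upSubst_var hs) fun x => upSubst_var (hr x)]

theorem sendCode_subst {k k' : ℕ} (d : Expr S) (y : ℕ) (P : PiProc) (hs : σ s = .var s')
    (hr : ∀ x, σ (r x) = .var (r' (h x))) (hk : σ k = .var k') :
    (sendCode s r d y k P).subst σ = sendCode s' r' (d.subst σ) (h y) k' (P.rename h) := by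
  have := ackCode_subst (k := k + 1) (h := h) (r' := fun z => r' z + 1) (r := fun z => r z + 1) P
    (upSubst_var (n := 1) hs) (fun x => upSubst_var (n := 1) (hr x)) (upSubst_var (n := 1) hk)
  simp only [sendCode, Expr.subst, Expr.subst_pair, hr, hk]
  exact congrArg (Expr.bind _) (congrArg Expr.lam this)

theorem splitCode_subst (e : Expr S) (P : PiProc) (hs : σ s = .var s')
    (hr : ∀ x, σ (r x) = .var (r' (h x))) :
    (splitCode s r e P).subst σ = splitCode s' r' (e.subst σ) (P.rename (upRen 1 h)) := by
  simp only [splitCode, Expr.subst]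
  congr 1
  funext c
  cases c
  refine congrArg (Expr.bind _) (congrArg Expr.lam ?_)
  apply tauAux_subst (s' := s' + 3) (r' := consName 1 fun z => r' z + 3)
  · exact upSubst_var (upSubst_var (n := 2) hs)
  · rintro (_ | x)
    · rfl
    · exact upSubst_var (upSubst_var (n := 2) (hr x))

theorem recvCode_subst (d : Expr S) (P : PiProc) (hs : σ s = .var s')
    (hr : ∀ x, σ (r x) = .var (r' (h x))) :
    (recvCode s r d P).subst σ = recvCode s' r' (d.subst σ) (P.rename (upRen 1 h)) := by
  simp only [recvCode, Expr.subst,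
    splitCode_subst (r' := fun z => r' z + 1) (h := h) _ P (upSubst_var hs)
      fun x => upSubst_var (hr x)]
  rfl

theorem bindCode_subst {m m' : ℕ} (P : PiProc) (hs : σ s = .var s')
    (hr : ∀ x, σ (r x) = .var (r' (h x))) (hm : σ m = .var m') :
    (bindCode s r m P).subst σ = bindCode s' r' m' (P.rename (upRen 1 h)) := by
  simp only [bindCode, Expr.subst, Expr.subst_chan, upSubst_var hm,
    tauAux_subst (r' := consName 0 fun z => r' z + 1) P (upSubst_var hs)
      (upSubst_consName Nat.one_pos hr)]

theorem clearCode_subst {m m' : ℕ} (P : PiProc) (hs : σ s = .var s')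
    (hr : ∀ x, σ (r x) = .var (r' (h x))) (hm : σ m = .var m') :
    (clearCode s r m P).subst σ = clearCode s' r' m' (P.rename (upRen 1 h)) := by
  simp only [clearCode, Expr.subst, hm,
    bindCode_subst (r' := fun z => r' z + 1) (h := h) P (upSubst_var hs)
      (fun x => upSubst_var (hr x)) (upSubst_var hm)]

theorem loopCode_subst {f f' : ℕ} (P : PiProc) (hs : σ s = .var s')
    (hr : ∀ x, σ (r x) = .var (r' (h x))) (hf : σ f = .var f') :
    (loopCode s r f P).subst σ = loopCode s' r' f' (P.rename h) := by
  simp only [loopCode, Expr.subst, tauAux_subst P hs hr, upSubst_var hf]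

end Subst

/-! ### Continuations of monadic steps -/

/-- The expression `e` is `e₀`, or becomes `e₀` when the monadic operation in front of it, which has
finished, is composed with its continuation. -/
def Pre (e₀ e : Expr S) : Prop :=
  e = e₀ ∨ (∃ b v, e = .bind (.ret v) (.lam b) ∧ b.inst ![v] = e₀) ∨
    ∃ b v, e = .app (.lam b) v ∧ b.inst ![v] = e₀

theorem Pre.refl (e : Expr S) : Pre e e := .inl rfl

theorem Pre.bind {b v e₀ : Expr S} (h : b.inst ![v] = e₀) : Pre e₀ (.bind (.ret v) (.lam b)) :=
  .inr (.inl ⟨b, v, rfl, h⟩)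

theorem Pre.rename {e₀ e : Expr S} (h : Pre e₀ e) (f : ℕ → ℕ) :
    Pre (e₀.rename f) (e.rename f) := by
  have key : ∀ b v : Expr S, ((b.rename (upRen 1 f)).inst ![v.rename f]) =
      (b.inst ![v]).rename f := by
    intro b v
    rw [Expr.rename_inst]
    congr 1
    funext i
    match i with
    | 0 => rfl
  rcases h with rfl | ⟨b, v, rfl, rfl⟩ | ⟨b, v, rfl, rfl⟩
  · exact .inl rfl
  · exact .inr (.inl ⟨_, _, rfl, key b v⟩)
  · exact .inr (.inr ⟨_, _, rfl, key b v⟩)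

theorem Pre.step {e₀ e : Expr S} (h : Pre e₀ e) : e = e₀ ∨ ∃ e', Pre e₀ e' ∧ MRed e (.loc e') := by
  rcases h with rfl | ⟨b, v, rfl, h⟩ | ⟨b, v, rfl, h⟩
  · exact .inl rfl
  · exact .inr ⟨_, .inr (.inr ⟨b, v, rfl, h⟩), .base (.lunit _ _)⟩
  · exact .inr ⟨_, .inl h, .force (.eval (.base (.beta _ _)))⟩

theorem MRed.tStep_loc {e e' : Expr S} (h : MRed e (.loc e')) (b : Bool) (m : Multiset (Comp S)) :
    TStep b e m (.thread b e' ::ₘ m) := ⟨_, h, .loc _ _⟩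

theorem Pre.steps {e₀ e : Expr S} (h : Pre e₀ e) (b : Bool) (m : Multiset (Comp S)) :
    Relation.ReflTransGen DStep (.thread b e ::ₘ m) (.thread b e₀ ::ₘ m) := by
  rcases h with rfl | ⟨c, v, rfl, rfl⟩ | ⟨c, v, rfl, rfl⟩
  · exact .refl
  · refine .head (MRed.tStep_loc (.base (.lunit _ _)) b m).dStep (.single ?_)
    exact (MRed.tStep_loc (.force (.eval (.base (.beta _ _)))) b m).dStep
  · exact .single (MRed.tStep_loc (.force (.eval (.base (.beta _ _)))) b m).dStep

theorem AStep.new' {b : Bool} {v v' e : Expr S} {m : Multiset (Comp S)}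
    (h : v.rename Nat.succ = v') :
    AStep b (.new v e) m (.thread b e ::ₘ .mvar 0 v' ::ₘ ren Nat.succ m) :=
  h ▸ .new v e m

theorem inst_of_forall {e e' v : Expr S}
    (h : e.subst (fun y => Nat.casesOn y v fun x => .var x) = e') : e.inst ![v] = e' := by
  rw [Expr.inst_single, h]

theorem inst_rename_succ (e : Expr S) : (e.rename (upRen 1 (· + 1))).inst ![.var 0] = e := by
  rw [Expr.inst_single, Expr.subst_rename]
  conv_rhs => rw [← Expr.subst_var e]
  congr 1
  funext y
  cases y <;> simp

/-! ### The steps of the threads of a translated process -/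

section Steps

variable {s : ℕ} {r : ℕ → ℕ} {m : Multiset (Comp S)}

theorem tStep_out (x y : ℕ) (P : PiProc) : ∃ e,
    Pre (sendCode (s + 1) (fun z => r z + 1) (.unchan (.var (r x + 1))) y 0 P) e ∧
    TStep false (tauAux s r (.out x y P)) m
      (.thread false e ::ₘ .mvar 0 .unit ::ₘ ren (· + 1) m) :=
  ⟨_, .bind (inst_rename_succ _), _, .bind _ (.base (.new _)), .new' (Expr.rename_unit _)⟩

theorem tStep_send_look (y k : ℕ) (P : PiProc) (z : ℕ) (v : Expr S) :
    TStep false (sendCode s r (.unchan (.var z)) y k P) (.share z v ::ₘ m)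
      (.thread false (sendCode s r (.unchan v) y k P) ::ₘ .share z v ::ₘ m) :=
  ⟨_, .bind _ (.force (.put _ (.case _ _ (.base (.var _))))), .look _ _ _ _⟩

theorem tStep_send_case (y k : ℕ) (P : PiProc) (c : ℕ) :
    TStep false (sendCode s r (.unchan (.chan (.var c))) y k P) m
      (.thread false (sendCode s r (.var c) y k P) ::ₘ m) :=
  ⟨_, .bind _ (.force (.put _ (.base (.case _ _ _)))), .loc _ _⟩

theorem tStep_send_put (y k : ℕ) (P : PiProc) (c : ℕ) : ∃ e, Pre (ackCode s r k P) e ∧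
    TStep false (sendCode s r (.var c) y k P) (.empty c ::ₘ m)
      (.thread false e ::ₘ .mvar c (.pair (.var (r y)) (.var k)) ::ₘ m) := by
  refine ⟨_, .bind (inst_of_forall ?_), _, .bind _ (.base (.put _ _)), .put _ _ _ _⟩
  have := ackCode_subst (S := S) (s := s + 1) (s' := s) (r := fun z => r z + 1) (r' := r) (h := id)
    (k := k + 1) (k' := k) (σ := fun y => Nat.casesOn y .unit fun x => .var x) P rfl
    (fun _ => rfl) rfl
  rwa [PiProc.rename_id] at this

theorem tStep_ack (k : ℕ) (P : PiProc) : ∃ e, Pre (tauAux s r P) e ∧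
    TStep false (ackCode s r k P) (.empty k ::ₘ m) (.thread false e ::ₘ .mvar k .unit ::ₘ m) := by
  refine ⟨_, .bind (inst_of_forall ?_), _, .bind _ (.base (.put _ _)), .put _ _ _ _⟩
  have := tauAux_subst (S := S) (s := s + 1) (s' := s) (r := fun z => r z + 1) (r' := r) (h := id)
    (σ := fun y => Nat.casesOn y .unit fun x => .var x) P rfl (fun _ => rfl)
  rwa [PiProc.rename_id] at this

theorem tStep_recv_look (P : PiProc) (z : ℕ) (v : Expr S) :
    TStep false (recvCode s r (.unchan (.var z)) P) (.share z v ::ₘ m)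
      (.thread false (recvCode s r (.unchan v) P) ::ₘ .share z v ::ₘ m) :=
  ⟨_, .bind _ (.force (.take (.case _ _ (.base (.var _))))), .look _ _ _ _⟩

theorem tStep_recv_case (P : PiProc) (c : ℕ) :
    TStep false (recvCode s r (.unchan (.chan (.var c))) P) m
      (.thread false (recvCode s r (.var c) P) ::ₘ m) :=
  ⟨_, .bind _ (.force (.take (.base (.case _ _ _)))), .loc _ _⟩

theorem tStep_recv_take (P : PiProc) (c : ℕ) (v : Expr S) : ∃ e, Pre (splitCode s r v P) e ∧
    TStep false (recvCode s r (.var c) P) (.mvar c v ::ₘ m)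
      (.thread false e ::ₘ .empty c ::ₘ m) := by
  refine ⟨_, .bind (inst_of_forall ?_), _, .bind _ (.base (.take _)), .take _ _ _ _⟩
  have := splitCode_subst (S := S) (s := s + 1) (s' := s) (r := fun z => r z + 1) (r' := r)
    (h := id) (σ := fun y => Nat.casesOn y v fun x => .var x) (.var 0) P rfl (fun _ => rfl)
  rwa [upRen_id, PiProc.rename_id] at this

theorem tStep_split (y k : ℕ) (P : PiProc) :
    TStep false (splitCode s r (.pair (.var (r y)) (.var k)) P) m
      (.thread false (takeCode s r k (P.rename (instName y))) ::ₘ m) := by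
  have key : Expr.inst ![.var (r y), .var k] (.bind (.take (.var 1)) (.lam
      (tauAux (S := S) (s + 3) (consName 1 (fun z => r z + 3)) P))) =
        takeCode s r k (P.rename (instName y)) := by
    rw [Expr.inst_two]
    refine congrArg (Expr.bind _) (congrArg Expr.lam ?_)
    apply tauAux_subst (s' := s + 1) (r' := fun z => r z + 1)
    · rfl
    · rintro (_ | x) <;> rfl
  rw [← key]
  exact ⟨_, .force (.eval (.base (.case _ _ _))), .loc _ _⟩

theorem tStep_take (k : ℕ) (P : PiProc) (v : Expr S) : ∃ e, Pre (tauAux s r P) e ∧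
    TStep false (takeCode s r k P) (.mvar k v ::ₘ m) (.thread false e ::ₘ .empty k ::ₘ m) := by
  refine ⟨_, .bind (inst_of_forall ?_), _, .bind _ (.base (.take _)), .take _ _ _ _⟩
  have := tauAux_subst (S := S) (s := s + 1) (s' := s) (r := fun z => r z + 1) (r' := r) (h := id)
    (σ := fun y => Nat.casesOn y v fun x => .var x) P rfl (fun _ => rfl)
  rwa [PiProc.rename_id] at this

theorem tStep_par (P Q : PiProc) : ∃ e, Pre (tauAux s r P) e ∧
    TStep false (tauAux s r (.par P Q)) m
      (.thread false e ::ₘ .thread false (tauAux s r Q) ::ₘ m) := by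
  refine ⟨_, .bind (inst_of_forall ?_), _, .bind _ (.base (.fork _)), .fork _ _ _⟩
  have := tauAux_subst (S := S) (s := s + 1) (s' := s) (r := fun z => r z + 1) (r' := r) (h := id)
    (σ := fun y => Nat.casesOn y .unit fun x => .var x) P rfl (fun _ => rfl)
  rwa [PiProc.rename_id] at this

theorem tStep_nu (P : PiProc) : ∃ e, Pre (clearCode (s + 1) (fun z => r z + 1) 0 P) e ∧
    TStep false (tauAux s r (.nu P)) m
      (.thread false e ::ₘ .mvar 0 .bot ::ₘ ren (· + 1) m) :=
  ⟨_, .bind (inst_rename_succ _), _, .bind _ (.base (.new _)), .new' rfl⟩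

theorem tStep_clear (k : ℕ) (P : PiProc) (v : Expr S) : ∃ e, Pre (bindCode s r k P) e ∧
    TStep false (clearCode s r k P) (.mvar k v ::ₘ m) (.thread false e ::ₘ .empty k ::ₘ m) := by
  refine ⟨_, .bind (inst_of_forall ?_), _, .bind _ (.base (.take _)), .take _ _ _ _⟩
  have := bindCode_subst (S := S) (s := s + 1) (s' := s) (r := fun z => r z + 1) (r' := r) (h := id)
    (m := k + 1) (m' := k) (σ := fun y => Nat.casesOn y v fun x => .var x) P rfl (fun _ => rfl) rfl
  rwa [upRen_id, PiProc.rename_id] at this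

theorem tStep_bind (k : ℕ) (P : PiProc) : TStep false (bindCode s r k P) m
    (.thread false (tauAux (s + 1) (consName 0 (fun z => r z + 1)) P) ::ₘ
      .share 0 (.chan (.var (k + 1))) ::ₘ ren (· + 1) m) :=
  ⟨_, .force (.eval (.base (.letrec _ _ _))), .binds _ _ _ _⟩

theorem tStep_bang (P : PiProc) : TStep false (tauAux s r (.bang P)) m
    (.thread false (.var 0) ::ₘ
      .share 0 (loopCode (s + 1) (fun z => r z + 1) 0 P) ::ₘ ren (· + 1) m) :=
  ⟨_, .force (.eval (.base (.letrec _ _ _))), .binds _ _ _ _⟩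

theorem tStep_var (f : ℕ) (v : Expr S) : TStep false (.var f) (.share f v ::ₘ m)
    (.thread false v ::ₘ .share f v ::ₘ m) :=
  ⟨_, .force (.eval (.base (.var _))), .look _ _ _ _⟩

theorem tStep_loop (f : ℕ) (P : PiProc) : ∃ e, Pre (.var f) e ∧
    TStep false (loopCode s r f P) m
      (.thread false e ::ₘ .thread false (tauAux s r P) ::ₘ m) :=
  ⟨_, .bind (inst_of_forall rfl), _, .bind _ (.base (.fork _)), .fork _ _ _⟩

theorem tStep_success (v : Expr S) : TStep false (tauAux s r .success) (.mvar s v ::ₘ m)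
    (.thread false (.ret v) ::ₘ .empty s ::ₘ m) :=
  ⟨_, .base (.take _), .take _ _ _ _⟩

end Steps

/-! ### States of a translated process -/

section Rename

variable {s s' : ℕ} {r r' h f : ℕ → ℕ}

theorem ackCode_rename {k k' : ℕ} (P : PiProc) (hs : f s = s') (hr : ∀ x, f (r x) = r' (h x))
    (hk : f k = k') : (ackCode s r k P : Expr S).rename f = ackCode s' r' k' (P.rename h) := by
  rw [Expr.rename_eq_subst]
  exact ackCode_subst P (congrArg _ hs) (fun x => congrArg _ (hr x)) (congrArg _ hk)

theorem takeCode_rename {k k' : ℕ} (P : PiProc) (hs : f s = s') (hr : ∀ x, f (r x) = r' (h x))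
    (hk : f k = k') : (takeCode s r k P : Expr S).rename f = takeCode s' r' k' (P.rename h) := by
  rw [Expr.rename_eq_subst]
  exact takeCode_subst P (congrArg _ hs) (fun x => congrArg _ (hr x)) (congrArg _ hk)

theorem sendCode_rename {k k' : ℕ} (d : Expr S) (y : ℕ) (P : PiProc) (hs : f s = s')
    (hr : ∀ x, f (r x) = r' (h x)) (hk : f k = k') :
    (sendCode s r d y k P).rename f = sendCode s' r' (d.rename f) (h y) k' (P.rename h) := by
  rw [Expr.rename_eq_subst, Expr.rename_eq_subst]
  exact sendCode_subst d y P (congrArg _ hs) (fun x => congrArg _ (hr x)) (congrArg _ hk)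

theorem splitCode_rename (e : Expr S) (P : PiProc) (hs : f s = s')
    (hr : ∀ x, f (r x) = r' (h x)) :
    (splitCode s r e P).rename f = splitCode s' r' (e.rename f) (P.rename (upRen 1 h)) := by
  rw [Expr.rename_eq_subst, Expr.rename_eq_subst]
  exact splitCode_subst e P (congrArg _ hs) (fun x => congrArg _ (hr x))

theorem recvCode_rename (d : Expr S) (P : PiProc) (hs : f s = s')
    (hr : ∀ x, f (r x) = r' (h x)) :
    (recvCode s r d P).rename f = recvCode s' r' (d.rename f) (P.rename (upRen 1 h)) := by
  rw [Expr.rename_eq_subst, Expr.rename_eq_subst]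
  exact recvCode_subst d P (congrArg _ hs) (fun x => congrArg _ (hr x))

theorem bindCode_rename {k k' : ℕ} (P : PiProc) (hs : f s = s') (hr : ∀ x, f (r x) = r' (h x))
    (hk : f k = k') :
    (bindCode s r k P : Expr S).rename f = bindCode s' r' k' (P.rename (upRen 1 h)) := by
  rw [Expr.rename_eq_subst]
  exact bindCode_subst P (congrArg _ hs) (fun x => congrArg _ (hr x)) (congrArg _ hk)

theorem clearCode_rename {k k' : ℕ} (P : PiProc) (hs : f s = s') (hr : ∀ x, f (r x) = r' (h x))
    (hk : f k = k') :
    (clearCode s r k P : Expr S).rename f = clearCode s' r' k' (P.rename (upRen 1 h)) := by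
  rw [Expr.rename_eq_subst]
  exact clearCode_subst P (congrArg _ hs) (fun x => congrArg _ (hr x)) (congrArg _ hk)

theorem loopCode_rename {k k' : ℕ} (P : PiProc) (hs : f s = s') (hr : ∀ x, f (r x) = r' (h x))
    (hk : f k = k') : (loopCode s r k P : Expr S).rename f = loopCode s' r' k' (P.rename h) := by
  rw [Expr.rename_eq_subst]
  exact loopCode_subst P (congrArg _ hs) (fun x => congrArg _ (hr x)) (congrArg _ hk)

end Rename

/-- The expressions for the MVar of the channel `x` that occur during its evaluation. -/
inductive Target (r c : ℕ → ℕ) (x : ℕ) : Expr S → Prop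
  | name : Target r c x (.unchan (.var (r x)))
  | chan : Target r c x (.unchan (.chan (.var (c x))))
  | mvar : Target r c x (.var (c x))

/-- The components that implement a single process: `Ready s r c C P p`, where `p = 1` if the
process is a sender whose message is already in the MVar of the channel, and `p = 0` otherwise.
The variable of a name `x` is `r x`, its MVar is `c x`, and `s` is the variable `stop`. -/
inductive Ready (s : ℕ) (r c : ℕ → ℕ) : Multiset (Comp S) → PiProc → ℕ → Prop
  | run {P e} : Pre (tauAux s r P) e → Ready s r c (.thread false e ::ₘ 0) P 0
  | send {x y k P d e} : Target r c x d → Pre (sendCode s r d y k P) e →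
      Ready s r c (.thread false e ::ₘ .mvar k .unit ::ₘ 0) (.out x y P) 0
  | recv {x P d e} : Target r c x d → Pre (recvCode s r d P) e →
      Ready s r c (.thread false e ::ₘ 0) (.inp x P) 0
  | clear {k P e} : Pre (clearCode s r k P) e →
      Ready s r c (.thread false e ::ₘ .mvar k .bot ::ₘ 0) (.nu P) 0
  | bind {k P e} : Pre (bindCode s r k P) e →
      Ready s r c (.thread false e ::ₘ .empty k ::ₘ 0) (.nu P) 0
  | jump {f P e} : Pre (.var f) e →
      Ready s r c (.thread false e ::ₘ .share f (loopCode s r f P) ::ₘ 0) (.bang P) 0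
  | loop {f P e} : Pre (loopCode s r f P) e →
      Ready s r c (.thread false e ::ₘ .share f (loopCode s r f P) ::ₘ 0) (.bang P) 0
  | pending {x y k P e} : Pre (ackCode s r k P) e →
      Ready s r c (.thread false e ::ₘ .share (r x) (.chan (.var (c x))) ::ₘ
        .mvar (c x) (.pair (.var (r y)) (.var k)) ::ₘ .mvar k .unit ::ₘ 0) (.out x y P) 1

/-- Groups of components that belong together, and the processes that they implement: besides
those for a single process, a receiver that has got the message of a sender, a sender with a taken
acknowledgement, an MVar that is not used any longer, and a channel whose MVar is empty. -/
inductive IsItem (s : ℕ) (r c : ℕ → ℕ) : Multiset (Comp S) → Multiset PiProc → ℕ → Prop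
  | ready {C P p} : Ready s r c C P p → IsItem s r c C {P} p
  | couple {y k P Q e e'} : Pre (splitCode s r (.pair (.var (r y)) (.var k)) P) e ∨
      Pre (takeCode s r k (P.rename (instName y))) e → Pre (ackCode s r k Q) e' →
      IsItem s r c (.thread false e ::ₘ .thread false e' ::ₘ .mvar k .unit ::ₘ 0)
        {P.rename (instName y), Q} 0
  | acked {k Q e} : Pre (ackCode s r k Q) e →
      IsItem s r c (.thread false e ::ₘ .empty k ::ₘ 0) {Q} 0
  | junk (x v) : IsItem s r c (.mvar x v ::ₘ 0) 0 0
  | idle (x) : IsItem s r c (.share (r x) (.chan (.var (c x))) ::ₘ .empty (c x) ::ₘ 0) 0 0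

section Rename

variable {s s' : ℕ} {r r' c c' h f : ℕ → ℕ}

theorem Target.rename {x : ℕ} {d : Expr S} (hd : Target r c x d) (hr : ∀ x, f (r x) = r' (h x))
    (hc : ∀ x, f (c x) = c' (h x)) : Target r' c' (h x) (d.rename f) := by
  cases hd
  · rw [Expr.rename_unchan, Expr.rename, hr]; exact .name
  · rw [Expr.rename_unchan, Expr.rename_chan, Expr.rename, hc]; exact .chan
  · rw [Expr.rename, hc]; exact .mvar

theorem Ready.rename {C : Multiset (Comp S)} {P : PiProc} {p : ℕ} (hC : Ready s r c C P p)
    (hs : f s = s') (hr : ∀ x, f (r x) = r' (h x)) (hc : ∀ x, f (c x) = c' (h x)) :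
    Ready s' r' c' (ren f C) (P.rename h) p := by
  cases hC with
  | run he =>
    have := he.rename f
    rw [tauAux_rename _ hs hr] at this
    simp only [ren_cons, ren_zero, Comp.rename]
    exact .run this
  | send hd he =>
    have := he.rename f
    rw [sendCode_rename _ _ _ hs hr rfl] at this
    simp only [ren_cons, ren_zero, Comp.rename, Expr.rename_unit]
    exact .send (hd.rename hr hc) this
  | recv hd he =>
    have := he.rename f
    rw [recvCode_rename _ _ hs hr] at this
    simp only [ren_cons, ren_zero, Comp.rename]
    exact .recv (hd.rename hr hc) this
  | clear he =>
    have := he.rename f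
    rw [clearCode_rename _ hs hr rfl] at this
    simp only [ren_cons, ren_zero, Comp.rename, Expr.rename_bot]
    exact .clear this
  | bind he =>
    have := he.rename f
    rw [bindCode_rename _ hs hr rfl] at this
    simp only [ren_cons, ren_zero, Comp.rename]
    exact .bind this
  | jump he =>
    have := he.rename f
    simp only [ren_cons, ren_zero, Comp.rename, loopCode_rename _ hs hr rfl]
    exact .jump this
  | loop he =>
    have := he.rename f
    rw [loopCode_rename _ hs hr rfl] at this
    simp only [ren_cons, ren_zero, Comp.rename, loopCode_rename _ hs hr rfl]
    exact .loop this
  | pending he =>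
    have := he.rename f
    rw [ackCode_rename _ hs hr rfl] at this
    simp only [ren_cons, ren_zero, Comp.rename, Expr.rename_unit, Expr.rename_pair,
      Expr.rename_chan, Expr.rename, hr, hc]
    exact .pending this

theorem IsItem.rename {C : Multiset (Comp S)} {R : Multiset PiProc} {p : ℕ}
    (hC : IsItem s r c C R p) (hs : f s = s') (hr : ∀ x, f (r x) = r' (h x))
    (hc : ∀ x, f (c x) = c' (h x)) : IsItem s' r' c' (ren f C) (R.map (PiProc.rename h)) p := by
  cases hC with
  | ready hC => exact .ready (hC.rename hs hr hc)
  | @couple y k P Q e e' he he' =>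
    have h' := he'.rename f
    rw [ackCode_rename _ hs hr rfl] at h'
    have hy : (P.rename (instName y)).rename h =
        (P.rename (upRen 1 h)).rename (instName (h y)) := by
      rw [PiProc.rename_comp, PiProc.rename_comp, instName_comp_upRen]
    simp only [ren_cons, ren_zero, Comp.rename, Expr.rename_unit, Multiset.insert_eq_cons,
      Multiset.map_cons, Multiset.map_singleton, hy]
    refine .couple (he.imp (fun he => ?_) fun he => ?_) h'
    · have := he.rename f
      rwa [splitCode_rename _ _ hs hr, Expr.rename_pair, Expr.rename, Expr.rename, hr] at this
    · have := he.rename f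
      rwa [takeCode_rename _ hs hr rfl, hy] at this
  | acked he =>
    have := he.rename f
    rw [ackCode_rename _ hs hr rfl] at this
    simp only [ren_cons, ren_zero, Comp.rename, Multiset.map_singleton]
    exact .acked this
  | junk x v => exact .junk _ _
  | idle x =>
    simp only [ren_cons, ren_zero, Comp.rename, Expr.rename_chan, Expr.rename, hr, hc,
      Multiset.map_zero]
    exact .idle _

end Rename

/-- Multisets of components that are made up of such groups. -/
inductive Conf (s : ℕ) (r c : ℕ → ℕ) : Multiset (Comp S) → Multiset PiProc → ℕ → Prop
  | zero : Conf s r c 0 0 0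
  | add {C R p M L q} : IsItem s r c C R p → Conf s r c M L q → Conf s r c (C + M) (R + L) (p + q)

section Conf

variable {s : ℕ} {r c : ℕ → ℕ} {M : Multiset (Comp S)} {L : Multiset PiProc} {q : ℕ}

theorem IsItem.conf (h : IsItem s r c M L q) : Conf s r c M L q := by
  simpa using Conf.add h .zero

theorem Ready.conf {P : PiProc} (h : Ready s r c M P q) : Conf s r c M {P} q :=
  (IsItem.ready h).conf

theorem Conf.append {M' L' q'} (h : Conf s r c M L q) (h' : Conf s r c M' L' q') :
    Conf s r c (M + M') (L + L') (q + q') := by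
  induction h with
  | zero => simpa using h'
  | add h _ ih => rw [add_assoc, add_assoc, add_assoc]; exact .add h ih

theorem Conf.rename {s' : ℕ} {r' c' h f : ℕ → ℕ} (hM : Conf s r c M L q) (hs : f s = s')
    (hr : ∀ x, f (r x) = r' (h x)) (hc : ∀ x, f (c x) = c' (h x)) :
    Conf s' r' c' (ren f M) (L.map (PiProc.rename h)) q := by
  induction hM with
  | zero => exact .zero
  | add h _ ih => rw [ren_add, Multiset.map_add]; exact .add (h.rename hs hr hc) ih

theorem Conf.exists_item_of_comp (h : Conf s r c M L q) {t : Comp S} (ht : t ∈ M) :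
    ∃ C R p M' L' q', IsItem s r c C R p ∧ Conf s r c M' L' q' ∧ t ∈ C ∧ M = C + M' ∧ L = R + L' ∧
      q = p + q' := by
  induction h with
  | zero => simp at ht
  | @add C R p M L q h h' ih =>
    rcases Multiset.mem_add.1 ht with ht | ht
    · exact ⟨_, _, _, _, _, _, h, h', ht, rfl, rfl, rfl⟩
    · obtain ⟨C', R', p', M', L', q', h₁, h₂, h₃, rfl, rfl, rfl⟩ := ih ht
      exact ⟨_, _, _, _, _, _, h₁, .add h h₂, h₃, add_left_comm _ _ _, add_left_comm _ _ _,
        add_left_comm _ _ _⟩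

theorem Conf.exists_item_of_rd (h : Conf s r c M L q) {t : PiProc} (ht : t ∈ L) :
    ∃ C R p M' L' q', IsItem s r c C R p ∧ Conf s r c M' L' q' ∧ t ∈ R ∧ M = C + M' ∧ L = R + L' ∧
      q = p + q' := by
  induction h with
  | zero => simp at ht
  | @add C R p M L q h h' ih =>
    rcases Multiset.mem_add.1 ht with ht | ht
    · exact ⟨_, _, _, _, _, _, h, h', ht, rfl, rfl, rfl⟩
    · obtain ⟨C', R', p', M', L', q', h₁, h₂, h₃, rfl, rfl, rfl⟩ := ih ht
      exact ⟨_, _, _, _, _, _, h₁, .add h h₂, h₃, add_left_comm _ _ _, add_left_comm _ _ _,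
        add_left_comm _ _ _⟩

end Conf

/-- The MVar `stop`, which is full if `b = true`. -/
def stopComp (b : Bool) (s : ℕ) : Comp S := cond b (.mvar s .unit) (.empty s)

/-- `Frame s r c k b C X L q`: the components `X` are the state of a translated process, with the
exception of some groups of components `C`. They implement the processes `L` with names below `k`,
and `q` is the number of the messages that wait in the MVar of a channel. -/
structure Frame (s : ℕ) (r c : ℕ → ℕ) (k : ℕ) (b : Bool) (C X : Multiset (Comp S))
    (L : Multiset PiProc) (q : ℕ) : Prop where
  conf : ∃ e M, X = .thread true e ::ₘ stopComp b s ::ₘ M ∧ Pre (.put (.var s) .unit) e ∧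
    Conf s r c M L q
  inj : Function.Injective r
  below : ∀ P ∈ L, PiProc.Below k P
  chan : ∀ x < k, Comp.share (r x) (.chan (.var (c x))) ∈ C + X

section Frame

variable {s : ℕ} {r c : ℕ → ℕ} {k : ℕ} {b : Bool} {C X D : Multiset (Comp S)}
  {L R : Multiset PiProc} {p q : ℕ}

/-- Components that implement the processes `R` are put into the state. -/
theorem Frame.plug (h : Frame s r c k b (C + D) X L q) (hD : Conf s r c D R p)
    (hR : ∀ P ∈ R, PiProc.Below k P) : Frame s r c k b C (D + X) (R + L) (p + q) := by
  obtain ⟨⟨e, M, rfl, he, hM⟩, h₂, h₃, h₄⟩ := h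
  refine ⟨⟨e, D + M, by simp, he, hD.append hM⟩, h₂, ?_, by simpa only [add_assoc] using h₄⟩
  intro P hP
  rcases Multiset.mem_add.1 hP with hP | hP
  exacts [hR P hP, h₃ P hP]

theorem Frame.plug_zero (h : Frame s r c k b D X L q) (hD : Conf s r c D R p)
    (hR : ∀ P ∈ R, PiProc.Below k P) : Frame s r c k b 0 (D + X) (R + L) (p + q) :=
  Frame.plug (by rwa [zero_add]) hD hR

/-- The group of components to which a component belongs is taken out of the state. -/
theorem Frame.split_comp (h : Frame s r c k b C X L q) {t : Comp S} (ht : t ∈ X)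
    (h₁ : t.isMain = false) (h₂ : ∀ b', t ≠ stopComp b' s) :
    ∃ D X' R L' p q', X = D + X' ∧ L = R + L' ∧ q = p + q' ∧ t ∈ D ∧ IsItem s r c D R p ∧
      (∀ P ∈ R, PiProc.Below k P) ∧ Frame s r c k b (C + D) X' L' q' := by
  obtain ⟨⟨e, M, rfl, he, hM⟩, h₃, h₄, h₅⟩ := h
  have ht : t ∈ M := by
    rcases Multiset.mem_cons.1 ht with rfl | ht
    · simp at h₁
    · exact (Multiset.mem_cons.1 ht).resolve_left (h₂ _)
  obtain ⟨D, R, p, M', L', q', h₆, h₇, h₈, rfl, rfl, rfl⟩ := hM.exists_item_of_comp ht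
  refine ⟨D, .thread true e ::ₘ stopComp b s ::ₘ M', R, L', p, q', by simp, rfl, rfl, h₈, h₆,
    fun P hP => h₄ P (by simp [hP]), ⟨e, M', rfl, he, h₇⟩, h₃, fun P hP => h₄ P (by simp [hP]), ?_⟩
  intro x hx
  have := h₅ x hx
  simp only [Multiset.mem_add, Multiset.mem_cons] at this ⊢
  tauto

/-- The group of components that implements a given process is taken out of the state. -/
theorem Frame.split_rd (h : Frame s r c k b C X L q) {t : PiProc} (ht : t ∈ L) :
    ∃ D X' R L' p q', X = D + X' ∧ L = R + L' ∧ q = p + q' ∧ t ∈ R ∧ IsItem s r c D R p ∧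
      (∀ P ∈ R, PiProc.Below k P) ∧ Frame s r c k b (C + D) X' L' q' := by
  obtain ⟨⟨e, M, rfl, he, hM⟩, h₃, h₄, h₅⟩ := h
  obtain ⟨D, R, p, M', L', q', h₆, h₇, h₈, rfl, rfl, rfl⟩ := hM.exists_item_of_rd ht
  refine ⟨D, .thread true e ::ₘ stopComp b s ::ₘ M', R, L', p, q', by simp, rfl, rfl, h₈, h₆,
    fun P hP => h₄ P (by simp [hP]), ⟨e, M', rfl, he, h₇⟩, h₃, fun P hP => h₄ P (by simp [hP]), ?_⟩
  intro x hx
  have := h₅ x hx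
  simp only [Multiset.mem_add, Multiset.mem_cons] at this ⊢
  tauto

/-- The components that are missing from the state matter only for the bindings of the channels.
-/
theorem Frame.change (h : Frame s r c k b C X L q)
    (hC : ∀ x v, Comp.share x v ∈ C → Comp.share x v ∈ D) : Frame s r c k b D X L q := by
  obtain ⟨h₁, h₂, h₃, h₄⟩ := h
  refine ⟨h₁, h₂, h₃, fun x hx => ?_⟩
  rcases Multiset.mem_add.1 (h₄ x hx) with h | h
  · exact Multiset.mem_add.2 (.inl (hC _ _ h))
  · exact Multiset.mem_add.2 (.inr h)

theorem Frame.mem_chan (h : Frame s r c k b C X L q) (hC : ∀ x v, Comp.share x v ∉ C) {x : ℕ}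
    (hx : x < k) : Comp.share (r x) (.chan (.var (c x))) ∈ X :=
  (Multiset.mem_add.1 (h.chan x hx)).resolve_left (hC _ _)

theorem stopComp_rename (f : ℕ → ℕ) :
    (stopComp b s : Comp S).rename f = stopComp b (f s) := by
  cases b <;> simp [stopComp, Comp.rename]

theorem Frame.rename (h : Frame s r c k b C X L q) {s' k' : ℕ} {r' c' g f : ℕ → ℕ} (hs : f s = s')
    (hr : ∀ x, f (r x) = r' (g x)) (hc : ∀ x, f (c x) = c' (g x))
    (hr' : Function.Injective r') (hg : ∀ x < k, g x < k')
    (hD : ∀ x < k', Comp.share (r' x) (.chan (.var (c' x))) ∈ D + ren f X) :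
    Frame s' r' c' k' b D (ren f X) (L.map (PiProc.rename g)) q := by
  obtain ⟨⟨e, M, rfl, he, hM⟩, h₃, h₄, h₅⟩ := h
  refine ⟨⟨e.rename f, ren f M, ?_, ?_, hM.rename hs hr hc⟩, hr', ?_, hD⟩
  · simp only [ren_cons, stopComp_rename, hs]
    rfl
  · have := he.rename f
    rwa [Expr.rename, Expr.rename_unit, Expr.rename, hs] at this
  · intro P hP
    obtain ⟨Q, hQ, rfl⟩ := Multiset.mem_map.1 hP
    exact (h₄ Q hQ).rename hg

theorem chan_mem_ren (f : ℕ → ℕ) {x y : ℕ} (h : Comp.share x (.chan (.var y)) ∈ X) :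
    Comp.share (f x) (.chan (.var (f y))) ∈ ren f X := by
  have := Multiset.mem_map_of_mem (Comp.rename f) h
  rwa [Comp.rename, Expr.rename_chan, Expr.rename] at this

/-- The frame after the allocation of a variable. -/
theorem Frame.alloc (h : Frame s r c k b C X L q) (hC : ∀ x v, Comp.share x v ∉ C)
    (D : Multiset (Comp S)) : Frame (s + 1) (fun z => r z + 1) (fun z => c z + 1) k b D
      (ren (· + 1) X) L q := by
  have := h.rename (D := D) (g := id) (f := (· + 1)) (s' := s + 1) (r' := fun z => r z + 1)
    (c' := fun z => c z + 1) (k' := k) rfl (fun _ => rfl) (fun _ => rfl)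
    (fun x y e => h.inj (Nat.succ.inj e)) (fun _ h => h) fun x hx => Multiset.mem_add.2
      (.inr (chan_mem_ren _ (h.mem_chan hC hx)))
  have e : PiProc.rename id = id := funext PiProc.rename_id
  rwa [e, Multiset.map_id] at this

/-- The frame after the allocation of a channel with the MVar `m`. -/
theorem Frame.alloc_chan (h : Frame s r c k b C X L q) (hC : ∀ x v, Comp.share x v ∉ C) {m : ℕ}
    (hD : Comp.share 0 (.chan (.var (m + 1))) ∈ D) :
    Frame (s + 1) (consName 0 fun z => r z + 1) (consName (m + 1) fun z => c z + 1) (k + 1) b D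
      (ren (· + 1) X) (L.map (PiProc.rename Nat.succ)) q := by
  refine h.rename rfl (fun _ => rfl) (fun _ => rfl) ?_ (fun _ h => Nat.succ_lt_succ h) ?_
  · rintro (_ | x) (_ | y) e
    · rfl
    · simp [consName] at e
    · simp [consName] at e
    · simpa [consName, h.inj.eq_iff] using e
  · rintro (_ | x) hx
    · exact Multiset.mem_add.2 (.inl hD)
    · exact Multiset.mem_add.2 (.inr
        (chan_mem_ren (· + 1) (h.mem_chan hC (Nat.lt_of_succ_lt_succ hx))))

/-- The group of components that contains the MVar of a channel. -/
theorem Frame.split_chan (h : Frame s r c k b C X L q) (hC : ∀ x v, Comp.share x v ∉ C) {x : ℕ}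
    (hx : x < k) :
    (∃ X', X = .share (r x) (.chan (.var (c x))) ::ₘ .empty (c x) ::ₘ X' ∧
      Frame s r c k b (C + .share (r x) (.chan (.var (c x))) ::ₘ .empty (c x) ::ₘ 0) X' L q) ∨
    ∃ X' y l Q e L' q', Pre (ackCode s r l Q) e ∧ X = .thread false e ::ₘ
      .share (r x) (.chan (.var (c x))) ::ₘ .mvar (c x) (.pair (.var (r y)) (.var l)) ::ₘ
        .mvar l .unit ::ₘ X' ∧ L = .out x y Q ::ₘ L' ∧ q = 1 + q' ∧
        Frame s r c k b (C + .thread false e ::ₘ .share (r x) (.chan (.var (c x))) ::ₘ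
          .mvar (c x) (.pair (.var (r y)) (.var l)) ::ₘ .mvar l .unit ::ₘ 0) X' L' q' := by
  obtain ⟨D, X', R, L', p, q', rfl, rfl, rfl, ht, hD, -, hX⟩ := h.split_comp (h.mem_chan hC hx) rfl
    (by intro b'; cases b' <;> simp [stopComp])
  cases hD with
  | junk => simp at ht
  | couple => simp at ht
  | acked => simp at ht
  | idle x' =>
    have e : x' = x := h.inj (by simp at ht; exact ht.1.symm)
    subst e
    exact .inl ⟨X', by simp, by simpa using hX⟩
  | ready hD =>
    cases hD with
    | run => simp at ht
    | send => simp at ht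
    | recv => simp at ht
    | clear => simp at ht
    | bind => simp at ht
    | jump => simp [loopCode, Expr.chan] at ht
    | loop => simp [loopCode, Expr.chan] at ht
    | pending he =>
      rename_i x' y l Q e
      have e' : x' = x := h.inj (by simp at ht; exact ht.1.symm)
      subst e'
      exact .inr ⟨X', y, l, Q, e, L', q', he, by simp, by simp, rfl, hX⟩

end Frame

/-- The components `m` are a state of the translation of `νx₁…xₖ.(P₁ | … | Pₙ)`, where the `Pᵢ`
are the elements of `L`. -/
def Run (k : ℕ) (L : Multiset PiProc) (q : ℕ) (b : Bool) (m : Multiset (Comp S)) : Prop :=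
  ∃ s r c, Frame s r c k b 0 m L q

/-! ### Steps of the translation are simulated by the process -/

theorem TStep.of_eq {b : Bool} {e : Expr S} {m₁ m₁' m m' : Multiset (Comp S)}
    (h : TStep b e m₁ m₁') (hm : m = m₁) (hm' : m' = m₁') : TStep b e m m' := by
  rwa [hm, hm']

theorem TStep.not_full {b : Bool} {e u e' v : Expr S} {x : ℕ} {m m' : Multiset (Comp S)}
    (h : TStep b e m m') (hm : (intros m).Nodup) (he : MRed e (.put x u e'))
    (hx : Comp.mvar x v ∈ m) : False := by
  obtain ⟨a, ha, h⟩ := h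
  rcases he.det ha with rfl | ⟨y, ⟨hy, -⟩ | ⟨hy, hy'⟩⟩
  · cases h with
    | put => cases eq_of_intro hm hx (Multiset.mem_cons_self _ _) rfl rfl
  · cases hy
  · cases hy
    obtain ⟨w, hw⟩ := h.exists_looks hy'
    cases eq_of_intro hm hx hw rfl rfl

theorem TStep.not_empty {b : Bool} {e : Expr S} {K : Expr S → Expr S} {x : ℕ}
    {m m' : Multiset (Comp S)} (h : TStep b e m m') (hm : (intros m).Nodup)
    (he : MRed e (.take x K)) (hx : Comp.empty x ∈ m) : False := by
  obtain ⟨a, ha, h⟩ := h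
  rcases he.det ha with rfl | ⟨y, ⟨hy, -⟩ | ⟨hy, hy'⟩⟩
  · cases h with
    | take => cases eq_of_intro hm hx (Multiset.mem_cons_self _ _) rfl rfl
  · cases hy
  · cases hy
    obtain ⟨w, hw⟩ := h.exists_looks hy'
    cases eq_of_intro hm hx hw rfl rfl

theorem TStep.not_ret {b : Bool} {e : Expr S} {m m' : Multiset (Comp S)}
    (h : TStep b (.ret e) m m') : False := by
  obtain ⟨a, ha, -⟩ := h
  cases ha with
  | force h => cases h with | eval h => cases h with | base h => cases h
  | base h => cases h

/-- The possible results of a step of the state of a translated process: the state implements the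
same process, or a reduct of this process, or the process is successful and `stop` has been emptied,
or the main thread has finished, which is possible only if `stop` is empty. -/
inductive BackRes (k : ℕ) (L : Multiset PiProc) (b : Bool) (m : Multiset (Comp S)) : Prop
  | same {k' L' q} : Run k' L' q b m → PiProc.rd k' L' = PiProc.rd k L → BackRes k L b m
  | com {x z A B L₀ q} : Run k (A.rename (instName z) ::ₘ B ::ₘ L₀) q b m →
      L = .inp x A ::ₘ .out x z B ::ₘ L₀ → BackRes k L b m
  | emptied {k' L' q} : b = true → .success ∈ L → Run k' L' q false m → BackRes k L b m
  | ret : b = false → HasRet m → BackRes k L b m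

section Back

variable {s : ℕ} {r c : ℕ → ℕ} {k : ℕ} {b : Bool} {D D' X Y m₀ m' : Multiset (Comp S)}
  {L R R' : Multiset PiProc} {p' q : ℕ} {e : Expr S}

/-- A thread of the group `D` makes a step without allocation, which turns `D` into `D'`. Threads
are deterministic, so it is enough to know one step. -/
theorem Frame.back_local (h : Frame s r c k b D X L q) (hm : (intros m₀).Nodup)
    (he : D + X = .thread false e ::ₘ m₀) (hs : TStep false e m₀ m')
    (hD : D = .thread false e ::ₘ Y) (hY : TStep false e (Y + X) (D' + X))
    (hD' : Conf s r c D' R' p') (hR : ∀ P ∈ R', PiProc.Below k P)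
    (hC : ∀ x v, Comp.share x v ∈ D → Comp.share x v ∈ D')
    (hr : PiProc.rd k (R' + L) = PiProc.rd k (R + L)) : BackRes k (R + L) b m' := by
  subst hD
  rw [Multiset.cons_add, Multiset.cons_inj_right] at he
  subst he
  rw [hs.det hm hY]
  exact .same ⟨s, r, c, (h.change hC).plug_zero hD' hR⟩ hr

/-- A thread makes a step that allocates one variable, by which all other variables are shifted.
-/
theorem Frame.back_alloc (h : Frame s r c k b D X L q) (hm : (intros m₀).Nodup)
    (he : D + X = .thread false e ::ₘ m₀) (hs : TStep false e m₀ m')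
    (hD : D = .thread false e ::ₘ 0) (hY : TStep false e X (D' + ren (· + 1) X))
    (hD' : Conf (s + 1) (fun z => r z + 1) (fun z => c z + 1) D' R p')
    (hR : ∀ P ∈ R, PiProc.Below k P) : BackRes k (R + L) b m' := by
  subst hD
  rw [Multiset.cons_add, Multiset.cons_inj_right, zero_add] at he
  subst he
  rw [hs.det hm hY]
  exact .same ⟨_, _, _, (h.alloc (by simp) D').plug_zero hD' hR⟩ rfl

/-- A step of the thread that runs `τ(P)`. -/
theorem Frame.back_run {P : PiProc} (h : Frame s r c k b (.thread false (tauAux s r P) ::ₘ 0) X L q)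
    (hm : (intros X).Nodup) (hs : TStep false (tauAux s r P) X m') (hP : PiProc.Below k P) :
    BackRes k ({P} + L) b m' := by
  have he : (Comp.thread false (tauAux s r P) ::ₘ 0 : Multiset (Comp S)) + X =
      .thread false (tauAux s r P) ::ₘ X := by simp
  have hP' : ∀ Q ∈ ({P} : Multiset PiProc), PiProc.Below k Q := by simpa using hP
  cases P with
  | zero => exact hs.not_ret.elim
  | success =>
    obtain ⟨⟨e, M, rfl, he', hM⟩, h₂, h₃, h₄⟩ := h
    cases b with
    | false => exact (hs.not_empty hm (.base (.take _)) (by simp [stopComp])).elim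
    | true =>
      rw [show (Comp.thread true e ::ₘ stopComp true s ::ₘ M : Multiset (Comp S)) =
        .mvar s .unit ::ₘ .thread true e ::ₘ M from Multiset.cons_swap _ _ _] at hs hm
      rw [hs.det hm (tStep_success _)]
      refine .emptied (k' := k) (L' := {.zero} + L) (q := 0 + q) rfl (by simp) ⟨s, r, c, ?_⟩
      have : Frame s r c k false (.thread false (tauAux s r .success) ::ₘ 0)
          (.thread true e ::ₘ .empty s ::ₘ M) L q := ⟨⟨e, M, rfl, he', hM⟩, h₂, h₃, fun x hx => by
        have := h₄ x hx
        simp only [Multiset.mem_add, Multiset.mem_cons, stopComp, cond] at this ⊢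
        simpa using this⟩
      have := (this.change (D := .thread false (tauAux s r .zero) ::ₘ 0) (by simp)).plug_zero
        (Ready.run (.refl _)).conf (by simp [PiProc.Below])
      convert this using 1
      rw [Multiset.cons_add, zero_add, Multiset.cons_swap (Comp.empty s)]
      rfl
  | out x y P =>
    obtain ⟨e, he', hT⟩ := tStep_out (S := S) (s := s) (r := r) (m := X) x y P
    refine h.back_alloc hm he hs rfl (D' := .thread false e ::ₘ .mvar 0 .unit ::ₘ 0)
      (by simpa only [Multiset.cons_add, zero_add] using hT)
      (Ready.send (x := x) .name he').conf hP'
  | inp x P =>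
    have hx := h.mem_chan (by simp) hP.1
    obtain ⟨X', rfl⟩ := Multiset.exists_cons_of_mem hx
    refine h.back_local hm he hs rfl (D' := .thread false (recvCode s r _ P) ::ₘ 0)
      ((tStep_recv_look (s := s) (r := r) P (r x) _).of_eq (zero_add _)
        (by simp only [Multiset.cons_add, zero_add]))
      (Ready.recv .chan (.refl _)).conf hP' (by simp) rfl
  | par P Q =>
    obtain ⟨e, he', hT⟩ := tStep_par (S := S) (s := s) (r := r) (m := X) P Q
    refine h.back_local hm he hs rfl
      (D' := .thread false e ::ₘ .thread false (tauAux s r Q) ::ₘ 0)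
      (by simpa only [Multiset.cons_add, zero_add] using hT)
      (by simpa using (Ready.run he').conf.append (Ready.run (.refl (tauAux s r Q))).conf)
      (by simpa using And.intro hP.1 hP.2) (by simp) (PiProc.rd_congr ?_)
    simp [PiProc.cl_par, add_assoc]
  | nu P =>
    obtain ⟨e, he', hT⟩ := tStep_nu (S := S) (s := s) (r := r) (m := X) P
    refine h.back_alloc hm he hs rfl (D' := .thread false e ::ₘ .mvar 0 .bot ::ₘ 0)
      (by simpa only [Multiset.cons_add, zero_add] using hT) (Ready.clear he').conf hP'
  | bang P =>
    refine h.back_alloc hm he hs rfl (D' := .thread false (.var 0) ::ₘ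
      .share 0 (loopCode (s + 1) (fun z => r z + 1) 0 P) ::ₘ 0)
      (by simpa only [Multiset.cons_add, zero_add] using tStep_bang (s := s) (r := r) P)
      (Ready.jump (.refl _)).conf hP'

/-- A step of the thread of a group of components that implements a single process. -/
theorem Frame.back_ready {P : PiProc} {p : ℕ} (h : Frame s r c k b D X L q)
    (hD : Ready s r c D P p) (hm : (intros m₀).Nodup) (he : D + X = .thread false e ::ₘ m₀)
    (hs : TStep false e m₀ m') (heD : .thread false e ∈ D) (hP : PiProc.Below k P) :
    BackRes k ({P} + L) b m' := by
  have hP' : ∀ Q ∈ ({P} : Multiset PiProc), PiProc.Below k Q := by simpa using hP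
  cases hD with
  | @run P e' hpre =>
    obtain rfl : e = e' := by simpa using heD
    rcases hpre.step with rfl | ⟨e', he', hl⟩
    · rw [Multiset.cons_add, zero_add, Multiset.cons_inj_right] at he
      subst he
      exact h.back_run hm hs hP
    · exact h.back_local hm he hs rfl (D' := .thread false e' ::ₘ 0)
        (by simpa only [Multiset.cons_add, zero_add] using hl.tStep_loc _ _)
        (Ready.run he').conf hP' (by simp) rfl
  | @send x y l P d e' hd hpre =>
    obtain rfl : e = e' := by simpa using heD
    rcases hpre.step with rfl | ⟨e', he', hl⟩
    · cases hd with
      | name =>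
        have hx := h.mem_chan (by simp) hP.1
        obtain ⟨X', rfl⟩ := Multiset.exists_cons_of_mem hx
        refine h.back_local hm he hs rfl
          (D' := .thread false (sendCode s r _ y l P) ::ₘ .mvar l .unit ::ₘ 0)
          ((tStep_send_look (m := .mvar l .unit ::ₘ X') y l P (r x) (.chan (.var (c x)))).of_eq
            ?_ ?_)
          (Ready.send .chan (.refl _)).conf hP' (by simp) rfl
        all_goals simp only [← Multiset.singleton_add]; abel
      | chan =>
        refine h.back_local hm he hs rfl
          (D' := .thread false (sendCode s r _ y l P) ::ₘ .mvar l .unit ::ₘ 0) ?_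
          (Ready.send .mvar (.refl _)).conf hP' (by simp) rfl
        simpa only [Multiset.cons_add, zero_add] using tStep_send_case y l P (c x)
      | mvar =>
        rw [Multiset.cons_add, Multiset.cons_inj_right] at he
        subst he
        rcases h.split_chan (by simp) hP.1 with ⟨X', rfl, hX⟩ | ⟨X', _, _, _, _, _, _, -, rfl, -⟩
        · obtain ⟨e', he', hT⟩ := tStep_send_put (S := S) (s := s) (r := r)
            (m := .share (r x) (.chan (.var (c x))) ::ₘ .mvar l .unit ::ₘ X') y l P (c x)
          rw [hs.det hm (hT.of_eq (by simp only [← Multiset.singleton_add]; abel) rfl)]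
          refine .same (k' := k) (L' := {.out x y P} + L) (q := 1 + q) ⟨s, r, c, ?_⟩ rfl
          have := (hX.change (D := .thread false e' ::ₘ .share (r x) (.chan (.var (c x))) ::ₘ
            .mvar (c x) (.pair (.var (r y)) (.var l)) ::ₘ .mvar l .unit ::ₘ 0) (by simp)).plug_zero
              (Ready.pending he').conf hP'
          convert this using 1
          simp only [← Multiset.singleton_add]; abel
        · exact (hs.not_full hm (.bind _ (.base (.put _ _)))
            (v := .pair _ _) (by simp; tauto)).elim
    · exact h.back_local hm he hs rfl (D' := .thread false e' ::ₘ .mvar l .unit ::ₘ 0)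
        (by simpa only [Multiset.cons_add, zero_add] using hl.tStep_loc _ _)
        (Ready.send hd he').conf hP' (by simp) rfl
  | @recv x P d e' hd hpre =>
    obtain rfl : e = e' := by simpa using heD
    rcases hpre.step with rfl | ⟨e', he', hl⟩
    · cases hd with
      | name =>
        rw [Multiset.cons_add, zero_add, Multiset.cons_inj_right] at he
        subst he
        exact Frame.back_run (P := .inp x P) h hm hs hP
      | chan =>
        refine h.back_local hm he hs rfl
          (D' := .thread false (recvCode s r _ P) ::ₘ 0) ?_
          (Ready.recv .mvar (.refl _)).conf hP' (by simp) rfl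
        simpa only [Multiset.cons_add, zero_add] using tStep_recv_case P (c x)
      | mvar =>
        rw [Multiset.cons_add, zero_add, Multiset.cons_inj_right] at he
        subst he
        rcases h.split_chan (by simp) hP.1 with ⟨X', rfl, hX⟩ |
          ⟨X', y, l, Q, e, L', q', hpre', rfl, rfl, rfl, hX⟩
        · exact (hs.not_empty hm (.bind _ (.base (.take _))) (by simp)).elim
        · obtain ⟨e', he', hT⟩ := tStep_recv_take (S := S) (s := s) (r := r)
            (m := .thread false e ::ₘ .share (r x) (.chan (.var (c x))) ::ₘ .mvar l .unit ::ₘ X')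
            P (c x) (.pair (.var (r y)) (.var l))
          rw [hs.det hm (hT.of_eq (by simp only [← Multiset.singleton_add]; abel) rfl)]
          have hb : PiProc.Below k (.out x y Q) := h.below _ (by simp)
          refine .com (q := 0 + 0 + q') (x := x) (z := y) (A := P) (B := Q) (L₀ := L')
            ⟨s, r, c, ?_⟩ (Multiset.singleton_add _ _)
          have := (hX.change (D := (.thread false e' ::ₘ .thread false e ::ₘ .mvar l .unit ::ₘ 0) +
            (.share (r x) (.chan (.var (c x))) ::ₘ .empty (c x) ::ₘ 0)) (by simp)).plug_zero
              ((IsItem.couple (.inl he') hpre').conf.append (IsItem.idle x).conf) (by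
                simp only [Multiset.insert_eq_cons, Multiset.mem_add, Multiset.mem_cons,
                  Multiset.mem_singleton]
                rintro R ((rfl | rfl) | h)
                · refine hP.2.rename fun z hz => ?_
                  rcases z with _ | z
                  · exact hb.2.1
                  · exact Nat.lt_of_succ_lt_succ hz
                · exact hb.2.2
                · simp at h)
          convert this using 1
          · simp only [← Multiset.singleton_add]; abel
          · simp
    · exact h.back_local hm he hs rfl (D' := .thread false e' ::ₘ 0)
        (by simpa only [Multiset.cons_add, zero_add] using hl.tStep_loc _ _)
        (Ready.recv hd he').conf hP' (by simp) rfl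
  | @clear l P e' hpre =>
    obtain rfl : e = e' := by simpa using heD
    rcases hpre.step with rfl | ⟨e', he', hl⟩
    · obtain ⟨e', he', hT⟩ := tStep_clear (S := S) (s := s) (r := r) (m := X) l P .bot
      exact h.back_local hm he hs rfl (D' := .thread false e' ::ₘ .empty l ::ₘ 0)
        (by simpa only [Multiset.cons_add, zero_add] using hT)
        (Ready.bind he').conf hP' (by simp) rfl
    · exact h.back_local hm he hs rfl (D' := .thread false e' ::ₘ .mvar l .bot ::ₘ 0)
        (by simpa only [Multiset.cons_add, zero_add] using hl.tStep_loc _ _)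
        (Ready.clear he').conf hP' (by simp) rfl
  | @bind l P e' hpre =>
    obtain rfl : e = e' := by simpa using heD
    rcases hpre.step with rfl | ⟨e', he', hl⟩
    · rw [Multiset.cons_add, Multiset.cons_inj_right] at he
      subst he
      rw [hs.det hm (tStep_bind l P)]
      refine .same (k' := k + 1) (L' := {P} + L.map (PiProc.rename Nat.succ)) (q := 0 + 0 + q)
        ⟨s + 1, consName 0 fun z => r z + 1, consName (l + 1) fun z => c z + 1, ?_⟩
        (PiProc.rd_nu k P L)
      have hi := IsItem.idle (S := S) (s := s + 1) (r := consName 0 fun z => r z + 1)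
        (c := consName (l + 1) fun z => c z + 1) 0
      have := (h.alloc_chan (by simp) (D := (.thread false _ ::ₘ 0) +
        (.share 0 (.chan (.var (l + 1))) ::ₘ .empty (l + 1) ::ₘ 0)) (by simp)).plug_zero
        ((Ready.run (.refl _)).conf.append hi.conf)
        (by simpa using show PiProc.Below (k + 1) P from hP)
      convert this using 1
      · simp only [Multiset.cons_add, zero_add, ren_cons]
        rfl
      · simp
    · exact h.back_local hm he hs rfl (D' := .thread false e' ::ₘ .empty l ::ₘ 0)
        (by simpa only [Multiset.cons_add, zero_add] using hl.tStep_loc _ _)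
        (Ready.bind he').conf hP' (by simp) rfl
  | @jump l P e' hpre =>
    obtain rfl : e = e' := by simpa using heD
    rcases hpre.step with rfl | ⟨e', he', hl⟩
    · exact h.back_local hm he hs rfl
        (D' := .thread false (loopCode s r l P) ::ₘ .share l (loopCode s r l P) ::ₘ 0)
        (by simpa only [Multiset.cons_add, zero_add] using tStep_var _ _)
        (Ready.loop (.refl _)).conf hP' (by simp) rfl
    · exact h.back_local hm he hs rfl
        (D' := .thread false e' ::ₘ .share l (loopCode s r l P) ::ₘ 0)
        (by simpa only [Multiset.cons_add, zero_add] using hl.tStep_loc _ _)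
        (Ready.jump he').conf hP' (by simp) rfl
  | @loop l P e' hpre =>
    obtain rfl : e = e' := by simpa using heD
    rcases hpre.step with rfl | ⟨e', he', hl⟩
    · obtain ⟨e', he', hT⟩ := tStep_loop (S := S) (s := s) (r := r)
        (m := .share l (loopCode s r l P) ::ₘ X) l P
      refine h.back_local hm he hs rfl
        (D' := (.thread false (tauAux s r P) ::ₘ 0) +
          (.thread false e' ::ₘ .share l (loopCode s r l P) ::ₘ 0)) ?_
        ((Ready.run (.refl _)).conf.append (Ready.jump he').conf)
        (by simpa [PiProc.Below] using hP) (by simp) (PiProc.rd_congr ?_)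
      · exact hT.of_eq (by simp) (by simp only [← Multiset.singleton_add]; abel)
      · simp only [Multiset.map_add, Multiset.map_singleton, Multiset.sum_add,
          Multiset.sum_singleton]
        rw [← PiProc.cl_bang]
    · exact h.back_local hm he hs rfl
        (D' := .thread false e' ::ₘ .share l (loopCode s r l P) ::ₘ 0)
        (by simpa only [Multiset.cons_add, zero_add] using hl.tStep_loc _ _)
        (Ready.loop he').conf hP' (by simp) rfl
  | @pending x y l P e' hpre =>
    obtain rfl : e = e' := by simpa using heD
    rcases hpre.step with rfl | ⟨e', he', hl⟩
    · rw [Multiset.cons_add, Multiset.cons_inj_right] at he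
      subst he
      exact (hs.not_full hm (.bind _ (.base (.put _ _))) (v := .unit) (by simp)).elim
    · exact h.back_local hm he hs rfl
        (D' := .thread false e' ::ₘ .share (r x) (.chan (.var (c x))) ::ₘ
          .mvar (c x) (.pair (.var (r y)) (.var l)) ::ₘ .mvar l .unit ::ₘ 0)
        (by simpa only [Multiset.cons_add, zero_add] using hl.tStep_loc _ _)
        (Ready.pending he').conf hP' (by simp) rfl

/-- The steps of the threads of a group of components. -/
theorem Frame.back_item {p : ℕ} (h : Frame s r c k b D X L q)
    (hD : IsItem s r c D R p) (hm : (intros m₀).Nodup) (he : D + X = .thread false e ::ₘ m₀)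
    (hs : TStep false e m₀ m') (heD : .thread false e ∈ D) (hR : ∀ P ∈ R, PiProc.Below k P) :
    BackRes k (R + L) b m' := by
  cases hD with
  | ready hD => exact h.back_ready hD hm he hs heD (by simpa using hR)
  | @couple y l P Q e₁ e₂ h₁ h₂ =>
    have h12 : (.thread false e₁ ::ₘ .thread false e₂ ::ₘ .mvar l .unit ::ₘ 0 : Multiset (Comp S)) =
      .thread false e₂ ::ₘ .thread false e₁ ::ₘ .mvar l .unit ::ₘ 0 := Multiset.cons_swap _ _ _
    have heD : e = e₁ ∨ e = e₂ := by simpa using heD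
    rcases heD with rfl | rfl
    · rcases h₁ with hpre | hpre
      · rcases hpre.step with rfl | ⟨e', he', hl⟩
        · exact h.back_local hm he hs rfl
            (D' := .thread false (takeCode s r l _) ::ₘ .thread false e₂ ::ₘ .mvar l .unit ::ₘ 0)
            (by simpa only [Multiset.cons_add, zero_add] using tStep_split y l P)
            (IsItem.couple (.inr (.refl _)) h₂).conf hR (by simp) rfl
        · exact h.back_local hm he hs rfl
            (D' := .thread false e' ::ₘ .thread false e₂ ::ₘ .mvar l .unit ::ₘ 0)
            (by simpa only [Multiset.cons_add, zero_add] using hl.tStep_loc _ _)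
            (IsItem.couple (.inl he') h₂).conf hR (by simp) rfl
      · rcases hpre.step with rfl | ⟨e', he', hl⟩
        · obtain ⟨e', he', hT⟩ := tStep_take (S := S) (s := s) (r := r)
            (m := .thread false e₂ ::ₘ X) l (P.rename (instName y)) .unit
          refine h.back_local hm he hs rfl
            (D' := (.thread false e' ::ₘ 0) + (.thread false e₂ ::ₘ .empty l ::ₘ 0)) ?_
            ((Ready.run he').conf.append (IsItem.acked h₂).conf) hR (by simp) rfl
          exact hT.of_eq (by simp only [← Multiset.singleton_add]; abel)
            (by simp only [← Multiset.singleton_add]; abel)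
        · exact h.back_local hm he hs rfl
            (D' := .thread false e' ::ₘ .thread false e₂ ::ₘ .mvar l .unit ::ₘ 0)
            (by simpa only [Multiset.cons_add, zero_add] using hl.tStep_loc _ _)
            (IsItem.couple (.inr he') h₂).conf hR (by simp) rfl
    · rcases h₂.step with rfl | ⟨e', he', hl⟩
      · rw [h12, Multiset.cons_add, Multiset.cons_inj_right] at he
        subst he
        exact (hs.not_full hm (.bind _ (.base (.put _ _))) (v := .unit) (by simp)).elim
      · refine h.back_local hm he hs h12
          (D' := .thread false e₁ ::ₘ .thread false e' ::ₘ .mvar l .unit ::ₘ 0) ?_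
          (IsItem.couple h₁ he').conf hR (by simp) rfl
        exact (hl.tStep_loc _ _).of_eq rfl (by simp only [← Multiset.singleton_add]; abel)
  | @acked l Q e₁ h₁ =>
    obtain rfl : e = e₁ := by simpa using heD
    rcases h₁.step with rfl | ⟨e', he', hl⟩
    · obtain ⟨e', he', hT⟩ := tStep_ack (S := S) (s := s) (r := r) (m := X) l Q
      exact h.back_local hm he hs rfl
        (D' := (.thread false e' ::ₘ 0) + (.mvar l .unit ::ₘ 0))
        (by simpa only [Multiset.cons_add, zero_add] using hT)
        ((Ready.run he').conf.append (IsItem.junk _ _).conf) (by simpa using hR) (by simp) (by simp)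
    · exact h.back_local hm he hs rfl
        (D' := .thread false e' ::ₘ .empty l ::ₘ 0)
        (by simpa only [Multiset.cons_add, zero_add] using hl.tStep_loc _ _)
        (IsItem.acked he').conf hR (by simp) rfl
  | junk => simp at heD
  | idle => simp at heD

end Back

/-- Every step of the state of a translated process is explained by the process. -/
theorem Run.back {k : ℕ} {L : Multiset PiProc} {q : ℕ} {b : Bool} {m m' : Multiset (Comp S)}
    (h : Run k L q b m) (hm : Good m) (hs : DStep m m') : BackRes k L b m' := by
  obtain ⟨s, r, c, h⟩ := h
  rw [dStep_iff] at hs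
  obtain ⟨b', e, m₀, rfl, hs⟩ := hs
  have hN : (intros m₀).Nodup := by simpa only [intros_cons_thread] using hm.1
  cases b' with
  | false =>
    obtain ⟨D, X, R, L', p, q', hX, rfl, rfl, ht, hD, hR, hF⟩ := h.split_comp
      (Multiset.mem_cons_self _ _) rfl (by intro b'; cases b' <;> simp [stopComp])
    rw [zero_add] at hF
    exact hF.back_item hD hN hX.symm hs ht hR
  | true =>
    obtain ⟨⟨e₁, M, hX, he₁, hM⟩, h₂, h₃, h₄⟩ := h
    have key : e = e₁ ∧ m₀ = stopComp b s ::ₘ M := by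
      rcases Multiset.cons_eq_cons.1 hX with ⟨h, h'⟩ | ⟨-, cs, h, -⟩
      · cases h
        exact ⟨rfl, h'⟩
      · subst h
        have := hm.2
        simp [mains_cons] at this
    obtain ⟨rfl, rfl⟩ := key
    rcases he₁.step with rfl | ⟨e', he', hl⟩
    · cases b with
      | true => exact (hs.not_full hN (.base (.put _ _)) (v := .unit) (by simp [stopComp])).elim
      | false =>
        have : TStep true (.put (.var s) .unit) (stopComp false s ::ₘ M)
          (.thread true (.ret .unit) ::ₘ .mvar s .unit ::ₘ M) := ⟨_, .base (.put _ _), .put _ _ _ _⟩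
        rw [hs.det hN this]
        exact .ret rfl ⟨.unit, by simp⟩
    · rw [hs.det hN (hl.tStep_loc _ _)]
      refine .same ⟨s, r, c, ⟨e', M, rfl, he', hM⟩, h₂, h₃, fun x hx => ?_⟩ rfl
      simpa using h₄ x hx

open Relation (ReflTransGen)

/-! ### Reductions of a process are simulated by the translation -/

theorem steps_of_eq {m₁ m₁' m m' : Multiset (Comp S)} (h : ReflTransGen DStep m₁ m₁')
    (hm : m = m₁) (hm' : m' = m₁') : ReflTransGen DStep m m' := by
  rwa [hm, hm']

section Forward

variable {s : ℕ} {r c : ℕ → ℕ} {k : ℕ} {b : Bool} {C D X m : Multiset (Comp S)}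
  {L R : Multiset PiProc} {p q : ℕ} {e e' : Expr S}

/-- A sender that has been acknowledged continues. -/
theorem acked_steps {l : ℕ} {Q : PiProc} (he : Pre (ackCode s r l Q) e) (m : Multiset (Comp S)) :
    ∃ e', Pre (tauAux s r Q) e' ∧ ReflTransGen DStep (.thread false e ::ₘ .empty l ::ₘ m)
      (.thread false e' ::ₘ .mvar l .unit ::ₘ m) := by
  obtain ⟨e', he', hT⟩ := tStep_ack (S := S) (s := s) (r := r) (m := m) l Q
  exact ⟨e', he', (he.steps false _).trans (.single hT.dStep)⟩

/-- A receiver that has got the message of a sender acknowledges it, and both of them continue. -/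
theorem couple_steps {y l : ℕ} {P Q : PiProc}
    (he : Pre (splitCode s r (.pair (.var (r y)) (.var l)) P) e ∨
      Pre (takeCode s r l (P.rename (instName y))) e) (he' : Pre (ackCode s r l Q) e')
    (m : Multiset (Comp S)) :
    ∃ f f', Pre (tauAux s r (P.rename (instName y))) f ∧ Pre (tauAux s r Q) f' ∧
      ReflTransGen DStep (.thread false e ::ₘ .thread false e' ::ₘ .mvar l .unit ::ₘ m)
        (.thread false f ::ₘ .thread false f' ::ₘ .mvar l .unit ::ₘ m) := by
  have h₁ : ∀ m, ReflTransGen DStep (.thread false e ::ₘ m)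
      (.thread false (takeCode s r l (P.rename (instName y))) ::ₘ m) := by
    intro m
    rcases he with he | he
    · exact (he.steps false m).trans (.single (tStep_split y l P).dStep)
    · exact he.steps false m
  obtain ⟨f, hf, hT⟩ := tStep_take (S := S) (s := s) (r := r) (m := .thread false e' ::ₘ m) l
    (P.rename (instName y)) .unit
  obtain ⟨f', hf', hT'⟩ := acked_steps he' (.thread false f ::ₘ m)
  refine ⟨f, f', hf, hf', (h₁ _).trans ?_⟩
  refine (steps_of_eq (.single hT.dStep) ?_ rfl).trans (steps_of_eq hT' ?_ ?_)
  all_goals simp only [← Multiset.singleton_add]; abel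

/-- Every process of a state can be given components of its own. -/
theorem Frame.expose (h : Frame s r c k b C X L q) {Q : PiProc} (hQ : Q ∈ L) :
    ∃ D X' L' p q', ReflTransGen DStep (C + X) (C + (D + X')) ∧ L = Q ::ₘ L' ∧ q = p + q' ∧
      Ready s r c D Q p ∧ PiProc.Below k Q ∧ Frame s r c k b (C + D) X' L' q' := by
  have hb := h.below Q hQ
  obtain ⟨D, X, R, L, p, q, rfl, rfl, rfl, ht, hD, hR, hF⟩ := h.split_rd hQ
  cases hD with
  | ready hD =>
    rw [Multiset.mem_singleton] at ht
    subst ht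
    exact ⟨D, X, L, p, q, .refl, rfl, rfl, hD, hb, hF⟩
  | junk => simp at ht
  | idle => simp at ht
  | @acked l Q' e he =>
    rw [Multiset.mem_singleton] at ht
    subst ht
    obtain ⟨e', he', hS⟩ := acked_steps he (C + X)
    refine ⟨.thread false e' ::ₘ 0, .mvar l .unit ::ₘ 0 + X, 0 + L, 0, 0 + q,
      steps_of_eq hS ?_ ?_, by simp, by simp, .run he', hb,
      (hF.change (D := C + (.thread false e' ::ₘ 0) + (.mvar l .unit ::ₘ 0)) ?_).plug
        (IsItem.junk _ _).conf (by simp)⟩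
    · simp only [← Multiset.singleton_add]; abel
    · simp only [← Multiset.singleton_add]; abel
    · simp
  | @couple y l P Q' e e' he he' =>
    obtain ⟨f, f', hf, hf', hS⟩ := couple_steps he he' (C + X)
    have ht : Q = P.rename (instName y) ∨ Q = Q' := by simpa using ht
    rcases ht with rfl | rfl
    · refine ⟨.thread false f ::ₘ 0, (.thread false f' ::ₘ 0 + .mvar l .unit ::ₘ 0) + X,
        ({Q'} + 0) + L, 0, (0 + 0) + q, steps_of_eq hS ?_ ?_, by simp, by simp, .run hf, hb,
        (hF.change (D := C + (.thread false f ::ₘ 0) +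
          (.thread false f' ::ₘ 0 + .mvar l .unit ::ₘ 0)) ?_).plug
          ((Ready.run hf').conf.append (IsItem.junk _ _).conf) ?_⟩
      · simp only [← Multiset.singleton_add]; abel
      · simp only [← Multiset.singleton_add]; abel
      · simp
      · intro T hT
        exact hR T (by simp at hT; simp [hT])
    · refine ⟨.thread false f' ::ₘ 0, (.thread false f ::ₘ 0 + .mvar l .unit ::ₘ 0) + X,
        ({P.rename (instName y)} + 0) + L, 0, (0 + 0) + q, steps_of_eq hS ?_ ?_, ?_, by simp,
        .run hf', hb, (hF.change (D := C + (.thread false f' ::ₘ 0) +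
          (.thread false f ::ₘ 0 + .mvar l .unit ::ₘ 0)) ?_).plug
          ((Ready.run hf).conf.append (IsItem.junk _ _).conf) ?_⟩
      · simp only [← Multiset.singleton_add]; abel
      · simp only [← Multiset.singleton_add]; abel
      · simp [Multiset.cons_swap]
      · simp
      · intro T hT
        exact hR T (by simp at hT; simp [hT])

/-- The translation performs the unfolding of a parallel composition, by forking. -/
theorem Run.par {A B : PiProc} (h : Run k (.par A B ::ₘ L) q b m) :
    ∃ m', ReflTransGen DStep m m' ∧ Run k (A ::ₘ B ::ₘ L) q b m' := by
  obtain ⟨s, r, c, h⟩ := h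
  obtain ⟨D, X, L', p, q, hS, hL, rfl, hD, hb, hF⟩ := h.expose (Multiset.mem_cons_self _ _)
  rw [Multiset.cons_inj_right] at hL
  subst hL
  simp only [zero_add] at hS hF
  cases hD with
  | @run P e he =>
    obtain ⟨e', he', hT⟩ := tStep_par (S := S) (s := s) (r := r) (m := X) A B
    refine ⟨(.thread false e' ::ₘ 0 + .thread false (tauAux s r B) ::ₘ 0) + X, hS.trans
      (steps_of_eq ((he.steps false X).trans (.single hT.dStep)) (by simp) (by simp)),
      s, r, c, ?_⟩
    have := (hF.change (D := .thread false e' ::ₘ 0 + .thread false (tauAux s r B) ::ₘ 0)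
      (by simp)).plug_zero ((Ready.run he').conf.append (Ready.run (.refl _)).conf)
      (by simpa using And.intro hb.1 hb.2)
    simpa only [add_zero, Multiset.singleton_add, Multiset.cons_add] using this

theorem Frame.nu_of_bind {A : PiProc} {l : ℕ} (hA : PiProc.Below (k + 1) A)
    (he : Pre (bindCode s r l A) e)
    (h : Frame s r c k b (.thread false e ::ₘ .empty l ::ₘ 0) X L q) :
    ∃ m', ReflTransGen DStep (.thread false e ::ₘ .empty l ::ₘ X) m' ∧
      Run (k + 1) (A ::ₘ L.map (PiProc.rename Nat.succ)) q b m' := by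
  refine ⟨_, (he.steps false _).trans (.single (tStep_bind l A).dStep), s + 1,
    consName 0 fun z => r z + 1, consName (l + 1) fun z => c z + 1, ?_⟩
  have hi := IsItem.idle (S := S) (s := s + 1) (r := consName 0 fun z => r z + 1)
    (c := consName (l + 1) fun z => c z + 1) 0
  have := (h.alloc_chan (by simp) (D := (.thread false _ ::ₘ 0) +
    (.share 0 (.chan (.var (l + 1))) ::ₘ .empty (l + 1) ::ₘ 0)) (by simp)).plug_zero
    ((Ready.run (.refl _)).conf.append hi.conf) (by simpa using hA)
  convert this using 1
  · simp only [Multiset.cons_add, zero_add, ren_cons]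
    rfl
  · simp
  · simp

theorem Frame.nu_of_clear {A : PiProc} {l : ℕ} (hA : PiProc.Below (k + 1) A)
    (he : Pre (clearCode s r l A) e)
    (h : Frame s r c k b (.thread false e ::ₘ .mvar l .bot ::ₘ 0) X L q) :
    ∃ m', ReflTransGen DStep (.thread false e ::ₘ .mvar l .bot ::ₘ X) m' ∧
      Run (k + 1) (A ::ₘ L.map (PiProc.rename Nat.succ)) q b m' := by
  obtain ⟨e', he', hT⟩ := tStep_clear (S := S) (s := s) (r := r) (m := X) l A .bot
  obtain ⟨m', h₁, h₂⟩ := Frame.nu_of_bind hA he'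
    (h.change (D := .thread false e' ::ₘ .empty l ::ₘ 0) (by simp))
  exact ⟨m', ((he.steps false _).trans (.single hT.dStep)).trans h₁, h₂⟩

/-- The translation performs the opening of a restriction, by allocating a channel. -/
theorem Run.nu {A : PiProc} (h : Run k (.nu A ::ₘ L) q b m) :
    ∃ m', ReflTransGen DStep m m' ∧
      Run (k + 1) (A ::ₘ L.map (PiProc.rename Nat.succ)) q b m' := by
  obtain ⟨s, r, c, h⟩ := h
  obtain ⟨D, X, L', p, q, hS, hL, rfl, hD, hb, hF⟩ := h.expose (Multiset.mem_cons_self _ _)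
  rw [Multiset.cons_inj_right] at hL
  subst hL
  simp only [zero_add] at hS hF
  cases hD with
  | @run P e he =>
    obtain ⟨e', he', hT⟩ := tStep_nu (S := S) (s := s) (r := r) (m := X) A
    obtain ⟨m', h₁, h₂⟩ := Frame.nu_of_clear hb he'
      (hF.alloc (by simp) (.thread false e' ::ₘ .mvar 0 .bot ::ₘ 0))
    rw [zero_add]
    exact ⟨m', (hS.trans (steps_of_eq ((he.steps false X).trans (.single hT.dStep)) (by simp)
      rfl)).trans h₁, h₂⟩
  | clear he =>
    obtain ⟨m', h₁, h₂⟩ := Frame.nu_of_clear hb he hF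
    rw [zero_add]
    exact ⟨m', hS.trans (steps_of_eq h₁ (by simp) rfl), h₂⟩
  | bind he =>
    obtain ⟨m', h₁, h₂⟩ := Frame.nu_of_bind hb he hF
    rw [zero_add]
    exact ⟨m', hS.trans (steps_of_eq h₁ (by simp) rfl), h₂⟩

theorem Frame.bang_of_loop {A : PiProc} {l : ℕ} (hA : PiProc.Below k A)
    (he : Pre (loopCode s r l A) e)
    (h : Frame s r c k b (.thread false e ::ₘ .share l (loopCode s r l A) ::ₘ 0) X L q) :
    ∃ m', ReflTransGen DStep (.thread false e ::ₘ .share l (loopCode s r l A) ::ₘ X) m' ∧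
      Run k (A ::ₘ .bang A ::ₘ L) q b m' := by
  obtain ⟨e', he', hT⟩ := tStep_loop (S := S) (s := s) (r := r)
    (m := .share l (loopCode s r l A) ::ₘ X) l A
  refine ⟨_, (he.steps false _).trans (.single hT.dStep), s, r, c, ?_⟩
  have := (h.change (D := (.thread false (tauAux s r A) ::ₘ 0) +
    (.thread false e' ::ₘ .share l (loopCode s r l A) ::ₘ 0)) (by simp)).plug_zero
    ((Ready.run (.refl _)).conf.append (Ready.jump he').conf)
    (by simpa [PiProc.Below] using hA)
  convert this using 1
  · simp only [← Multiset.singleton_add]; abel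
  · simp
  · simp

theorem Frame.bang_of_jump {A : PiProc} {l : ℕ} (hA : PiProc.Below k A)
    (he : Pre (.var l) e)
    (h : Frame s r c k b (.thread false e ::ₘ .share l (loopCode s r l A) ::ₘ 0) X L q) :
    ∃ m', ReflTransGen DStep (.thread false e ::ₘ .share l (loopCode s r l A) ::ₘ X) m' ∧
      Run k (A ::ₘ .bang A ::ₘ L) q b m' := by
  obtain ⟨m', h₁, h₂⟩ := Frame.bang_of_loop hA (.refl _)
    (h.change (D := .thread false (loopCode s r l A) ::ₘ .share l (loopCode s r l A) ::ₘ 0)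
      (by simp))
  exact ⟨m', ((he.steps false _).trans (.single (tStep_var _ _).dStep)).trans h₁, h₂⟩

/-- The translation performs the unfolding of a replication, by one round of the loop. -/
theorem Run.bang {A : PiProc} (h : Run k (.bang A ::ₘ L) q b m) :
    ∃ m', ReflTransGen DStep m m' ∧ Run k (A ::ₘ .bang A ::ₘ L) q b m' := by
  obtain ⟨s, r, c, h⟩ := h
  obtain ⟨D, X, L', p, q, hS, hL, rfl, hD, hb, hF⟩ := h.expose (Multiset.mem_cons_self _ _)
  rw [Multiset.cons_inj_right] at hL
  subst hL
  simp only [zero_add] at hS hF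
  cases hD with
  | @run P e he =>
    obtain ⟨m', h₁, h₂⟩ := Frame.bang_of_jump (A := A) hb (.refl _) (hF.alloc (by simp)
      (.thread false (.var 0) ::ₘ .share 0 (loopCode (s + 1) (fun z => r z + 1) 0 A) ::ₘ 0))
    rw [zero_add]
    exact ⟨m', (hS.trans (steps_of_eq ((he.steps false X).trans (.single (tStep_bang A).dStep))
      (by simp) rfl)).trans h₁, h₂⟩
  | jump he =>
    obtain ⟨m', h₁, h₂⟩ := Frame.bang_of_jump (A := A) hb he hF
    rw [zero_add]
    exact ⟨m', hS.trans (steps_of_eq h₁ (by simp) rfl), h₂⟩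
  | loop he =>
    obtain ⟨m', h₁, h₂⟩ := Frame.bang_of_loop (A := A) hb he hF
    rw [zero_add]
    exact ⟨m', hS.trans (steps_of_eq h₁ (by simp) rfl), h₂⟩

/-- If a process has the constant `Stop` as a component, then its translation succeeds. -/
theorem Run.success (h : Run k (.success ::ₘ L) q true m) :
    ∃ m', ReflTransGen DStep m m' ∧ HasRet m' := by
  obtain ⟨s, r, c, h⟩ := h
  obtain ⟨D, X, L', p, q, hS, hL, rfl, hD, hb, hF⟩ := h.expose (Multiset.mem_cons_self _ _)
  simp only [zero_add] at hS hF
  cases hD with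
  | @run P e he =>
    obtain ⟨⟨e₁, M, rfl, he₁, -⟩, -, -, -⟩ := hF
    have h₁ := tStep_success (S := S) (s := s) (r := r) (m := .thread true e₁ ::ₘ M) .unit
    have h₂ := he₁.steps true (.thread false (.ret .unit) ::ₘ .empty s ::ₘ M)
    have h₃ : TStep true (.put (.var s) .unit) (.empty s ::ₘ .thread false (.ret .unit) ::ₘ M)
      (.thread true (.ret .unit) ::ₘ .mvar s .unit ::ₘ .thread false (.ret .unit) ::ₘ M) :=
      ⟨_, .base (.put _ _), .put _ _ _ _⟩
    refine ⟨_, hS.trans ((steps_of_eq (he.steps false (.thread true e₁ ::ₘ stopComp true s ::ₘ M))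
      (by rw [Multiset.cons_add, zero_add]) rfl).trans
      ((steps_of_eq (.single h₁.dStep) ?_ rfl).trans
        ((steps_of_eq h₂ ?_ rfl).trans (steps_of_eq (.single h₃.dStep) ?_ rfl)))), .unit, by simp⟩
    · rw [Multiset.cons_swap (Comp.mvar s .unit)]
      rfl
    · simp only [← Multiset.singleton_add]; abel
    · simp only [← Multiset.singleton_add]; abel

/-- A sender evaluates its channel to the MVar. -/
theorem send_steps {x y l : ℕ} {d : Expr S} {Q : PiProc} (hd : Target r c x d)
    (he : Pre (sendCode s r d y l Q) e)
    (hm : Comp.share (r x) (.chan (.var (c x))) ∈ m) :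
    ReflTransGen DStep (.thread false e ::ₘ m)
      (.thread false (sendCode s r (.var (c x)) y l Q) ::ₘ m) := by
  refine (he.steps false m).trans ?_
  have h₁ := (tStep_send_case (S := S) (s := s) (r := r) (m := m) y l Q (c x)).dStep
  cases hd with
  | name =>
    obtain ⟨m, rfl⟩ := Multiset.exists_cons_of_mem hm
    exact .head (tStep_send_look y l Q (r x) _).dStep (.single h₁)
  | chan => exact .single h₁
  | mvar => exact .refl

/-- A receiver evaluates its channel to the MVar. -/
theorem recv_steps {x : ℕ} {d : Expr S} {Q : PiProc} (hd : Target r c x d)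
    (he : Pre (recvCode s r d Q) e)
    (hm : Comp.share (r x) (.chan (.var (c x))) ∈ m) :
    ReflTransGen DStep (.thread false e ::ₘ m)
      (.thread false (recvCode s r (.var (c x)) Q) ::ₘ m) := by
  refine (he.steps false m).trans ?_
  have h₁ := (tStep_recv_case (S := S) (s := s) (r := r) (m := m) Q (c x)).dStep
  cases hd with
  | name =>
    obtain ⟨m, rfl⟩ := Multiset.exists_cons_of_mem hm
    exact .head (tStep_recv_look Q (r x) _).dStep (.single h₁)
  | chan => exact .single h₁
  | mvar => exact .refl

/-- A sender can be brought to the point where it fills the MVar of the channel, unless it has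
already done this. -/
theorem Run.send {x y : ℕ} {Q : PiProc} (h : Run k (.out x y Q ::ₘ L) q b m) :
    ∃ (s : ℕ) (r c : ℕ → ℕ) (l : ℕ) (X : Multiset (Comp S)),
      (ReflTransGen DStep m
        (.thread false (sendCode s r (.var (c x)) y l Q) ::ₘ .mvar l .unit ::ₘ X) ∧
        Frame s r c k b (.thread false (sendCode s r (.var (c x)) y l Q) ::ₘ .mvar l .unit ::ₘ 0)
          X L q) ∨
      ∃ e q', q = 1 + q' ∧ Pre (ackCode s r l Q) e ∧
        ReflTransGen DStep m (.thread false e ::ₘ .share (r x) (.chan (.var (c x))) ::ₘ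
          .mvar (c x) (.pair (.var (r y)) (.var l)) ::ₘ .mvar l .unit ::ₘ X) ∧
        Frame s r c k b (.thread false e ::ₘ .share (r x) (.chan (.var (c x))) ::ₘ
          .mvar (c x) (.pair (.var (r y)) (.var l)) ::ₘ .mvar l .unit ::ₘ 0) X L q' := by
  obtain ⟨s, r, c, h⟩ := h
  obtain ⟨D, X, L', p, q, hS, hL, rfl, hD, hb, hF⟩ := h.expose (Multiset.mem_cons_self _ _)
  rw [Multiset.cons_inj_right] at hL
  subst hL
  simp only [zero_add] at hS hF
  have key : ∀ {s : ℕ} {r c : ℕ → ℕ} {l : ℕ} {d e : Expr S} {X : Multiset (Comp S)},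
      Target r c x d → Pre (sendCode s r d y l Q) e →
      Frame s r c k b (.thread false e ::ₘ .mvar l .unit ::ₘ 0) X L q →
      ReflTransGen DStep (.thread false e ::ₘ .mvar l .unit ::ₘ X)
        (.thread false (sendCode s r (.var (c x)) y l Q) ::ₘ .mvar l .unit ::ₘ X) ∧
      Frame s r c k b (.thread false (sendCode s r (.var (c x)) y l Q) ::ₘ .mvar l .unit ::ₘ 0)
          X L q := by
    intro s r c l d e X hd he hF
    have hx := hF.mem_chan (by simp) hb.1
    exact ⟨send_steps hd he (Multiset.mem_cons_of_mem hx), hF.change (by simp)⟩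
  cases hD with
  | @run P e he =>
    obtain ⟨e', he', hT⟩ := tStep_out (S := S) (s := s) (r := r) (m := X) x y Q
    obtain ⟨h₁, h₂⟩ := key (c := fun z => c z + 1) (r := fun z => r z + 1) .name he'
      (hF.alloc (by simp) (.thread false e' ::ₘ .mvar 0 .unit ::ₘ 0))
    refine ⟨_, _, _, _, _, .inl ⟨?_, by rw [zero_add]; exact h₂⟩⟩
    exact (hS.trans (steps_of_eq ((he.steps false X).trans (.single hT.dStep)) (by simp)
      rfl)).trans h₁
  | send hd he =>
    obtain ⟨h₁, h₂⟩ := key hd he hF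
    exact ⟨_, _, _, _, _, .inl ⟨hS.trans (steps_of_eq h₁ (by simp) rfl),
      by rw [zero_add]; exact h₂⟩⟩
  | @pending x y l Q e he =>
    exact ⟨s, r, c, l, X, .inr ⟨e, q, rfl, he, by simpa using hS, hF⟩⟩

/-- A receiver takes a message from the MVar of the channel. -/
theorem Frame.deliver {x y l : ℕ} {A Q : PiProc} (he : Pre (ackCode s r l Q) e)
    (hA : PiProc.Below k (.inp x A)) (hQ : PiProc.Below k (.out x y Q))
    (hC : Conf s r c C R p) (hR : ∀ P ∈ R, PiProc.Below k P)
    (h : Frame s r c k b (.thread false (recvCode s r (.var (c x)) A) ::ₘ .thread false e ::ₘ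
      .share (r x) (.chan (.var (c x))) ::ₘ .mvar (c x) (.pair (.var (r y)) (.var l)) ::ₘ
      .mvar l .unit ::ₘ C) X L q) :
    ∃ m', ReflTransGen DStep (.thread false (recvCode s r (.var (c x)) A) ::ₘ .thread false e ::ₘ
      .share (r x) (.chan (.var (c x))) ::ₘ .mvar (c x) (.pair (.var (r y)) (.var l)) ::ₘ
      .mvar l .unit ::ₘ (C + X)) m' ∧
      Run k (A.rename (instName y) ::ₘ Q ::ₘ (R + L)) (p + q) b m' := by
  obtain ⟨e', he', hT⟩ := tStep_recv_take (S := S) (s := s) (r := r)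
    (m := .thread false e ::ₘ .share (r x) (.chan (.var (c x))) ::ₘ .mvar l .unit ::ₘ (C + X))
    A (c x) (.pair (.var (r y)) (.var l))
  refine ⟨_, steps_of_eq (.single hT.dStep) ?_ rfl, s, r, c, ?_⟩
  · simp only [← Multiset.singleton_add]; abel
  have := (h.change (D := (.thread false e' ::ₘ .thread false e ::ₘ .mvar l .unit ::ₘ 0) +
    (.share (r x) (.chan (.var (c x))) ::ₘ .empty (c x) ::ₘ 0) + C) (by simp)).plug_zero
      (((IsItem.couple (.inl he') he).conf.append (IsItem.idle x).conf).append hC) (by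
        simp only [Multiset.insert_eq_cons, Multiset.mem_add, Multiset.mem_cons,
          Multiset.mem_singleton]
        rintro T (((rfl | rfl) | h) | h)
        · refine hA.2.rename fun z hz => ?_
          rcases z with _ | z
          · exact hQ.2.1
          · exact Nat.lt_of_succ_lt_succ hz
        · exact hQ.2.2
        · simp at h
        · exact hR T h)
  convert this using 1
  · simp only [← Multiset.singleton_add]; abel
  · simp
  · simp

/-- An interaction on the channel `x` is simulated, or `x` is occupied by the message of another
sender, which can be delivered instead. -/
theorem Run.com {x z : ℕ} {A B : PiProc} (h : Run k (.inp x A ::ₘ .out x z B ::ₘ L) q b m) :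
    ∃ m', ReflTransGen DStep m m' ∧
      ((∃ q' ≤ q, Run k (A.rename (instName z) ::ₘ B ::ₘ L) q' b m') ∨
        ∃ y Q L' q', q' < q ∧ L = .out x y Q ::ₘ L' ∧
          Run k (A.rename (instName y) ::ₘ Q ::ₘ .out x z B ::ₘ L') q' b m') := by
  rw [Multiset.cons_swap] at h
  have hB : PiProc.Below k (.out x z B) := by
    obtain ⟨s, r, c, h⟩ := h
    exact h.below _ (by simp)
  obtain ⟨s, r, c, l, X, ⟨hS, hF⟩ | ⟨e, q, rfl, he, hS, hF⟩⟩ := h.send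
  all_goals
    obtain ⟨D, X, L', p, q, hS', hL, rfl, hD, hb, hF'⟩ := hF.expose (Multiset.mem_cons_self _ _)
    rw [Multiset.cons_inj_right] at hL
    subst hL
    obtain ⟨d, f, rfl, hd, hf, rfl⟩ : ∃ d f, D = .thread false f ::ₘ 0 ∧ Target r c x d ∧
        Pre (recvCode s r d A) f ∧ p = 0 := by
      cases hD with
      | run he => exact ⟨_, _, rfl, .name, he, rfl⟩
      | recv hd he => exact ⟨_, _, rfl, hd, he, rfl⟩
  -- The sender has not yet put its message; what happens depends on the MVar of the channel.
  · have hx := hF'.mem_chan (by simp) hB.1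
    have h₁ := recv_steps (m := .thread false (sendCode s r (.var (c x)) z l B) ::ₘ
      .mvar l .unit ::ₘ X) hd hf (by simp [hx])
    rcases hF'.split_chan (by simp) hB.1 with ⟨X, rfl, hX⟩ |
      ⟨X, y, l', Q, e, L', q', hpre, rfl, rfl, rfl, hX⟩
    -- The MVar is empty: the sender fills it, and the receiver takes the message.
    · obtain ⟨e, he, hT⟩ := tStep_send_put (S := S) (s := s) (r := r)
        (m := .share (r x) (.chan (.var (c x))) ::ₘ .mvar l .unit ::ₘ
          .thread false (recvCode s r (.var (c x)) A) ::ₘ X) z l B (c x)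
      obtain ⟨m', h₂, h₃⟩ := Frame.deliver he hb hB .zero (by simp)
        (hX.change (D := .thread false (recvCode s r (.var (c x)) A) ::ₘ .thread false e ::ₘ
          .share (r x) (.chan (.var (c x))) ::ₘ .mvar (c x) (.pair (.var (r z)) (.var l)) ::ₘ
          .mvar l .unit ::ₘ 0) (by simp))
      refine ⟨m', ?_, .inl ⟨0 + q, by omega, by simpa using h₃⟩⟩
      refine hS.trans ((steps_of_eq hS' ?_ rfl).trans ((steps_of_eq h₁ ?_ rfl).trans
        ((steps_of_eq (.single hT.dStep) ?_ rfl).trans (steps_of_eq h₂ ?_ rfl))))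
      all_goals simp only [← Multiset.singleton_add]; abel
    -- The MVar holds the message of another sender, which the receiver takes; the first
    -- sender stays.
    · have hQ := hF'.below (.out x y Q) (by simp)
      have hi : Ready s r c (.thread false (sendCode s r (.var (c x)) z l B) ::ₘ
        .mvar l .unit ::ₘ 0) (.out x z B) 0 :=
        .send .mvar (.refl (S := S) _)
      obtain ⟨m', h₂, h₃⟩ := Frame.deliver hpre hb hQ hi.conf (by simpa using hB)
        (hX.change (D := .thread false (recvCode s r (.var (c x)) A) ::ₘ .thread false e ::ₘ
          .share (r x) (.chan (.var (c x))) ::ₘ .mvar (c x) (.pair (.var (r y)) (.var l')) ::ₘ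
          .mvar l' .unit ::ₘ .thread false (sendCode s r (.var (c x)) z l B) ::ₘ
            .mvar l .unit ::ₘ 0) (by simp))
      refine ⟨m', ?_, .inr ⟨y, Q, L', 0 + q', by omega, rfl, by simpa using h₃⟩⟩
      refine hS.trans ((steps_of_eq hS' ?_ rfl).trans ((steps_of_eq h₁ ?_ rfl).trans
        (steps_of_eq h₂ ?_ rfl)))
      all_goals simp only [← Multiset.singleton_add]; abel
  -- The message of the sender itself waits already, and the receiver takes it.
  · have h₁ := recv_steps (m := .thread false e ::ₘ .share (r x) (.chan (.var (c x))) ::ₘ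
      .mvar (c x) (.pair (.var (r z)) (.var l)) ::ₘ .mvar l .unit ::ₘ X) hd hf (by simp)
    obtain ⟨m', h₂, h₃⟩ := Frame.deliver he hb hB .zero (by simp)
      (hF'.change (D := .thread false (recvCode s r (.var (c x)) A) ::ₘ .thread false e ::ₘ
        .share (r x) (.chan (.var (c x))) ::ₘ .mvar (c x) (.pair (.var (r z)) (.var l)) ::ₘ
        .mvar l .unit ::ₘ 0) (by simp))
    refine ⟨m', ?_, .inl ⟨0 + q, by omega, by simpa using h₃⟩⟩
    refine hS.trans ((steps_of_eq hS' ?_ rfl).trans ((steps_of_eq h₁ ?_ rfl).trans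
      (steps_of_eq h₂ ?_ rfl)))
    all_goals simp only [← Multiset.singleton_add]; abel

end Forward

/-! ### Convergence of a process and of its translation -/

/-- A finished main thread stays finished. -/
theorem HasRet.dStep {m m' : Multiset (Comp S)} (h : HasRet m) (hs : DStep m m') : HasRet m' := by
  obtain ⟨v, hv⟩ := h
  rw [dStep_iff] at hs
  obtain ⟨b, e, m₀, rfl, hs⟩ := hs
  have hv : Comp.thread true (.ret v) ∈ m₀ := by
    refine (Multiset.mem_cons.1 hv).resolve_left fun h => ?_
    cases h
    exact hs.not_ret
  obtain ⟨a, -, hs⟩ := hs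
  cases hs with
  | binds n es e =>
    exact ⟨v.rename (· + n), by
      simpa using .inr (.inr (Multiset.mem_map_of_mem (Comp.rename (· + n)) hv))⟩
  | new w e =>
    exact ⟨v.rename Nat.succ, by
      simpa using .inr (Multiset.mem_map_of_mem (Comp.rename Nat.succ) hv)⟩
  | _ =>
    refine ⟨v, ?_⟩
    simp at hv ⊢
    tauto

theorem Good.dSteps {m m' : Multiset (Comp S)} (h : Good m) (hs : ReflTransGen DStep m m') :
    Good m' := by
  induction hs with
  | refl => exact h
  | tail _ h' ih => exact ih.dstep h'

/-- A reduction that does not end in success is a standard reduction, as no intermediate state is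
successful. -/
theorem sSteps_of_dSteps {m m' : Multiset (Comp S)} (hs : ReflTransGen DStep m m')
    (h : ¬ HasRet m') : ReflTransGen SStep m m' := by
  induction hs with
  | refl => exact .refl
  | tail _ h' ih =>
    have hr : ¬ HasRet _ := fun hr => h (hr.dStep h')
    exact (ih hr).tail ⟨hr, h'⟩

theorem mMay_of_dSteps {m m' : Multiset (Comp S)} (hs : ReflTransGen DStep m m')
    (h : HasRet m') : MMay m := by
  induction hs using ReflTransGen.head_induction_on with
  | refl => exact ⟨_, .refl, h⟩
  | @head a c h' _ ih =>
    by_cases hr : HasRet a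
    · exact ⟨_, .refl, hr⟩
    · obtain ⟨m', h₁, h₂⟩ := ih
      exact ⟨m', .head ⟨hr, h'⟩ h₁, h₂⟩

theorem MMay.of_sSteps {m m' : Multiset (Comp S)} (hs : ReflTransGen SStep m m') (h : MMay m') :
    MMay m := by
  obtain ⟨m'', h₁, h₂⟩ := h
  exact ⟨m'', hs.trans h₁, h₂⟩

section Run

variable {k q : ℕ} {L : Multiset PiProc} {b : Bool} {m m' : Multiset (Comp S)}

/-- In a state of a translated process the main thread has not finished: it still has to fill
`stop`. -/
theorem Run.not_hasRet (h : Run k L q b m) (hm : Good m) : ¬ HasRet m := by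
  rintro ⟨v, hv⟩
  obtain ⟨s, r, c, ⟨e, M, rfl, he, -⟩, -⟩ := h
  rcases Multiset.mem_cons.1 hv with h | h
  · cases h
    rcases he with h | ⟨_, _, h, -⟩ | ⟨_, _, h, -⟩ <;> cases h
  · obtain ⟨M', hM'⟩ := Multiset.exists_cons_of_mem h
    have := hm.2
    rw [hM'] at this
    simp [mains_cons] at this

/-- If `stop` is empty, then the main thread can finish. -/
theorem Run.mMay_of_empty (h : Run k L q false m) : MMay m := by
  obtain ⟨s, r, c, ⟨e, M, rfl, he, -⟩, -⟩ := h
  have h : TStep true (.put (.var s) .unit) (stopComp false s ::ₘ M)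
    (.thread true (.ret .unit) ::ₘ .mvar s .unit ::ₘ M) := ⟨_, .base (.put _ _), .put _ _ _ _⟩
  exact mMay_of_dSteps ((he.steps true _).tail h.dStep) ⟨.unit, by simp⟩

/-- If unfolding exposes an interaction with a result in the class `a`, then the translation
reaches a state of `a`, unless the channel is occupied by the message of another sender. In this
case it reaches a state of another reduct, with fewer waiting messages. -/
theorem Run.unfolds_com {a : PiProc.PiCl} (hU : PiProc.Unfolds (PiProc.ComGoal a) k L) :
    ∀ {m : Multiset (Comp S)}, Run k L q b m → ∃ m', ReflTransGen DStep m m' ∧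
      ((∃ k' L' q', q' ≤ q ∧ Run k' L' q' b m' ∧ a = PiProc.rd k' L') ∨
        ∃ k' L' q', q' < q ∧ Run k' L' q' b m' ∧ ∀ P P', PiProc.cl P = PiProc.rd k L →
          PiProc.cl P' = PiProc.rd k' L' → PiProc.Step P P') := by
  have key : ∀ {k₁ k₂ : ℕ} {L₁ L₂ : Multiset PiProc}, PiProc.rd k₂ L₂ = PiProc.rd k₁ L₁ →
      (∀ {m : Multiset (Comp S)}, Run k₁ L₁ q b m →
        ∃ m', ReflTransGen DStep m m' ∧ Run k₂ L₂ q b m') →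
      (∀ {m : Multiset (Comp S)}, Run k₂ L₂ q b m → ∃ m', ReflTransGen DStep m m' ∧
        ((∃ k' L' q', q' ≤ q ∧ Run k' L' q' b m' ∧ a = PiProc.rd k' L') ∨
          ∃ k' L' q', q' < q ∧ Run k' L' q' b m' ∧ ∀ P P', PiProc.cl P = PiProc.rd k₂ L₂ →
            PiProc.cl P' = PiProc.rd k' L' → PiProc.Step P P')) →
      (∀ {m : Multiset (Comp S)}, Run k₁ L₁ q b m → ∃ m', ReflTransGen DStep m m' ∧
        ((∃ k' L' q', q' ≤ q ∧ Run k' L' q' b m' ∧ a = PiProc.rd k' L') ∨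
          ∃ k' L' q', q' < q ∧ Run k' L' q' b m' ∧ ∀ P P', PiProc.cl P = PiProc.rd k₁ L₁ →
            PiProc.cl P' = PiProc.rd k' L' → PiProc.Step P P')) := by
    intro k₁ k₂ L₁ L₂ hL h₁ h₂ m h
    obtain ⟨m₁, h₃, h₄⟩ := h₁ h
    obtain ⟨m₂, h₅, h₆⟩ := h₂ h₄
    rw [hL] at h₆
    exact ⟨m₂, h₃.trans h₅, h₆⟩
  induction hU with
  | base h =>
    intro m hm
    obtain ⟨x, z, P, Q, L₀, rfl, rfl⟩ := h
    obtain ⟨m', h₁, ⟨q', hq, h₂⟩ | ⟨y, R, L', q', hq, rfl, h₂⟩⟩ := hm.com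
    · exact ⟨m', h₁, .inl ⟨_, _, q', hq, h₂, rfl⟩⟩
    · refine ⟨m', h₁, .inr ⟨_, _, q', hq, h₂, fun A A' hA hA' => ?_⟩⟩
      rw [Multiset.cons_swap (PiProc.out x z Q)] at hA
      exact PiProc.step_rd hA hA'
  | par h ih =>
    intro m hm
    refine key (PiProc.rd_congr ?_) Run.par ih hm
    simp [PiProc.cl_par, add_assoc]
  | nu h ih =>
    intro m hm
    exact key (PiProc.rd_nu _ _ _) Run.nu ih hm
  | @bang k P L h ih =>
    intro m hm
    refine key (PiProc.rd_congr ?_) Run.bang ih hm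
    simp only [Multiset.map_cons, Multiset.sum_cons]
    rw [← add_assoc, ← PiProc.cl_bang]

theorem Run.unfolds_success (hU : PiProc.Unfolds PiProc.StopGoal k L) :
    ∀ {m : Multiset (Comp S)}, Run k L q true m →
      ∃ m', ReflTransGen DStep m m' ∧ HasRet m' := by
  induction hU with
  | base h =>
    intro m hm
    obtain ⟨L, rfl⟩ := Multiset.exists_cons_of_mem h
    exact hm.success
  | par h ih =>
    intro m hm
    obtain ⟨m₁, h₁, h₂⟩ := hm.par
    obtain ⟨m₂, h₃, h₄⟩ := ih h₂
    exact ⟨m₂, h₁.trans h₃, h₄⟩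
  | nu h ih =>
    intro m hm
    obtain ⟨m₁, h₁, h₂⟩ := hm.nu
    obtain ⟨m₂, h₃, h₄⟩ := ih h₂
    exact ⟨m₂, h₁.trans h₃, h₄⟩
  | bang h ih =>
    intro m hm
    obtain ⟨m₁, h₁, h₂⟩ := hm.bang
    obtain ⟨m₂, h₃, h₄⟩ := ih h₂
    exact ⟨m₂, h₁.trans h₃, h₄⟩

end Run

/-- The components `m` are a state of the translation of the process `P` with `q` messages that
wait in the MVar of a channel. -/
def Sim (P : PiProc) (q : ℕ) (m : Multiset (Comp S)) : Prop :=
  ∃ k L, Run k L q true m ∧ PiProc.cl P = PiProc.rd k L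

section Sim

variable {P P' : PiProc} {q : ℕ} {m m' : Multiset (Comp S)}

theorem Sim.mMay_of_hasStop (h : Sim P q m) (hP : P.HasStop) : MMay m := by
  obtain ⟨k, L, h, e⟩ := h
  obtain ⟨m', h₁, h₂⟩ := h.unfolds_success (hP.unfolds_rd e)
  exact mMay_of_dSteps h₁ h₂

/-- A step of the process is simulated, unless a channel is occupied by the message of another
sender. In this case another reduct of the process can be reached, with fewer waiting messages. -/
theorem Sim.step (h : Sim P q m) (hm : Good m) (hs : PiProc.Step P P') :
    ∃ m', ReflTransGen SStep m m' ∧ Good m' ∧ ((∃ q' ≤ q, Sim P' q' m') ∨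
      ∃ P'' q', q' < q ∧ PiProc.Step P P'' ∧ Sim P'' q' m') := by
  obtain ⟨k, L, h, e⟩ := h
  obtain ⟨m', h₁, h₂⟩ := h.unfolds_com (hs.unfolds e)
  have hm' := hm.dSteps h₁
  rcases h₂ with ⟨k', L', q', hq, h₂, h₃⟩ | ⟨k', L', q', hq, h₂, h₃⟩
  · exact ⟨m', sSteps_of_dSteps h₁ (h₂.not_hasRet hm'), hm', .inl ⟨q', hq, k', L', h₂, h₃⟩⟩
  · obtain ⟨P'', hP''⟩ := PiProc.exists_rd k' L'
    exact ⟨m', sSteps_of_dSteps h₁ (h₂.not_hasRet hm'), hm',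
      .inr ⟨P'', q', hq, h₃ P P'' e hP'', k', L', h₂, hP''⟩⟩

/-- If a process may converge, then its translation may converge, provided that no messages wait,
or that the process should converge: then a message in a channel which the successful reduction
uses can be delivered first. -/
theorem Sim.mMay : ∀ (q : ℕ) {P : PiProc} {m : Multiset (Comp S)}, Sim P q m → Good m →
    P.MayConv → q = 0 ∨ P.ShouldConv → MMay m := by
  intro q
  induction q using Nat.strong_induction_on with
  | _ q ihq =>
    intro P m h hm ⟨P', hs, hP'⟩ hc
    rw [PiProc.successful_iff] at hP'
    induction hs using ReflTransGen.head_induction_on generalizing m with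
    | refl => exact h.mMay_of_hasStop hP'
    | @head P P₁ hs hs' ih =>
      have hc₁ : ∀ {R}, PiProc.Step P R → P.ShouldConv → R.ShouldConv :=
        fun hR hc T hT => hc T (.head hR hT)
      obtain ⟨m', h₁, hm', ⟨q', hq, h₂⟩ | ⟨R, q', hq, hR, h₂⟩⟩ := h.step hm hs
      -- The first step of the successful reduction is simulated.
      · refine MMay.of_sSteps h₁ ?_
        rcases hq.eq_or_lt with rfl | hq
        · exact ih h₂ hm' (hc.imp_right (hc₁ hs))
        · exact ihq q' hq h₂ hm' ⟨P', hs', PiProc.successful_iff.2 hP'⟩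
            (.inr (hc₁ hs (hc.resolve_left (by omega))))
      -- Another message has been delivered. The reduct `R` may converge by a new reduction, and
      · have hc := hc₁ hR (hc.resolve_left (by omega))
        exact MMay.of_sSteps h₁ (ihq q' hq h₂ hm' (hc R .refl) (.inr hc))

/-- Reductions of the translation are reductions of the process, until `stop` is emptied. -/
theorem Sim.back (h : Sim P q m) (hm : Good m) (hs : ReflTransGen SStep m m') : Good m' ∧
    ((∃ P' q', ReflTransGen PiProc.Step P P' ∧ Sim P' q' m') ∨
      (∃ P', ReflTransGen PiProc.Step P P' ∧ P'.HasStop) ∧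
        (HasRet m' ∨ ∃ k L q', Run k L q' false m')) := by
  induction hs with
  | refl => exact ⟨hm, .inl ⟨P, q, .refl, h⟩⟩
  | tail _ hs ih =>
    obtain ⟨hm, ih⟩ := ih
    refine ⟨hm.dstep hs.2, ?_⟩
    rcases ih with ⟨P', q', hP, k, L, h, e⟩ | ⟨hP, hr | ⟨k, L, q', h⟩⟩
    · rcases h.back hm hs.2 with ⟨h', e'⟩ | ⟨h', rfl⟩ | ⟨-, hL, h'⟩ | ⟨h', -⟩
      · exact .inl ⟨P', _, hP, _, _, h', e.trans e'.symm⟩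
      · obtain ⟨P'', hP''⟩ := PiProc.exists_rd k _
        exact .inl ⟨P'', _, hP.tail (PiProc.step_rd e hP''), _, _, h', hP''⟩
      · exact .inr ⟨⟨P', hP, (PiProc.hasStop_rd e).2 ⟨_, hL, trivial⟩⟩, .inr ⟨_, _, _, h'⟩⟩
      · cases h'
    · exact absurd hr hs.1
    · refine .inr ⟨hP, ?_⟩
      rcases h.back hm hs.2 with ⟨h', -⟩ | ⟨h', -⟩ | ⟨h', -, -⟩ | ⟨-, h'⟩
      · exact .inr ⟨_, _, _, h'⟩
      · exact .inr ⟨_, _, _, h'⟩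
      · cases h'
      · exact .inl h'

theorem Sim.mayConv (h : Sim P q m) (hm : Good m) (hc : MMay m) : P.MayConv := by
  obtain ⟨m', hs, hr⟩ := hc
  obtain ⟨hm', ⟨P', q', -, k, L, h', -⟩ | ⟨⟨P', hP, hP'⟩, -⟩⟩ := h.back hm hs
  · exact absurd hr (h'.not_hasRet hm')
  · exact ⟨P', hP, PiProc.successful_iff.2 hP'⟩

theorem Sim.mMay_iff (h : Sim P 0 m) (hm : Good m) : MMay m ↔ P.MayConv :=
  ⟨h.mayConv hm, fun hc => Sim.mMay 0 h hm hc (.inl rfl)⟩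

/-- From left to right, a reduction is simulated without leaving messages in channels; from right
to left, every state of the translation implements a reduct of the process, possibly with waiting
messages, and `Sim.mMay` applies because the reduct should converge. -/
theorem Sim.mShould_iff (h : Sim P 0 m) (hm : Good m) : MShould m ↔ P.ShouldConv := by
  constructor
  · intro hc P' hs
    have key : ∃ m', ReflTransGen SStep m m' ∧ Good m' ∧ Sim P' 0 m' := by
      induction hs with
      | refl => exact ⟨m, .refl, hm, h⟩
      | tail _ hs ih =>
        obtain ⟨m₁, h₁, hm₁, h⟩ := ih
        obtain ⟨m₂, h₂, hm₂, ⟨q, hq, h'⟩ | ⟨_, q, hq, -⟩⟩ := h.step hm₁ hs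
        · rw [Nat.le_zero.1 hq] at h'
          exact ⟨m₂, h₁.trans h₂, hm₂, h'⟩
        · omega
    obtain ⟨m', h₁, hm', h₂⟩ := key
    exact h₂.mayConv hm' (hc m' h₁)
  · intro hc m' hs
    obtain ⟨hm', ⟨P', q', hP, h'⟩ | ⟨-, hr | ⟨k, L, q', h'⟩⟩⟩ := h.back hm hs
    · exact Sim.mMay q' h' hm' (hc P' hP) (.inr fun R hR => hc R (hP.trans hR))
    · exact ⟨m', .refl, hr⟩
    · exact h'.mMay_of_empty

end Sim

/-! ### The initial state -/

section Init

variable {b : Bool} {e : Expr S} {m m' : Multiset (Comp S)}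

/-- A deterministic first step does not change convergence. -/
theorem mMay_iff_of_det (hm : ¬ HasRet m) (hs : DStep m m') (hd : ∀ m'', DStep m m'' → m'' = m') :
    MMay m ↔ MMay m' := by
  refine ⟨?_, fun h => h.of_sSteps (.single ⟨hm, hs⟩)⟩
  rintro ⟨m'', h₁, h₂⟩
  rcases h₁.cases_head with rfl | ⟨m₁, h₃, h₄⟩
  · exact absurd h₂ hm
  · rw [hd m₁ h₃.2] at h₄
    exact ⟨m'', h₄, h₂⟩

theorem mShould_iff_of_det (hm : ¬ HasRet m) (hs : DStep m m')
    (hd : ∀ m'', DStep m m'' → m'' = m') : MShould m ↔ MShould m' := by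
  refine ⟨fun h m'' h' => h m'' (.head ⟨hm, hs⟩ h'), fun h m'' h' => ?_⟩
  rcases h'.cases_head with rfl | ⟨m₁, h₃, h₄⟩
  · exact (h m' .refl).of_sSteps (.single ⟨hm, hs⟩)
  · rw [hd m₁ h₃.2] at h₄
    exact h m'' h₄

/-- A state with a single thread, which is not finished, can be replaced by its successor. -/
theorem conv_iff_of_tStep (hm : Good (.thread b e ::ₘ m)) (hs : TStep b e m m')
    (hn : ∀ c ∈ m, ∀ b e, c ≠ .thread b e) :
    Good m' ∧ (MMay (.thread b e ::ₘ m) ↔ MMay m') ∧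
      (MShould (.thread b e ::ₘ m) ↔ MShould m') := by
  have hr : ¬ HasRet (.thread b e ::ₘ m) := by
    rintro ⟨v, hv⟩
    rcases Multiset.mem_cons.1 hv with h | h
    · cases h
      exact hs.not_ret
    · exact hn _ h _ _ rfl
  have hd : ∀ m'', DStep (.thread b e ::ₘ m) m'' → m'' = m' := by
    intro m'' h
    rw [dStep_iff] at h
    obtain ⟨b', e', m₀, h₁, h₂⟩ := h
    rcases Multiset.cons_eq_cons.1 h₁ with ⟨h, rfl⟩ | ⟨-, cs, rfl, -⟩
    · cases h
      have : (intros m).Nodup := by simpa only [intros_cons_thread] using hm.1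
      exact h₂.det this hs
    · exact absurd rfl (hn _ (Multiset.mem_cons_self _ _) _ _)
  exact ⟨hm.dstep hs.dStep, mMay_iff_of_det hr hs.dStep hd, mShould_iff_of_det hr hs.dStep hd⟩

/-- The main thread allocates `stop` and starts the observed expression. -/
theorem conv_iff_of_outer (f : Expr S) : ∃ e, Pre (.put (.var 0) .unit) e ∧
    Good (.thread true e ::ₘ .thread false f ::ₘ .mvar 0 .unit ::ₘ 0) ∧
    ∀ m, m = .thread true (.bind (.new .unit)
        (.lam (.bind (.fork f) (.lam (.put (.var 1) .unit))))) ::ₘ 0 → Good m ∧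
      (MMay m ↔ MMay (.thread true e ::ₘ .thread false f ::ₘ .mvar 0 .unit ::ₘ 0)) ∧
      (MShould m ↔ MShould (.thread true e ::ₘ .thread false f ::ₘ .mvar 0 .unit ::ₘ 0)) := by
  have h₀ : Good (.thread true (.bind (.new .unit)
      (.lam (.bind (.fork f) (.lam (.put (.var 1) .unit))))) ::ₘ 0) := by
    constructor
    · rw [intros_cons_thread]
      exact Multiset.nodup_zero
    · simp [mains]
  obtain ⟨h₁, h₁', h₁''⟩ := conv_iff_of_tStep h₀
    ⟨_, .bind _ (.base (.new _)), .new' (Expr.rename_unit _)⟩ (by simp)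
  have hn : ∀ c ∈ (.mvar 0 .unit ::ₘ 0 : Multiset (Comp S)), ∀ b e, c ≠ .thread b e := by simp
  obtain ⟨h₂, h₂', h₂''⟩ := conv_iff_of_tStep h₁ ⟨_, .base (.lunit _ _), .loc _ _⟩ hn
  obtain ⟨h₃, h₃', h₃''⟩ := conv_iff_of_tStep h₂ ⟨_, .force (.eval (.base (.beta _ _))),
    .loc _ _⟩ hn
  rw [inst_rename_succ] at h₃ h₃' h₃''
  obtain ⟨h₄, h₄', h₄''⟩ := conv_iff_of_tStep h₃ ⟨_, .bind _ (.base (.fork _)), .fork _ _ _⟩ hn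
  refine ⟨_, .bind (inst_of_forall ?_), h₄, ?_⟩
  · simp [Expr.subst]
  · rintro m rfl
    exact ⟨h₀, h₁'.trans (h₂'.trans (h₃'.trans h₄')), h₁''.trans (h₂''.trans (h₃''.trans h₄''))⟩

/-- A closed process and its translation have the same convergence properties. -/
theorem conv₀_tau {P : PiProc} (hP : PiProc.Below 0 P) :
    (MayConv₀ (tau S P) ↔ P.MayConv) ∧ (ShouldConv₀ (tau S P) ↔ P.ShouldConv) := by
  -- Below the binders of the outer context, `stop` is the variable `0`; no channel name is free.
  have hf : (((tau S P).rename (bindName stopVar)).rename (upRen 1 (bindName stopVar))) =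
      tauAux 0 id P := by
    rw [tau, tauAux_rename (s := stopVar) (r := chanVar) (f := bindName stopVar) (h := id) (s' := 0)
      (r' := fun x => bindName stopVar (chanVar x)) P (by simp [bindName]) fun _ => rfl,
      tauAux_rename (s := 0) (r := fun x => bindName stopVar (chanVar x))
      (f := upRen 1 (bindName stopVar)) (h := id) (s' := 0)
      (r' := fun x => upRen 1 (bindName stopVar) (bindName stopVar (chanVar x))) _
      (by simp [upRen]) fun _ => rfl, PiProc.rename_id, PiProc.rename_id]
    exact tauAux_congr hP (by simp)
  obtain ⟨e, he, hG, h⟩ := conv_iff_of_outer (tauAux (S := S) 0 id P)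
  obtain ⟨h₀, h₁, h₂⟩ := h _ rfl
  have hr : Rep (outerCtx (tau S P)) (.thread true (.bind (.new .unit)
      (.lam (.bind (.fork (tauAux 0 id P)) (.lam (.put (.var 1) .unit))))) ::ₘ 0) := by
    refine ⟨Equiv.refl ℕ, ?_⟩
    simp only [outerCtx, flat, Expr.rename, Expr.rename_unit, hf]
    exact (ren_id _).symm
  have hs : Sim P 0 (.thread true e ::ₘ .thread false (tauAux (S := S) 0 id P) ::ₘ
      .mvar 0 .unit ::ₘ 0) := by
    refine ⟨0, {P}, ⟨0, id, id, ⟨e, .thread false (tauAux 0 id P) ::ₘ 0, ?_, he,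
      (Ready.run (.refl _)).conf⟩, Function.injective_id, by simpa using hP, by simp⟩, ?_⟩
    · exact congrArg _ (Multiset.cons_swap _ _ _)
    · simp [PiProc.rd]
  exact ⟨(hr.mayConv_iff h₀).trans (h₁.trans (hs.mMay_iff hG)),
    (hr.shouldConv_iff h₀).trans (h₂.trans (hs.mShould_iff hG))⟩

end Init

end CH

namespace PiProc

/-! ### Contexts of the pi-calculus -/

theorem bindName_injective (x : ℕ) : Function.Injective (bindName x) := by
  intro y z h
  simp only [bindName] at h
  split_ifs at h <;> omega

theorem bindName_lt {k x y : ℕ} (hy : y < k) : bindName x y < k + 1 := by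
  simp only [bindName]
  split_ifs <;> omega

/-- Unfolding preserves the class of the process. -/
theorem Unfolds.exists_rd {g : ℕ → Multiset PiProc → Prop} {k : ℕ} {L : Multiset PiProc}
    (h : Unfolds g k L) : ∃ k' L', g k' L' ∧ rd k L = rd k' L' := by
  induction h with
  | base h => exact ⟨_, _, h, rfl⟩
  | par h ih =>
    obtain ⟨k', L', hg, e⟩ := ih
    refine ⟨k', L', hg, e ▸ rd_congr ?_⟩
    simp [cl_par, add_assoc]
  | nu h ih =>
    obtain ⟨k', L', hg, e⟩ := ih
    exact ⟨k', L', hg, e ▸ (rd_nu _ _ _).symm⟩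
  | bang h ih =>
    obtain ⟨k', L', hg, e⟩ := ih
    refine ⟨k', L', hg, e ▸ rd_congr ?_⟩
    simp only [Multiset.map_cons, Multiset.sum_cons]
    rw [← add_assoc, ← cl_bang]

/-- Internal transitions are standard reductions. -/
theorem TTau.step {P Q : PiProc} (h : TTau P Q) : Step P Q := by
  obtain ⟨k, L, ⟨x, z, A, B, L, rfl, hQ⟩, e⟩ := (h.unfolds 0 0).exists_rd
  refine step_rd (x := x) (z := z) (A := A) (B := B) (L := L) (k := k) ?_ ?_
  · rw [← e]
    simp [rd]
  · rw [← hQ]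
    simp [rdAdd]

/-! ### Convergence below a restriction -/

theorem step_nuName {P Q : PiProc} (h : Step P Q) (x : ℕ) : Step (nuName x P) (nuName x Q) := by
  obtain ⟨R, hR, e⟩ := h.exists_ttau rfl
  refine (hR.rename (bindName x)).step.nu.cl_right ?_
  rw [nuName, cl_nu, cl_nu, cl_rename, cl_rename, e]

/-- A restriction can reduce only inside its scope. -/
theorem exists_step_of_nuName {P Q R : PiProc} {x : ℕ} (h : Step Q R)
    (e : cl Q = cl (nuName x P)) : ∃ P', Step P P' ∧ cl R = cl (nuName x P') := by
  obtain ⟨R', hR, e'⟩ := h.exists_ttau e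
  cases hR with
  | nu hR =>
    obtain ⟨P', rfl, hP⟩ := hR.of_rename (bindName_injective x)
    exact ⟨P', hP.step, e'⟩

theorem exists_steps_of_nuName {P Q R : PiProc} {x : ℕ} (h : Relation.ReflTransGen Step Q R)
    (e : cl Q = cl (nuName x P)) :
    ∃ P', Relation.ReflTransGen Step P P' ∧ cl R = cl (nuName x P') := by
  induction h with
  | refl => exact ⟨P, .refl, e⟩
  | tail _ h ih =>
    obtain ⟨P', hP, e'⟩ := ih
    obtain ⟨P'', hP', e''⟩ := exists_step_of_nuName h e'
    exact ⟨P'', hP.tail hP', e''⟩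

theorem steps_nuName {P Q : PiProc} (h : Relation.ReflTransGen Step P Q) (x : ℕ) :
    Relation.ReflTransGen Step (nuName x P) (nuName x Q) :=
  h.lift (nuName x) fun _ _ h => step_nuName h x

theorem hasStop_nuName {P : PiProc} {x : ℕ} : HasStop (nuName x P) ↔ HasStop P := by
  simp [nuName, HasStop]

theorem mayConv_of_cl_nuName {P Q : PiProc} {x : ℕ} (h : MayConv P) (e : cl Q = cl (nuName x P)) :
    MayConv Q := by
  obtain ⟨P', hs, hP⟩ := h
  rw [successful_iff] at hP
  rcases (steps_nuName hs x).cases_head with h | ⟨R, h₁, h₂⟩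
  · refine ⟨Q, .refl, successful_iff.2 ((hasStop_nuName.2 hP).cl (h ▸ e.symm))⟩
  · exact ⟨_, .head (h₁.cl_left e.symm) h₂, successful_iff.2 (hasStop_nuName.2 hP)⟩

theorem mayConv_of_nuName {P Q : PiProc} {x : ℕ} (h : MayConv Q) (e : cl Q = cl (nuName x P)) :
    MayConv P := by
  obtain ⟨Q', hs, hQ⟩ := h
  obtain ⟨P', hP, e'⟩ := exists_steps_of_nuName hs e
  exact ⟨P', hP, successful_iff.2 (hasStop_nuName.1 ((successful_iff.1 hQ).cl e'))⟩

theorem mayConv_nuName {P : PiProc} (x : ℕ) : MayConv (nuName x P) ↔ MayConv P :=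
  ⟨fun h => mayConv_of_nuName h rfl, fun h => mayConv_of_cl_nuName h rfl⟩

theorem shouldConv_nuName {P : PiProc} (x : ℕ) : ShouldConv (nuName x P) ↔ ShouldConv P := by
  constructor
  · intro h P' hs
    exact (mayConv_nuName x).1 (h _ (steps_nuName hs x))
  · intro h Q hs
    obtain ⟨P', hP, e⟩ := exists_steps_of_nuName hs rfl
    exact mayConv_of_cl_nuName (h P' hP) e

/-- The free names of a context and the names which it binds are smaller than `k`. -/
def Ctx.Below (k : ℕ) : Ctx → Prop
  | hole => True
  | out x y C => x < k ∧ y < k ∧ C.Below k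
  | inp x y C => x < k ∧ y < k ∧ C.Below k
  | parL C P => C.Below k ∧ PiProc.Below k P
  | parR P C => PiProc.Below k P ∧ C.Below k
  | bang C => C.Below k
  | nu x C => x < k ∧ C.Below k

theorem Ctx.Below.mono {C : Ctx} {k k' : ℕ} (h : C.Below k) (hk : k ≤ k') : C.Below k' := by
  induction C with
  | hole => trivial
  | out x y C ih => exact ⟨h.1.trans_le hk, h.2.1.trans_le hk, ih h.2.2⟩
  | inp x y C ih => exact ⟨h.1.trans_le hk, h.2.1.trans_le hk, ih h.2.2⟩
  | parL C P ih => exact ⟨ih h.1, PiProc.Below.mono h.2 hk⟩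
  | parR P C ih => exact ⟨PiProc.Below.mono h.1 hk, ih h.2⟩
  | bang C ih => exact ih h
  | nu x C ih => exact ⟨h.1.trans_le hk, ih h.2⟩

theorem Ctx.exists_below (C : Ctx) : ∃ k, C.Below k := by
  induction C with
  | hole => exact ⟨0, trivial⟩
  | out x y C ih =>
    obtain ⟨k, h⟩ := ih
    exact ⟨k + x + y + 1, by omega, by omega, h.mono (by omega)⟩
  | inp x y C ih =>
    obtain ⟨k, h⟩ := ih
    exact ⟨k + x + y + 1, by omega, by omega, h.mono (by omega)⟩
  | parL C P ih =>
    obtain ⟨k, h⟩ := ih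
    obtain ⟨l, h'⟩ := PiProc.exists_below P
    exact ⟨k + l, h.mono (by omega), h'.mono (by omega)⟩
  | parR P C ih =>
    obtain ⟨k, h⟩ := ih
    obtain ⟨l, h'⟩ := PiProc.exists_below P
    exact ⟨k + l, h'.mono (by omega), h.mono (by omega)⟩
  | bang C ih => exact ih
  | nu x C ih =>
    obtain ⟨k, h⟩ := ih
    exact ⟨k + x + 1, by omega, h.mono (by omega)⟩

theorem Ctx.Below.plug {C : Ctx} {P : PiProc} {k : ℕ} (hC : C.Below k) (hP : PiProc.Below k P) :
    PiProc.Below k (C.plug P) := by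
  induction C with
  | hole => exact hP
  | out x y C ih => exact ⟨hC.1, hC.2.1, ih hC.2.2⟩
  | inp x y C ih => exact ⟨hC.1, (ih hC.2.2).rename fun _ => bindName_lt⟩
  | parL C P ih => exact ⟨ih hC.1, hC.2⟩
  | parR P C ih => exact ⟨hC.1, ih hC.2⟩
  | bang C ih => exact ih hC
  | nu x C ih => exact PiProc.Below.rename (k' := k + 1) (ih hC.2) fun _ => bindName_lt

/-- The context `νx₀.….νxₖ₋₁.C` for the names `xᵢ = i`. -/
def Ctx.close : ℕ → Ctx → Ctx
  | 0, C => C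
  | k + 1, C => close k (.nu k C)

theorem Below.nuName {P : PiProc} {k : ℕ} (h : Below (k + 1) P) : Below k (nuName k P) := by
  refine h.rename fun y hy => ?_
  simp only [bindName]
  split_ifs <;> omega

theorem Ctx.below_close {P : PiProc} : ∀ {k : ℕ} {C : Ctx}, PiProc.Below k (C.plug P) →
    PiProc.Below 0 ((Ctx.close k C).plug P)
  | 0, _, h => h
  | k + 1, C, h => below_close (k := k) (C := .nu k C) (Below.nuName h)

theorem Ctx.mayConv_close {P : PiProc} : ∀ {k : ℕ} {C : Ctx},
    MayConv ((Ctx.close k C).plug P) ↔ MayConv (C.plug P)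
  | 0, _ => Iff.rfl
  | k + 1, C => (mayConv_close (k := k) (C := .nu k C)).trans (mayConv_nuName k)

theorem Ctx.shouldConv_close {P : PiProc} : ∀ {k : ℕ} {C : Ctx},
    ShouldConv ((Ctx.close k C).plug P) ↔ ShouldConv (C.plug P)
  | 0, _ => Iff.rfl
  | k + 1, C => (shouldConv_close (k := k) (C := .nu k C)).trans (shouldConv_nuName k)

end PiProc

namespace CH

variable {S : DataSig}

/-! ### Contexts of the translation -/

theorem tauAux_rename_of_below {P : PiProc} {k s s' : ℕ} {r r' h f : ℕ → ℕ}
    (hP : PiProc.Below k P) (hs : f s = s') (hr : ∀ x < k, f (r x) = r' (h x)) :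
    (tauAux s r P : Expr S).rename f = tauAux s' r' (P.rename h) := by
  rw [tauAux_rename (r := r) (h := id) (r' := f ∘ r) P hs fun _ => rfl, PiProc.rename_id,
    tauAux_congr (r := f ∘ r) (r' := r' ∘ h) hP hr, ← Expr.rename_id (tauAux s' (r' ∘ h) P)]
  exact tauAux_rename P rfl fun _ => rfl

theorem tauAux_rename_congr {P : PiProc} {k s s' : ℕ} {r r' f : ℕ → ℕ}
    (hP : PiProc.Below k P) (hs : f s = s') (hr : ∀ x < k, f (r x) = r' x) :
    (tauAux s r P : Expr S).rename f = tauAux s' r' P := by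
  simpa only [PiProc.rename_id] using tauAux_rename_of_below (S := S) (h := id) hP hs hr

theorem bindNames_apply {n : ℕ} {xs : Fin n → ℕ} (h : Function.Injective xs) (i : Fin n) :
    bindNames xs (xs i) = i := by
  have h' : ∃ j, xs j = xs i := ⟨i, rfl⟩
  rw [bindNames, dif_pos h', h h'.choose_spec]

theorem bindNames_of_ne {n : ℕ} {xs : Fin n → ℕ} {y : ℕ} (h : ∀ i, xs i ≠ y) :
    bindNames xs y = y + n := by
  rw [bindNames, dif_neg]
  rintro ⟨i, hi⟩
  exact h i hi

theorem bindNames_one (x : ℕ) : bindNames ![x] = bindName x := by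
  funext y
  by_cases h : y = x
  · subst h
    exact (bindNames_apply (Function.injective_of_subsingleton ![y]) 0).trans (by simp [bindName])
  · rw [bindNames_of_ne (by simpa using Ne.symm h)]
    simp [bindName, h]

theorem injective_pair {x y : ℕ} (h : x ≠ y) : Function.Injective ![x, y] := by
  intro i j hij
  fin_cases i <;> fin_cases j <;> simp_all

theorem bindNames_two {x y : ℕ} (h : x ≠ y) (z : ℕ) :
    bindNames ![x, y] z = if z = x then 0 else if z = y then 1 else z + 2 := by
  have hi := injective_pair h
  split_ifs with h₁ h₂
  · subst h₁
    exact bindNames_apply hi 0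
  · subst h₂
    exact bindNames_apply hi 1
  · refine bindNames_of_ne fun i => ?_
    fin_cases i
    · exact Ne.symm h₁
    · exact Ne.symm h₂

/-- The translation of a context whose names are smaller than `k`. The variables `k + 1`, `k + 2`
and `k + 3`, which do not represent such names, are the bound variables of the translation. -/
def tauCtx (S : DataSig) (k : ℕ) : PiProc.Ctx → Ctx S
  | .hole => .hole
  | .out x y C =>
      .bindR (.new .unit) (.lam (k + 1)
        (.bindR (.put (.unchan (.var (chanVar x))) (.pair (.var (chanVar y)) (.var (k + 1))))
          (.lam (k + 2) (.bindR (.put (.var (k + 1)) .unit) (.lam (k + 3) (tauCtx S k C))))))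
  | .inp x y C =>
      .bindR (.take (.unchan (.var (chanVar x)))) (.lam (k + 1)
        (.caseAlt (T := .pair) (.var (k + 1)) (fun _ => .unit) .pair ![chanVar y, k + 2]
          (.bindR (.take (.var (k + 2))) (.lam (k + 3) (tauCtx S k C)))))
  | .parL C P => .bindR (.fork (tau S P)) (.lam (k + 1) (tauCtx S k C))
  | .parR P C => .bindL (.fork (tauCtx S k C)) (.lam ((tau S P).rename Nat.succ))
  | .nu x C =>
      .bindR (.new .bot) (.lam (k + 1) (.bindR (.take (.var (k + 1))) (.lam (k + 2)
        (.letrecBody ![chanVar x] (fun _ => .chan (.var (k + 1))) (tauCtx S k C)))))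
  | .bang C =>
      .letrecRhs ![k + 1] (fun _ => .unit) 0 (.bindL (.fork (tauCtx S k C)) (.lam (.var (k + 2))))
        (.var (k + 1))

/-- The translation is compositional: it commutes with plugging, captures of names included. -/
theorem tauCtx_plug {C : PiProc.Ctx} {P : PiProc} {k : ℕ} (hC : C.Below k)
    (hP : PiProc.Below k P) : (tauCtx S k C).plug (tau S P) = tau S (C.plug P) := by
  simp only [tau]
  induction C with
  | hole => rfl
  | out x y C ih =>
    have h := PiProc.Ctx.Below.plug hC.2.2 hP
    obtain ⟨hx, hy, hC⟩ := hC
    simp only [tauCtx, Ctx.plug, ih hC, PiProc.Ctx.plug, tauAux, Expr.rename, Expr.rename_unit,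
      Expr.rename_unchan, Expr.rename_pair, Expr.rename_comp]
    rw [tauAux_rename_congr (s' := stopVar + 3) (r' := fun z => chanVar z + 3) h]
    · simp [bindName, upRen, chanVar, hx.ne, hy.ne]
    · simp [bindName, upRen, stopVar]
    · intro z hz
      simp [bindName, upRen, chanVar, hz.ne, (show z ≠ k + 1 by omega), (show z ≠ k + 2 by omega)]
  | inp x y C ih =>
    have h := PiProc.Ctx.Below.plug hC.2.2 hP
    obtain ⟨hx, hy, hC⟩ := hC
    have hne : chanVar y ≠ k + 2 := by simp only [chanVar]; omega
    simp only [tauCtx, Ctx.plug, ih hC, PiProc.Ctx.plug, PiProc.inpName, tauAux, Expr.rename,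
      Expr.rename_comp]
    have hc : ∀ (_ : DecidableEq (Con S .pair)) (a : Con S .pair → Expr S) (e : Expr S),
        Function.update a .pair e = fun _ => e := by
      intro _ a e
      funext c
      cases c
      simp
    have hb : ∀ z, @bindNames (Con.pair : Con S .pair).arity ![y + 1, k + 2] z =
        if z = y + 1 then 0 else if z = k + 2 then 1 else z + 2 := bindNames_two hne
    rw [hc]
    refine congrArg _ (congrArg _ (congrArg₂ _ (by simp [bindName]) (funext fun c => ?_)))
    cases c
    simp only [Expr.rename, Expr.rename_comp]
    rw [tauAux_rename_of_below (h := bindName y) (s' := stopVar + 4)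
      (r' := consName 1 fun z => chanVar z + 4) h]
    · simp [hb, upRen, chanVar, (show k + 1 ≠ y by omega)]
    · simp [bindName, upRen, hb, stopVar, chanVar, Con.arity]
    · intro z hz
      by_cases hzy : z = y
      · simp [bindName, upRen, hb, chanVar, consName, hzy, (show y ≠ k + 2 by omega)]
      · simp [bindName, upRen, hb, chanVar, consName, hzy, hz.ne, Con.arity,
          (show z ≠ k + 1 by omega), (show z ≠ k + 2 by omega)]
  | parL C Q ih =>
    have h := PiProc.Ctx.Below.plug hC.1 hP
    simp only [tauCtx, tau, Ctx.plug, ih hC.1, PiProc.Ctx.plug, tauAux]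
    rw [tauAux_rename_congr (s' := stopVar + 1) (r' := fun z => chanVar z + 1) h]
    · simp [bindName, stopVar]
    · intro z hz
      simp [bindName, chanVar, hz.ne]
  | parR Q C ih =>
    simp only [tauCtx, tau, Ctx.plug, ih hC.2, PiProc.Ctx.plug, tauAux]
    rw [tauAux_rename (s := stopVar) (r := chanVar) (h := id) (s' := stopVar + 1)
      (r' := fun z => chanVar z + 1) Q rfl fun _ => rfl, PiProc.rename_id]
  | nu x C ih =>
    have h := PiProc.Ctx.Below.plug hC.2 hP
    obtain ⟨hx, hC⟩ := hC
    simp only [tauCtx, Ctx.plug, ih hC, PiProc.Ctx.plug, PiProc.nuName, tauAux, Expr.rename,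
      Expr.rename_chan, Expr.rename_comp, bindNames_one]
    rw [tauAux_rename_of_below (h := bindName x) (s' := stopVar + 3)
      (r' := consName 0 fun z => chanVar z + 3) h]
    · simp [bindName, upRen, chanVar, hx.ne']
    · simp [bindName, upRen, stopVar, chanVar]
    · intro z hz
      by_cases hzx : z = x
      · simp [bindName, upRen, chanVar, hzx, consName]
      · simp [bindName, upRen, chanVar, hzx, consName, hz.ne, (show z ≠ k + 1 by omega)]
  | bang C ih =>
    have h := PiProc.Ctx.Below.plug (C := C) hC hP
    simp only [tauCtx, Ctx.plug, ih hC, PiProc.Ctx.plug, tauAux, bindNames_one]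
    congr 1
    · funext j
      obtain rfl := Subsingleton.elim j 0
      simp only [Function.update_self, Expr.rename]
      rw [tauAux_rename_congr (s' := stopVar + 1) (r' := fun z => chanVar z + 1) h]
      · simp [bindName, upRen]
      · simp [bindName, stopVar]
      · intro z hz
        simp [bindName, chanVar, hz.ne]
    · simp [bindName, Expr.rename]

/-! ### Typing of the translation -/

section Typing

variable {Γ : Env S} {e : Expr S}

/-- The type of the MVar of a channel. -/
abbrev chanTy (S : DataSig) : Ty S.toTySig := .mvar (Ty.pair Ty.channel (.mvar Ty.unit))

theorem hasTy_unit : HasTy Γ .unit Ty.unit := .con fun i => i.elim0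

theorem HasTy.pair {e₁ e₂ : Expr S} {t₁ t₂ : Ty S.toTySig} (h₁ : HasTy Γ e₁ t₁)
    (h₂ : HasTy Γ e₂ t₂) : HasTy Γ (.pair e₁ e₂) (Ty.pair t₁ t₂) := by
  refine .con fun i => ?_
  rcases i with ⟨_ | _ | i, hi⟩
  · exact h₁
  · exact h₂
  · exact absurd hi (by simp [Con.arity])

theorem HasTy.chan (h : HasTy Γ e (chanTy S)) : HasTy Γ (.chan e) Ty.channel := by
  refine .con fun i => ?_
  rcases i with ⟨_ | i, hi⟩
  · exact h
  · exact absurd hi (by simp [Con.arity])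

theorem HasTy.unchan (h : HasTy Γ e Ty.channel) : HasTy Γ (.unchan e) (chanTy S) := by
  refine .case h fun c => .var ?_
  cases c
  rfl

theorem hasTy_bot (t : Ty S.toTySig) : HasTy Γ .bot t :=
  .letrec (ts := ![t]) (fun i => .var (by obtain rfl := Subsingleton.elim i 0; rfl)) (.var rfl)

/-- The translation is well typed if `stop` is an MVar and all free names are channels. -/
theorem hasTy_tauAux {P : PiProc} : ∀ {k s : ℕ} {r : ℕ → ℕ} {Γ : Env S}, PiProc.Below k P →
    Γ s = some (.mvar Ty.unit) → (∀ x < k, Γ (r x) = some Ty.channel) →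
    HasTy Γ (tauAux s r P) (.io Ty.unit) := by
  induction P with
  | nu P ih =>
    intro k s r Γ hP hs hr
    refine .bind (.new (hasTy_bot (Ty.pair Ty.channel (.mvar Ty.unit))))
      (.lam (.bind (.take (.var rfl)) (.lam
      (.letrec (ts := ![Ty.channel]) (fun i => ?_) (ih (k := k + 1) hP hs ?_)))))
    · obtain rfl := Subsingleton.elim i 0
      exact .chan (.var rfl)
    · rintro (_ | x) hx
      · rfl
      · exact hr x (by omega)
  | out x y P ih =>
    intro k s r Γ hP hs hr
    exact .bind (.new hasTy_unit) (.lam (.bind (.put (.unchan (.var (hr x hP.1)))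
      (.pair (.var (hr y hP.2.1)) (.var rfl))) (.lam (.bind (.put (.var rfl) hasTy_unit) (.lam
      (ih hP.2.2 hs hr))))))
  | inp x P ih =>
    intro k s r Γ hP hs hr
    refine .bind (.take (.unchan (.var (hr x hP.1)))) (.lam (.case (.var rfl) fun c => ?_))
    cases c
    refine .bind (.take (.var rfl)) (.lam (ih (k := k + 1) hP.2 hs ?_))
    rintro (_ | x) hx
    · rfl
    · exact hr x (by omega)
  | bang P ih =>
    intro k s r Γ hP hs hr
    refine .letrec (ts := ![.io Ty.unit]) (fun i => ?_) (.var rfl)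
    obtain rfl := Subsingleton.elim i 0
    exact .bind (.fork (ih (k := k) hP hs hr)) (.lam (.var rfl))
  | par P Q ihP ihQ =>
    intro k s r Γ hP hs hr
    exact .bind (.fork (ihQ hP.2 hs hr)) (.lam (ihP hP.1 hs hr))
  | zero => intros; exact .ret hasTy_unit
  | success => intro k s r Γ hP hs hr; exact .take (.var hs)

/-- The environment types `stop` and the variables for the names below `k`. -/
def IsTauEnv (k : ℕ) (Γ : Env S) : Prop :=
  Γ stopVar = some (.mvar Ty.unit) ∧ ∀ x < k, Γ (chanVar x) = some Ty.channel

/-- The least environment which types `stop` and the variables for the names below `k`. -/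
def tauEnv (S : DataSig) (k : ℕ) : Env S := fun y =>
  if y = stopVar then some (.mvar Ty.unit) else if y ≤ k then some Ty.channel else none

theorem isTauEnv_tauEnv (k : ℕ) : IsTauEnv k (tauEnv S k) := by
  refine ⟨by simp [tauEnv], fun x hx => ?_⟩
  simp [tauEnv, chanVar, stopVar, Nat.succ_le_of_lt hx]

theorem IsTauEnv.of_tauEnv {k : ℕ} (h : IsTauEnv k Γ) {x : ℕ} {t : Ty S.toTySig}
    (hx : tauEnv S k x = some t) : Γ x = some t := by
  rcases x with _ | x
  · rw [← hx]
    exact h.1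
  · by_cases hk : x < k
    · rw [← hx]
      exact (h.2 x hk).trans ((isTauEnv_tauEnv k).2 x hk).symm
    · simp [tauEnv, stopVar, show ¬ x + 1 ≤ k by omega] at hx

theorem isTauEnv_stopEnv : IsTauEnv 0 (stopEnv : Env S) := ⟨by simp [stopEnv], by simp⟩

theorem IsTauEnv.update {k y : ℕ} (h : IsTauEnv k Γ) (hy : k < y) (t : Option (Ty S.toTySig)) :
    IsTauEnv k (Function.update Γ y t) := by
  refine ⟨?_, fun x hx => ?_⟩
  · rw [Function.update_of_ne (by simp only [stopVar]; omega)]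
    exact h.1
  · rw [Function.update_of_ne (by simp only [chanVar]; omega)]
    exact h.2 x hx

theorem Env.bindNames_one (Γ : Env S) (x : ℕ) (t : Ty S.toTySig) :
    Γ.bindNames ![x] ![t] = Function.update Γ x (some t) := by
  funext y
  by_cases h : y = x
  · simp [Env.bindNames, CH.bindNames_one, bindName, Env.ext, h]
  · simp [Env.bindNames, CH.bindNames_one, bindName, Env.ext, h]

theorem Env.bindNames_two (Γ : Env S) {x y : ℕ} (h : x ≠ y) (t u : Ty S.toTySig) :
    Γ.bindNames ![x, y] ![t, u] = Function.update (Function.update Γ x (some t)) y (some u) := by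
  funext z
  by_cases hx : z = x
  · simp [Env.bindNames, CH.bindNames_two h, Env.ext, hx, h]
  · by_cases hy : z = y
    · simp [Env.bindNames, CH.bindNames_two h, Env.ext, hy, h.symm]
    · simp [Env.bindNames, CH.bindNames_two h, Env.ext, hx, hy]

theorem IsTauEnv.bind_chan {j k x : ℕ} (h : IsTauEnv j Γ) (hk : ∀ z < k, z < j ∨ z = x) :
    IsTauEnv k (Function.update Γ (chanVar x) (some Ty.channel)) := by
  refine ⟨?_, fun z hz => ?_⟩
  · rw [Function.update_of_ne (by simp [stopVar, chanVar])]
    exact h.1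
  · by_cases hzx : z = x
    · rw [hzx, Function.update_self]
    · rw [Function.update_of_ne (by simpa [chanVar] using hzx)]
      exact h.2 z ((hk z hz).resolve_right hzx)

/-- Below the restriction of `x` the environment types one more name: the names below `j` are
known outside of it, those below `j'` inside. -/
theorem ctxTy_nu {Δ : Env S} {t t' : Ty S.toTySig} {j j' k x : ℕ} {C : PiProc.Ctx}
    (hΓ : IsTauEnv j Γ) (hj : j ≤ k) (hx : x < k) (hj' : ∀ z < j', z < j ∨ z = x)
    (hC : ∀ Γ, IsTauEnv j' Γ → CtxTy Δ t Γ (tauCtx S k C) (.io t')) :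
    CtxTy Δ t Γ (tauCtx S k (.nu x C)) (.io t') := by
  refine .bindR (.new (hasTy_bot (Ty.pair Ty.channel (.mvar Ty.unit)))) (.lam (.bindR
    (.take (.var (Function.update_self _ _ _))) (.lam (.letrecBody (ts := ![Ty.channel])
      (Function.injective_of_subsingleton _) (fun i => ?_) (hC _ ?_)))))
  · obtain rfl := Subsingleton.elim i 0
    refine .chan (.var ?_)
    rw [Env.bindNames_one, Function.update_of_ne (by simp only [chanVar]; omega),
      Function.update_of_ne (by omega), Function.update_self]
  · rw [Env.bindNames_one]
    exact ((hΓ.update (by omega) _).update (by omega) _).bind_chan hj'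

theorem ctxTy_tauCtx {k : ℕ} {C : PiProc.Ctx} : ∀ {Γ : Env S}, C.Below k → IsTauEnv k Γ →
    CtxTy (tauEnv S k) (.io Ty.unit) Γ (tauCtx S k C) (.io Ty.unit) := by
  induction C with
  | hole => intro Γ _ hΓ; exact .hole fun x t => hΓ.of_tauEnv
  | out x y C ih =>
    intro Γ hC hΓ
    have h₁ := hΓ.update (y := k + 1) (by omega) (some (.mvar Ty.unit))
    have h₂ := h₁.update (y := k + 2) (by omega) (some Ty.unit)
    refine .bindR (.new hasTy_unit) (.lam (.bindR (.put (.unchan (.var (h₁.2 x hC.1)))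
      (.pair (.var (h₁.2 y hC.2.1)) (.var (Function.update_self _ _ _)))) (.lam (.bindR
      (.put (.var ?_) hasTy_unit) (.lam (ih hC.2.2 (h₂.update (by omega) _)))))))
    rw [Function.update_of_ne (by omega), Function.update_self]
  | inp x y C ih =>
    intro Γ hC hΓ
    have h₁ := hΓ.update (y := k + 1) (by omega) (some (Ty.pair Ty.channel (.mvar Ty.unit)))
    have hne : chanVar y ≠ k + 2 := by
      have := hC.2.1
      simp only [chanVar]
      omega
    refine .bindR (.take (.unchan (.var (hΓ.2 x hC.1)))) (.lam (.caseAlt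
      (ts := ![Ty.channel, .mvar Ty.unit]) (injective_pair hne) (.var (Function.update_self _ _ _))
      (fun c hc => absurd (by cases c; rfl) hc) ?_))
    have h₂ := (h₁.bind_chan (x := y) fun z hz => .inl hz).update (y := k + 2) (by omega)
      (some (.mvar Ty.unit))
    have he := Env.bindNames_two (Function.update Γ (k + 1)
      (some (Ty.pair Ty.channel (.mvar Ty.unit)))) hne Ty.channel (.mvar Ty.unit)
    rw [← he] at h₂
    refine .bindR (t₁ := Ty.unit) (.take (.var ?_)) (.lam (ih hC.2.2 (h₂.update (by omega) _)))
    exact (congrFun he _).trans (Function.update_self _ _ _)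
  | parL C P ih =>
    intro Γ hC hΓ
    exact .bindR (.fork (hasTy_tauAux hC.2 hΓ.1 hΓ.2)) (.lam (ih hC.1 (hΓ.update (by omega) _)))
  | parR P C ih =>
    intro Γ hC hΓ
    refine .bindL (.fork (ih hC.2 hΓ)) (.lam ?_)
    rw [tau, tauAux_rename (s := stopVar) (r := chanVar) (h := id) (s' := stopVar + 1)
      (r' := fun z => chanVar z + 1) P rfl fun _ => rfl, PiProc.rename_id]
    exact hasTy_tauAux hC.1 hΓ.1 hΓ.2
  | bang C ih =>
    intro Γ hC hΓ
    refine .letrecRhs (ts := ![.io Ty.unit]) (Function.injective_of_subsingleton _)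
      (fun j hj => absurd (Subsingleton.elim j 0) hj) (.bindL (.fork (ih hC ?_)) (.lam (.var ?_)))
      (.var ?_)
    · rw [Env.bindNames_one]
      exact hΓ.update (by omega) _
    · exact congrFun (Env.bindNames_one Γ (k + 1) (.io Ty.unit)) _ |>.trans
        (Function.update_self _ _ _)
    · rw [Env.bindNames_one, Function.update_self]
  | nu x C ih =>
    intro Γ hC hΓ
    exact ctxTy_nu hΓ le_rfl hC.1 (fun z hz => .inl hz) fun Γ' hΓ' => ih hC.2 hΓ'

/-- After closing, at most `stop` is free in the translated context. -/
theorem ctxTy_close {k : ℕ} : ∀ {j : ℕ} {C : PiProc.Ctx}, j ≤ k →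
    (∀ Γ : Env S, IsTauEnv j Γ →
      CtxTy (tauEnv S k) (.io Ty.unit) Γ (tauCtx S k C) (.io Ty.unit)) →
    CtxTy (tauEnv S k) (.io Ty.unit) stopEnv (tauCtx S k (.close j C)) (.io Ty.unit)
  | 0, _, _, h => h _ isTauEnv_stopEnv
  | j + 1, C, hj, h => ctxTy_close (j := j) (C := .nu j C) (by omega) fun _ hΓ =>
      ctxTy_nu hΓ (by omega) (by omega) (fun _ _ => by omega) h

end Typing

end CH

theorem PiProc.Ctx.below_close_ctx {k : ℕ} : ∀ {j : ℕ} {C : PiProc.Ctx}, j ≤ k → C.Below k →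
    (Ctx.close j C).Below k
  | 0, _, _, h => h
  | j + 1, C, hj, h => below_close_ctx (j := j) (C := .nu j C) (by omega) ⟨by omega, h⟩

/-- The open translation `τ` from the pi-calculus into CH is adequate. -/
theorem mainTheorem2 (S : CH.DataSig) (P P' : PiProc)
    (h : CH.LeTau₀ (.io CH.Ty.unit) (CH.tau S P) (CH.tau S P')) : PiProc.CtxLe P P' := by
  -- The context `C` is closed by restricting all names below `k`, as the contexts of CH
  -- must not leave channel names free.
  have key : ∀ C : PiProc.Ctx, (PiProc.MayConv (C.plug P) → PiProc.MayConv (C.plug P')) ∧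
      (PiProc.ShouldConv (C.plug P) → PiProc.ShouldConv (C.plug P')) := by
    intro C
    obtain ⟨k₁, h₁⟩ := C.exists_below
    obtain ⟨k₂, h₂⟩ := PiProc.exists_below P
    obtain ⟨k₃, h₃⟩ := PiProc.exists_below P'
    obtain ⟨k, hC, hP, hP'⟩ : ∃ k, C.Below k ∧ P.Below k ∧ P'.Below k :=
      ⟨k₁ + k₂ + k₃, h₁.mono (by omega), h₂.mono (by omega), h₃.mono (by omega)⟩
    have ht : ∀ {Q : PiProc}, Q.Below k → CH.HasTy (CH.tauEnv S k) (CH.tau S Q) (.io CH.Ty.unit) :=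
      fun hQ => CH.hasTy_tauAux hQ (CH.isTauEnv_tauEnv k).1 (CH.isTauEnv_tauEnv k).2
    have hc := PiProc.Ctx.below_close_ctx (le_refl k) hC
    -- The hole is typed in the environment of all names that are in scope there.
    have := h (CH.tauEnv S k) (CH.tauCtx S k (.close k C)) (ht hP) (ht hP')
      (CH.ctxTy_close le_rfl fun _ hΓ => CH.ctxTy_tauCtx hC hΓ)
    rw [CH.tauCtx_plug hc hP, CH.tauCtx_plug hc hP'] at this
    obtain ⟨m, s⟩ := CH.conv₀_tau (S := S) (PiProc.Ctx.below_close (hC.plug hP))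
    obtain ⟨m', s'⟩ := CH.conv₀_tau (S := S) (PiProc.Ctx.below_close (hC.plug hP'))
    rwa [m, s, m', s', PiProc.Ctx.mayConv_close, PiProc.Ctx.mayConv_close,
      PiProc.Ctx.shouldConv_close, PiProc.Ctx.shouldConv_close] at this
  exact ⟨fun C => (key C).1, fun C => (key C).2⟩
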